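/- Let $n$ be a nonnegative integer. A signed permutation of degree $n$ is a bijection $\sigma$ of $\{\pm1,\dots,\pm n\}$ with $\sigma(-i)=-\sigma(i)$, and $\mathcal D_n$ is the group of those with an even number of negative entries among $\sigma(1),\dots,\sigma(n)$. It acts on $\mathbb R^n$ by $e_i\mapsto e_{\sigma(i)}$, where $e_{-i}=-e_i$, and is the Weyl group of the root system $\Phi=\{\pm(e_i\pm e_j): 1\le i<j\le n\}$ with simple roots $e_1+e_2$ and $e_{i+1}-e_i$ ($1\le i\le n-1$); the corresponding generators are $s_0=(1,\overline 2)(2,\overline 1)$ and $s_i=(i,i+1)(\overline{i},\overline{i+1})$, where $\overline{k}=-k$. For $\sigma\in\mathcal D_n$ let $\ell(\sigma)$ be the number of positive roots that $\sigma$ sends to negative roots, and let $L(\sigma)$ be the number of those among them whose height is odd. For $I\subseteq[0,n-1]$ put $$\mathcal D_n^I=\{\sigma\in\mathcal D_n : \ell(\sigma s_i)>\ell(\sigma)\text{ for all } i\in I\},\qquad \mathcal D_n^I(x)=\sum_{\sigma\in\mathcal D_n^I}(-1)^{\ell(\sigma)}x^{L(\sigma)}\in\mathbb Z[x].$$ Let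 $I_0,I_1,\dots,I_s$ be the connected components (maximal intervals) of $I$ in increasing order, where $I_0$ is the one containing $0$ ($I_0=\emptyset$ if $0\notin I$), and put $m_I=\sum_{k=0}^s\lfloor(|I_k|+1)/2\rfloor$. Put $a_k=|I_0|+\sum_{i=1}^k 2\lfloor(|I_i|+1)/2\rfloor$ for $0\le k\le s$ and $$C(I)=[0,a_0-1]\cup[a_0+1,a_1-1]\cup\cdots\cup[a_{s-1}+1,a_s-1].$$ A subset of $[0,N-1]$ is called compressed if it has the form $[0,c_0-1]\cup[c_0+1,c_1-1]\cup\cdots\cup[c_{t-1}+1,c_t-1]$ with integers $0\le c_0<c_1<\dots<c_t\le N$ that all have the same parity. Empty products are $1$. Let $I\subseteq[0,n-1]$ with $|I_0|\ge 2$. (1) If $|I_0|$ is odd and $J=C(I)$, then $2m_J-1\le n$, $J$ is a compressed subset of $[0,2m_J-2]$, and $$\mathcal D_n^I(x)=\mathcal D_{2m_J-1}^{J}(x)\prod_{j=2m_J}^n\left(1+(-1)^{j-1}x^{\lfloor j/2\rfloor}\right)^2.$$ (2) If $|I_0|$ is even, $a_s\le n-1$, and $J=[0,a_0]\cup[a_0+2,a_1]\cup\cdots\cup[a_{s-1}+2,a_s]$,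 then $2m_J-1\le n$, $J$ is a compressed subset of $[0,2m_J-2]$, and $$\mathcal D_n^I(x)=(1+x^{a_0})\,\mathcal D_{2m_J-1}^{J}(x)\prod_{j=2m_J}^n\left(1+(-1)^{j-1}x^{\lfloor j/2\rfloor}\right)^2.$$ -/

import Mathlib

open scoped Polynomial

namespace TypeD

/-- The set `𝓓_n` of even signed permutations of degree `n`. A signed permutation, a bijection of
`{±1, …, ±n}` with `σ (-k) = -σ k`, is extended to `ℤ` by the identity. The one-line notation of
`σ` is `σ 1, σ 2, …, σ n`. -/
def evenSignedPerms (n : ℕ) : Set (Equiv.Perm ℤ) :=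
  {σ | (∀ k : ℤ, ¬ |k| ≤ n → σ k = k) ∧ (∀ k : ℤ, σ (-k) = -σ k) ∧
    Even (((Finset.Icc (1 : ℤ) n).filter (fun i => σ i < 0)).card)}

theorem evenSignedPerms_finite (n : ℕ) : (evenSignedPerms n).Finite := by
  have h : Finite {k : ℤ // |k| ≤ (n : ℤ)} :=
    ((Set.finite_Icc (-(n : ℤ)) n).subset fun k hk => abs_le.mp hk).to_subtype
  have h2 : Finite {σ : Equiv.Perm ℤ // ∀ k : ℤ, ¬ |k| ≤ (n : ℤ) → σ k = k} :=
    Finite.of_equiv _ (Equiv.Perm.subtypeEquivSubtypePerm fun k : ℤ => |k| ≤ (n : ℤ))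
  have h3 : {σ : Equiv.Perm ℤ | ∀ k : ℤ, ¬ |k| ≤ (n : ℤ) → σ k = k}.Finite :=
    @Set.toFinite _ _ h2
  exact h3.subset fun σ hσ => hσ.1

/-- The Coxeter generators: `s_0 = (1, -2)(2, -1)` and `s_i = (i, i+1)(-i, -(i+1))` for `i ≥ 1`. -/
def gen : ℕ → Equiv.Perm ℤ
  | 0 => Equiv.swap 1 (-2) * Equiv.swap 2 (-1)
  | i + 1 => Equiv.swap ((i : ℤ) + 1) (i + 2) * Equiv.swap (-((i : ℤ) + 1)) (-(i + 2))

/-- For `1 ≤ k ≤ n` the standard basis vector `e_k` (the coordinates `1, …, n` are indexed by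
`Fin n`, shifted by one), and `e_{-k} = -e_k`. -/
def e (n : ℕ) (k : ℤ) : Fin n → ℤ :=
  fun j => if k = (j : ℤ) + 1 then 1 else if k = -((j : ℤ) + 1) then -1 else 0

/-- The linear action of a signed permutation: `e_i ↦ e_{σ(i)}`. -/
def act (n : ℕ) (σ : Equiv.Perm ℤ) (v : Fin n → ℤ) : Fin n → ℤ :=
  ∑ i : Fin n, v i • e n (σ ((i : ℤ) + 1))

/-- The root system `{±(e_i ± e_j) | 1 ≤ i < j ≤ n}`. -/
def roots (n : ℕ) : Set (Fin n → ℤ) :=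
  {α | ∃ i j : ℤ, 1 ≤ i ∧ i < j ∧ j ≤ n ∧
    (α = e n i + e n j ∨ α = e n i - e n j ∨ α = -(e n i + e n j) ∨ α = -(e n i - e n j))}

/-- The simple roots `e_1 + e_2` (index `0`) and `e_{i+1} - e_i` (index `i ∈ {1, …, n-1}`). -/
def simpleRoot (n : ℕ) (i : Fin n) : Fin n → ℤ :=
  if (i : ℕ) = 0 then e n 1 + e n 2 else e n ((i : ℤ) + 1) - e n (i : ℤ)

/-- The positive roots: roots that are nonnegative combinations of simple roots. -/
def posRoots (n : ℕ) : Set (Fin n → ℤ) :=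
  {α ∈ roots n | ∃ c : Fin n → ℕ, α = ∑ i, (c i : ℤ) • simpleRoot n i}

/-- The height of `α` is `h`. -/
def HasHeight (n : ℕ) (α : Fin n → ℤ) (h : ℤ) : Prop :=
  ∃ c : Fin n → ℤ, α = ∑ i, c i • simpleRoot n i ∧ h = ∑ i, c i

/-- The Coxeter length: the number of positive roots sent to negative roots. -/
noncomputable def length (n : ℕ) (σ : Equiv.Perm ℤ) : ℕ :=
  {α ∈ posRoots n | -(act n σ α) ∈ posRoots n}.ncard

/-- The odd length: the number of positive roots of odd height sent to negative roots. -/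
noncomputable def oddLength (n : ℕ) (σ : Equiv.Perm ℤ) : ℕ :=
  {α ∈ posRoots n | (∃ h : ℤ, HasHeight n α h ∧ Odd h) ∧ -(act n σ α) ∈ posRoots n}.ncard

/-- The parabolic quotient `𝓓_n^I`. -/
def quotient (n : ℕ) (I : Finset ℕ) : Set (Equiv.Perm ℤ) :=
  {σ ∈ evenSignedPerms n | ∀ i ∈ I, length n σ < length n (σ * gen i)}

theorem quotient_finite (n : ℕ) (I : Finset ℕ) : (quotient n I).Finite :=
  (evenSignedPerms_finite n).subset fun _ hσ => hσ.1

/-- The sign-twisted generating function `𝓓_n^I(x)` of the odd length over `𝓓_n^I`. -/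
noncomputable def genFun (n : ℕ) (I : Finset ℕ) : ℤ[X] :=
  ∑ σ ∈ (quotient_finite n I).toFinset,
    (-1 : ℤ[X]) ^ length n σ * (Polynomial.X : ℤ[X]) ^ oddLength n σ

/-- The maximal interval of `I` starting at `a` (empty if `a ∉ I`). -/
def runFrom (I : Finset ℕ) (a : ℕ) : Finset ℕ :=
  I.filter (fun j => a ≤ j ∧ Finset.Icc a j ⊆ I)

/-- The least elements of the connected components of `I` other than `I_0`. -/
def starts (I : Finset ℕ) : Finset ℕ :=
  I.filter (fun a => a ≠ 0 ∧ a - 1 ∉ I)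

/-- The number `s` of connected components of `I` other than `I_0`. -/
def numComponents (I : Finset ℕ) : ℕ := (starts I).card

/-- The connected components `I_0, I_1, …, I_s` of `I` in increasing order, where `I_0` is the
one containing `0` (empty if `0 ∉ I`). Only indices `k ≤ s` are meaningful. -/
noncomputable def component (I : Finset ℕ) : ℕ → Finset ℕ
  | 0 => runFrom I 0
  | k + 1 => runFrom I (Nat.nth (fun a => a ∈ starts I) k)

/-- `m_I = ∑_{k=0}^s ⌊(|I_k| + 1) / 2⌋`. -/
noncomputable def m (I : Finset ℕ) : ℕ :=
  ∑ k ∈ Finset.range (numComponents I + 1), ((component I k).card + 1) / 2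

/-- `b_k = |I_0| + ∑_{i=1}^k 2 ⌊(|I_i| + 1) / 2⌋`, for `0 ≤ k ≤ s`. -/
noncomputable def b (I : Finset ℕ) (k : ℕ) : ℕ :=
  (component I 0).card + ∑ i ∈ Finset.Icc 1 k, 2 * (((component I i).card + 1) / 2)

/-- The set `[0, a_0 - 1] ∪ [a_0 + 1, a_1 - 1] ∪ ⋯ ∪ [a_{s-1} + 1, a_s - 1]`. -/
def blocks (s : ℕ) (a : ℕ → ℕ) : Finset ℕ :=
  Finset.Ico 0 (a 0) ∪ (Finset.Icc 1 s).biUnion (fun k => Finset.Ico (a (k - 1) + 1) (a k))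

/-- `I` is a compressed subset of `[0, n-1]`. -/
def IsCompressed (n : ℕ) (I : Finset ℕ) : Prop :=
  ∃ (s : ℕ) (a : ℕ → ℕ), (∀ k < s, a k < a (k + 1)) ∧ a s ≤ n ∧
    (∀ k ≤ s, a k ≡ a 0 [MOD 2]) ∧ I = blocks s a

/-- The compressed set `C(I) = [0, b_0 - 1] ∪ [b_0 + 1, b_1 - 1] ∪ ⋯ ∪ [b_{s-1} + 1, b_s - 1]`. -/
noncomputable def compress (I : Finset ℕ) : Finset ℕ :=
  blocks (numComponents I) (b I)

/-- The set `[0, b_0] ∪ [b_0 + 2, b_1] ∪ ⋯ ∪ [b_{s-1} + 2, b_s]`. -/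
noncomputable def shiftedCompress (I : Finset ℕ) : Finset ℕ :=
  Finset.Icc 0 (b I 0) ∪
    (Finset.Icc 1 (numComponents I)).biUnion (fun k => Finset.Icc (b I (k - 1) + 2) (b I k))

end TypeD

/-! A permutation in `D n` is read as the word of its entries at positions 1, ..., n. The positive
roots are e_j - e_i with i ≠ 0 and |i| < j, so the length is a sum of `pairInv` over pairs of
positions, the odd length is the same sum over pairs at odd distance, and i ∈ I demands an ascent at
i. Thus `genFun n I` becomes the sum `F n I` of signed weights over words with prescribed ascents
(`genFun_eq_F`).

Most of the sum cancels. The parity of the length depends only on the order of the absolute values,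
so exchanging two of them changes the sign of the weight. If their positions have the same parity
and no intermediate entry separates them, the odd length does not change. Applied to an increasing
block with an even number of entries and a free neighbouring position, this gives `F_append` and
`F_prepend`: the free position may be joined to the block on either side. Joining on one side and
releasing on the other moves a block, and releasing its last ascent normalises a component of even
size, so I may be replaced by its compression (`F_compress`). If |I_0| is even, a free position at
the end travels to the front past all later blocks (`F_blocks_even`). Joining it to the first block
costs the factor 1 + X^{a_0}: the last entry of the enlarged block may have either sign
(`F_join_first`).

The remaining free positions stand at the end and are added one at a time. The contribution of a
last entry ±(j+1) depends only on the set of values in even positions. In odd degree, exchanging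
adjacent values in positions of the same parity cancels all words except those with the even values
in the even positions (`sum_wt_evenVals`), and the sum over j then telescopes. The step into odd
degree is obtained by inserting two entries at once (`F_succ_succ_of_odd`). For a compressed set
with odd first block the last a_s is odd and equals 2m - 1, so the product starts at j = 2m. -/

namespace TypeD

/-! ### Roots, heights and the two lengths in terms of index pairs. -/

/-- The index pairs `(i, j)` of the positive roots `e_j - e_i`, where `e_{-k} = -e_k`. -/
def IsPosPair (n : ℕ) (i j : ℤ) : Prop := i ≠ 0 ∧ |i| < j ∧ j ≤ n

theorem e_neg (n : ℕ) {k : ℤ} (hk : k ≠ 0) : e n (-k) = -e n k := by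
  funext j
  simp only [e, Pi.neg_apply]
  split_ifs <;> omega

/-- The action and the height are both of the form v ↦ ∑ v_i g(i + 1). This evaluation serves both,
with g = e ∘ σ and g(t) = t - 1. -/
theorem e_sum_mul {n : ℕ} {k : ℤ} (h1 : 1 ≤ k) (h2 : k ≤ n) {M : Type*} [AddCommGroup M]
    (g : ℤ → M) : ∑ i : Fin n, e n k i • g ((i : ℤ) + 1) = g k := by
  have hk : (k - 1).toNat < n := by omega
  rw [Finset.sum_eq_single (⟨(k - 1).toNat, hk⟩ : Fin n)]
  · have : (((k - 1).toNat : ℕ) : ℤ) + 1 = k := by omega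
    simp only [e, this, if_true, one_smul]
  · intro i _ hi
    have hi' : (i : ℕ) ≠ (k - 1).toNat := fun h => hi (Fin.ext h)
    have : e n k i = 0 := by
      simp only [e]
      split_ifs <;> omega
    simp [this]
  · simp

theorem act_sub (n : ℕ) (σ : Equiv.Perm ℤ) (v w : Fin n → ℤ) :
    act n σ (v - w) = act n σ v - act n σ w := by
  simp [act, sub_smul, Finset.sum_sub_distrib]

theorem act_neg (n : ℕ) (σ : Equiv.Perm ℤ) (v : Fin n → ℤ) :
    act n σ (-v) = -act n σ v := by
  simp [act]

theorem act_e {n : ℕ} {σ : Equiv.Perm ℤ} (hσ : ∀ k, σ (-k) = -σ k) {k : ℤ} (h0 : k ≠ 0)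
    (h : |k| ≤ n) : act n σ (e n k) = e n (σ k) := by
  have key : ∀ k : ℤ, 1 ≤ k → k ≤ n → act n σ (e n k) = e n (σ k) := fun k h1 h2 =>
    e_sum_mul h1 h2 (fun t => e n (σ t))
  have hs0 : σ 0 = 0 := by have := hσ 0; simp at this; omega
  rcases lt_or_gt_of_ne h0 with hk | hk
  · rw [abs_of_neg hk] at h
    have h1 := key (-k) (by omega) h
    have h3 : σ k ≠ 0 := fun h => h0 (σ.injective (h.trans hs0.symm))
    rw [hσ, e_neg n h0, e_neg n h3, act_neg] at h1
    exact neg_injective h1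
  · rw [abs_of_pos hk] at h
    exact key k (by omega) h

/-- The height as a linear functional. -/
def ht (n : ℕ) (v : Fin n → ℤ) : ℤ := ∑ i : Fin n, v i • (((i : ℤ) + 1) - 1)

theorem ht_sub (n : ℕ) (v w : Fin n → ℤ) : ht n (v - w) = ht n v - ht n w := by
  simp [ht, sub_mul, Finset.sum_sub_distrib]

theorem ht_neg (n : ℕ) (v : Fin n → ℤ) : ht n (-v) = - ht n v := by
  simp [ht]

theorem ht_e {n : ℕ} {k : ℤ} (h1 : 1 ≤ k) (h2 : k ≤ n) : ht n (e n k) = k - 1 :=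
  e_sum_mul h1 h2 (fun t => t - 1)

theorem ht_e_neg {n : ℕ} {k : ℤ} (h1 : k ≤ -1) (h2 : -k ≤ n) : ht n (e n k) = k + 1 := by
  have h := ht_e (n := n) (k := -k) (by omega) h2
  rw [e_neg n (by omega), ht_neg] at h
  omega

/-- The weight k - 1 on e_k is chosen so that all simple roots have value 1. For n = 1 this fails:
e_2 vanishes and the only simple root gets the value 0. -/
theorem ht_simpleRoot {n : ℕ} (hn : 2 ≤ n) (i : Fin n) : ht n (simpleRoot n i) = 1 := by
  have hi := i.2
  unfold simpleRoot
  split_ifs with h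
  · rw [← sub_neg_eq_add, ht_sub, ht_neg, ht_e (by omega) (by omega), ht_e (by omega) (by omega)]
    norm_num
  · rw [ht_sub, ht_e (by omega) (by omega), ht_e (by omega) (by omega)]
    ring

theorem ht_sum {n : ℕ} (hn : 2 ≤ n) (c : Fin n → ℤ) :
    ht n (∑ i, c i • simpleRoot n i) = ∑ i, c i := by
  have h : ht n (∑ i, c i • simpleRoot n i) = ∑ i, c i * ht n (simpleRoot n i) := by
    simp only [ht, Finset.sum_apply, Pi.smul_apply, smul_eq_mul, Finset.sum_mul, Finset.mul_sum]
    rw [Finset.sum_comm]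
    exact Finset.sum_congr rfl fun _ _ => Finset.sum_congr rfl fun _ _ => by ring
  rw [h]
  simp only [ht_simpleRoot hn, mul_one]

theorem IsPosPair.two_le {n : ℕ} {i j : ℤ} (h : IsPosPair n i j) : 2 ≤ n := by
  obtain ⟨h0, h1, h2⟩ := h
  have : 0 < |i| := abs_pos.mpr h0
  omega

theorem IsPosPair.ht_eq {n : ℕ} {i j : ℤ} (h : IsPosPair n i j) :
    ht n (e n j - e n i) = if 0 < i then j - i else j - i - 2 := by
  obtain ⟨h0, h1, h2⟩ := h
  rw [abs_lt] at h1
  rw [ht_sub, ht_e (by omega) (by omega)]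
  split_ifs with hi
  · rw [ht_e (by omega) (by omega)]; ring
  · rw [ht_e_neg (by omega) (by omega)]; ring

theorem IsPosPair.ht_pos {n : ℕ} {i j : ℤ} (h : IsPosPair n i j) :
    0 < ht n (e n j - e n i) := by
  rw [h.ht_eq]
  obtain ⟨h0, h1, h2⟩ := h
  rw [abs_lt] at h1
  split_ifs <;> omega

theorem simpleRoot_mem {n : ℕ} (k : ℕ) (h1 : 1 ≤ k) (hk : k < n) :
    e n ((k : ℤ) + 1) - e n (k : ℤ) ∈ Submodule.span ℕ (Set.range (simpleRoot n)) := by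
  apply Submodule.subset_span
  refine ⟨⟨k, hk⟩, ?_⟩
  simp [simpleRoot, show k ≠ 0 by omega]

theorem sub_mem_span {n : ℕ} (i : ℕ) (h1 : 1 ≤ i) (d : ℕ) (hd : i + d ≤ n) :
    e n ((i + d : ℕ) : ℤ) - e n (i : ℤ) ∈ Submodule.span ℕ (Set.range (simpleRoot n)) := by
  induction d with
  | zero => simp
  | succ d ih =>
    have h := Submodule.add_mem _ (simpleRoot_mem (n := n) (i + d) (by omega) (by omega))
      (ih (by omega))
    rw [sub_add_sub_cancel] at h
    exact_mod_cast h

/-- For i < 0 the root is (e_{-i} - e_1) + (e_j - e_2) + (e_1 + e_2), where j ≥ 2 because j > |i|.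
-/
theorem IsPosPair.mem_span {n : ℕ} {i j : ℤ} (h : IsPosPair n i j) :
    e n j - e n i ∈ Submodule.span ℕ (Set.range (simpleRoot n)) := by
  have hn := h.two_le
  obtain ⟨h0, h1, h2⟩ := h
  rw [abs_lt] at h1
  rcases lt_or_gt_of_ne h0 with hi | hi
  · have a1 := sub_mem_span (n := n) 1 le_rfl ((-i).toNat - 1) (by omega)
    have a2 := sub_mem_span (n := n) 2 (by omega) (j.toNat - 2) (by omega)
    have a3 : e n 1 + e n 2 ∈ Submodule.span ℕ (Set.range (simpleRoot n)) :=
      Submodule.subset_span ⟨⟨0, by omega⟩, by simp [simpleRoot]⟩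
    have h := Submodule.add_mem _ a1 (Submodule.add_mem _ a2 a3)
    rw [show ((1 + ((-i).toNat - 1) : ℕ) : ℤ) = -i by omega,
      show ((2 + (j.toNat - 2) : ℕ) : ℤ) = j by omega, e_neg n h0] at h
    convert h using 1
    push_cast
    abel
  · have a1 := sub_mem_span (n := n) i.toNat (by omega) (j - i).toNat (by omega)
    rwa [show ((i.toNat + (j - i).toNat : ℕ) : ℤ) = j by omega,
      show ((i.toNat : ℕ) : ℤ) = i by omega] at a1

theorem IsPosPair.mem_roots {n : ℕ} {i j : ℤ} (h : IsPosPair n i j) :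
    e n j - e n i ∈ roots n := by
  obtain ⟨h0, h1, h2⟩ := h
  rw [abs_lt] at h1
  rcases lt_or_gt_of_ne h0 with hi | hi
  · refine ⟨-i, j, by omega, by omega, h2, Or.inl ?_⟩
    rw [e_neg n h0]; abel
  · refine ⟨i, j, by omega, by omega, h2, Or.inr (Or.inr (Or.inr ?_))⟩
    abel

theorem IsPosPair.mem_posRoots {n : ℕ} {i j : ℤ} (h : IsPosPair n i j) :
    e n j - e n i ∈ posRoots n := by
  refine ⟨h.mem_roots, ?_⟩
  obtain ⟨c, hc⟩ := (Submodule.mem_span_range_iff_exists_fun ℕ).mp h.mem_span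
  exact ⟨c, by simp [← hc]⟩

theorem exists_isPosPair {n : ℕ} {α : Fin n → ℤ} (h : α ∈ roots n) :
    ∃ i j, IsPosPair n i j ∧ (α = e n j - e n i ∨ α = -(e n j - e n i)) := by
  obtain ⟨i, j, h1, h2, h3, h⟩ := h
  have p1 : IsPosPair n i j := ⟨by omega, by rw [abs_lt]; omega, h3⟩
  have p2 : IsPosPair n (-i) j := ⟨by omega, by rw [abs_lt]; omega, h3⟩
  have hi : i ≠ 0 := by omega
  rcases h with h | h | h | h
  · exact ⟨-i, j, p2, Or.inl (by rw [h, e_neg n hi]; abel)⟩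
  · exact ⟨i, j, p1, Or.inr (by rw [h]; abel)⟩
  · exact ⟨-i, j, p2, Or.inr (by rw [h, e_neg n hi]; abel)⟩
  · exact ⟨i, j, p1, Or.inl (by rw [h]; abel)⟩

/-- A nonnegative combination of simple roots has nonnegative height, whereas this vector has
negative height. -/
theorem IsPosPair.neg_notMem_posRoots {n : ℕ} {i j : ℤ} (h : IsPosPair n i j) :
    -(e n j - e n i) ∉ posRoots n := by
  rintro ⟨-, c, hc⟩
  have h1 := h.ht_pos
  have h2 := congrArg (ht n) hc
  rw [ht_sum h.two_le (fun i => (c i : ℤ)), ht_neg] at h2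
  have h3 : 0 ≤ ∑ i, (c i : ℤ) := Finset.sum_nonneg fun _ _ => by positivity
  omega

theorem mem_posRoots_iff {n : ℕ} {α : Fin n → ℤ} :
    α ∈ posRoots n ↔ ∃ i j, IsPosPair n i j ∧ α = e n j - e n i := by
  constructor
  · intro h
    obtain ⟨i, j, hp, h1 | h1⟩ := exists_isPosPair h.1
    · exact ⟨i, j, hp, h1⟩
    · exact absurd (h1 ▸ h) hp.neg_notMem_posRoots
  · rintro ⟨i, j, hp, rfl⟩
    exact hp.mem_posRoots

/-- The height is unique by `ht_sum`. Its two formulas, j - i and j - i - 2, have the same parity,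
so the sign of i is irrelevant. -/
theorem IsPosPair.hasHeight_odd {n : ℕ} {i j : ℤ} (h : IsPosPair n i j) :
    (∃ k : ℤ, HasHeight n (e n j - e n i) k ∧ Odd k) ↔ Odd (j - i) := by
  have hodd : Odd (ht n (e n j - e n i)) ↔ Odd (j - i) := by
    rw [h.ht_eq]
    split_ifs
    · rfl
    · simp [Int.odd_sub]
  rw [← hodd]
  constructor
  · rintro ⟨k, ⟨c, hc, rfl⟩, hk⟩
    rwa [hc, ht_sum h.two_le]
  · intro hk
    obtain ⟨-, c, hc⟩ := h.mem_posRoots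
    refine ⟨_, ⟨fun i => (c i : ℤ), hc, rfl⟩, ?_⟩
    rwa [hc, ht_sum h.two_le] at hk

/-- The index of larger absolute value decides. The case |a| < |b| reduces to the other one by e_a -
e_b = e_{-b} - e_{-a}. -/
theorem e_sub_e_mem_posRoots {n : ℕ} {a b : ℤ} (ha : a ≠ 0) (hb : b ≠ 0) (ha' : |a| ≤ n)
    (hb' : |b| ≤ n) (hab : |a| ≠ |b|) : e n a - e n b ∈ posRoots n ↔ b < a := by
  have hpos : ∀ a b : ℤ, b ≠ 0 → |a| ≤ n → |b| < a → e n a - e n b ∈ posRoots n :=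
    fun a b h0 h1 h2 => IsPosPair.mem_posRoots ⟨h0, h2, le_trans (le_abs_self _) h1⟩
  have hneg : ∀ a b : ℤ, b ≠ 0 → |a| ≤ n → |b| < a → e n b - e n a ∉ posRoots n := by
    intro a b h0 h1 h2
    have := IsPosPair.neg_notMem_posRoots (n := n) (i := b) (j := a)
      ⟨h0, h2, le_trans (le_abs_self _) h1⟩
    rwa [neg_sub] at this
  have hflip : e n a - e n b = e n (-b) - e n (-a) := by
    rw [e_neg n ha, e_neg n hb]; abel
  rcases lt_or_gt_of_ne hab with h | h
  · rcases lt_or_gt_of_ne hb with hb0 | hb0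
    · rw [abs_of_neg hb0] at h
      have := hpos (-b) (-a) (by omega) (by rwa [abs_neg]) (by rwa [abs_neg])
      rw [abs_lt] at h
      exact ⟨fun _ => by omega, fun _ => hflip ▸ this⟩
    · rw [abs_of_pos hb0] at h
      have := hneg b a ha hb' h
      rw [abs_lt] at h
      exact ⟨fun h => absurd h this, fun _ => by omega⟩
  · rcases lt_or_gt_of_ne ha with ha0 | ha0
    · rw [abs_of_neg ha0] at h
      have := hneg (-a) (-b) (by omega) (by rwa [abs_neg]) (by rwa [abs_neg])
      rw [abs_lt] at h
      exact ⟨fun h => absurd (hflip ▸ h) this, fun _ => by omega⟩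
    · rw [abs_of_pos ha0] at h
      have := hpos a b hb ha' h
      rw [abs_lt] at h
      exact ⟨fun _ => by omega, fun _ => this⟩

theorem IsPosPair.e_apply {n : ℕ} {i j : ℤ} (h : IsPosPair n i j) (t : Fin n) :
    (e n j - e n i) t = (if j = t + 1 then 1 else 0) +
      (if i = t + 1 then -1 else if i = -(t + 1) then 1 else 0) := by
  obtain ⟨h0, h1, h2⟩ := h
  rw [abs_lt] at h1
  simp only [e, Pi.sub_apply]
  split_ifs <;> omega

/-- The index j is the last coordinate at which its root is nonzero, so reading off coordinate
max(j, j') gives j = j'. Coordinate |i| then determines i. -/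
theorem IsPosPair.eq_of_eq {n : ℕ} {i j i' j' : ℤ} (h : IsPosPair n i j)
    (h' : IsPosPair n i' j') (heq : e n j - e n i = e n j' - e n i') : i = i' ∧ j = j' := by
  have key : ∀ t : ℕ, t < n → (if j = t + 1 then (1 : ℤ) else 0) +
      (if i = t + 1 then -1 else if i = -(t + 1) then 1 else 0) =
      (if j' = t + 1 then 1 else 0) +
      (if i' = t + 1 then -1 else if i' = -(t + 1) then 1 else 0) := by
    intro t ht
    have := congrFun heq ⟨t, ht⟩
    rwa [h.e_apply, h'.e_apply] at this
  obtain ⟨h0, h1, h2⟩ := h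
  obtain ⟨h0', h1', h2'⟩ := h'
  rw [abs_lt] at h1 h1'
  have hj : j = j' := by
    rcases lt_trichotomy j j' with h | h | h
    · have k := key (j' - 1).toNat (by omega)
      rw [show (((j' - 1).toNat : ℕ) : ℤ) = j' - 1 by omega, if_neg (by omega), if_neg (by omega),
        if_neg (by omega), if_pos (by omega), if_neg (by omega), if_neg (by omega)] at k
      omega
    · exact h
    · have k := key (j - 1).toNat (by omega)
      rw [show (((j - 1).toNat : ℕ) : ℤ) = j - 1 by omega, if_pos (by omega), if_neg (by omega),
        if_neg (by omega), if_neg (by omega), if_neg (by omega), if_neg (by omega)] at k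
      omega
  refine ⟨?_, hj⟩
  subst hj
  rcases lt_or_gt_of_ne h0 with h | h
  · have k := key (-i - 1).toNat (by omega)
    rw [show (((-i - 1).toNat : ℕ) : ℤ) = -i - 1 by omega, if_neg (by omega), if_neg (by omega),
      if_pos (by omega)] at k
    by_contra hne
    rw [if_neg (c := i' = -_) (by omega)] at k
    split_ifs at k <;> omega
  · have k := key (i - 1).toNat (by omega)
    rw [show (((i - 1).toNat : ℕ) : ℤ) = i - 1 by omega, if_neg (by omega),
      if_pos (by omega)] at k
    by_contra hne
    rw [if_neg (c := i' = _ - _ + _) (by omega)] at k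
    split_ifs at k <;> omega

/-- The number of positive roots among `e_v - e_u` and `e_v + e_u` that are negative. -/
def pairInv (u v : ℤ) : ℕ := (if v < u then 1 else 0) + (if v < -u then 1 else 0)

/-- Sum over the pairs `1 ≤ i < j ≤ n`. -/
noncomputable def pairSum (n : ℕ) (h : ℤ → ℤ → ℕ) : ℕ :=
  ∑ j ∈ Finset.Icc (1 : ℤ) n, ∑ i ∈ Finset.Ico 1 j, h i j

/-- The length of the word `f 1, …, f n`. -/
noncomputable def len (n : ℕ) (f : ℤ → ℤ) : ℕ := pairSum n fun i j => pairInv (f i) (f j)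

/-- The odd length of the word `f 1, …, f n`. -/
noncomputable def oddLen (n : ℕ) (f : ℤ → ℤ) : ℕ :=
  pairSum n fun i j => if Odd (j - i) then pairInv (f i) (f j) else 0

/-- The pairs (i, j) and (-i, j) with 1 ≤ i < j are counted together as the two summands of
`pairInv`; `hr2` says that r treats them alike. -/
theorem ncard_posPairs (n : ℕ) (σ : ℤ → ℤ) (hσ : ∀ k, σ (-k) = -σ k) (r : ℤ → Prop)
    [DecidablePred r] (hr2 : ∀ i j, r (j + i) ↔ r (j - i)) :
    {x : ℤ × ℤ | IsPosPair n x.1 x.2 ∧ r (x.2 - x.1) ∧ σ x.2 < σ x.1}.ncard =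
      pairSum n fun i j => if r (j - i) then pairInv (σ i) (σ j) else 0 := by
  have h1 : {x : ℤ × ℤ | IsPosPair n x.1 x.2 ∧ r (x.2 - x.1) ∧ σ x.2 < σ x.1} =
      (((Finset.Icc (1 : ℤ) n).sigma fun j => ((Finset.Ico 1 j).disjUnion
        ((Finset.Ico 1 j).map (Equiv.neg ℤ).toEmbedding) (by
          rw [Finset.disjoint_left]
          simp only [Finset.mem_Ico, Finset.mem_map_equiv, Equiv.neg_symm, Equiv.neg_apply]
          omega)).filter fun i => r (j - i) ∧ σ j < σ i).map
        ⟨fun x : (_ : ℤ) × ℤ => (x.2, x.1), by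
          rintro ⟨a, b⟩ ⟨c, d⟩ h
          simp only [Prod.mk.injEq] at h
          simp [h.1, h.2]⟩ : Finset (ℤ × ℤ)) := by
    ext ⟨i, j⟩
    simp only [IsPosPair, Set.mem_ofPred_eq, Finset.coe_map, Set.mem_image, Finset.mem_coe, Finset.mem_sigma, Finset.mem_Icc, Finset.mem_filter,
      Finset.mem_disjUnion, Finset.mem_Ico, Finset.mem_map_equiv, Equiv.neg_symm, Equiv.neg_apply,
      Sigma.exists, abs_lt]
    constructor
    · rintro ⟨⟨h0, h1, h2⟩, h3, h4⟩
      exact ⟨j, i, ⟨⟨by omega, by omega⟩, by omega, h3, h4⟩, rfl⟩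
    · rintro ⟨j, i, ⟨⟨h0, h1⟩, h2, h3, h4⟩, h⟩
      obtain ⟨rfl, rfl⟩ := Prod.mk.inj h
      dsimp only at *
      exact ⟨⟨by omega, by omega, by omega⟩, h3, h4⟩
  rw [h1, Set.ncard_coe_finset, Finset.card_map, Finset.card_sigma]
  refine Finset.sum_congr rfl fun j _ => ?_
  rw [Finset.card_filter, Finset.sum_disjUnion, Finset.sum_map, ← Finset.sum_add_distrib]
  refine Finset.sum_congr rfl fun i _ => ?_
  simp only [Equiv.coe_toEmbedding, Equiv.neg_apply, sub_neg_eq_add, hr2, hσ, pairInv]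
  by_cases h : r (j - i) <;> simp [h]

/-- The vector -σ(e_j - e_i) = e_{σ i} - e_{σ j} is again a difference of two basis vectors with
distinct absolute indices, positive exactly when σ j < σ i. The predicates p and q let one proof
serve both lengths. -/
theorem ncard_roots {n : ℕ} {σ : Equiv.Perm ℤ} (hσ : σ ∈ evenSignedPerms n)
    (p : (Fin n → ℤ) → Prop) (q : ℤ → ℤ → Prop)
    (hpq : ∀ i j, IsPosPair n i j → (p (e n j - e n i) ↔ q i j)) :
    {α ∈ posRoots n | p α ∧ -(act n σ α) ∈ posRoots n}.ncard =
    {x : ℤ × ℤ | IsPosPair n x.1 x.2 ∧ q x.1 x.2 ∧ σ x.2 < σ x.1}.ncard := by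
  obtain ⟨hs, hodd, -⟩ := hσ
  have hs0 : σ 0 = 0 := by have := hodd 0; simp at this; omega
  have hne : ∀ k, k ≠ 0 → σ k ≠ 0 := fun k h0 h => h0 (σ.injective (h.trans hs0.symm))
  have hle : ∀ k : ℤ, |k| ≤ n → |σ k| ≤ n := by
    intro k hk
    by_contra h
    have := σ.injective (hs (σ k) h)
    exact h (by rwa [this])
  have habs : ∀ i j : ℤ, |i| ≠ |j| → |σ i| ≠ |σ j| := by
    intro i j h h'
    rcases abs_eq_abs.mp h' with h' | h'
    · exact h (by rw [σ.injective h'])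
    · rw [← hodd] at h'
      exact h (by rw [σ.injective h', abs_neg])
  have hkey : ∀ i j, IsPosPair n i j →
      (-(act n σ (e n j - e n i)) ∈ posRoots n ↔ σ j < σ i) := by
    rintro i j ⟨h0, h1, h2⟩
    have hj : 0 < j := lt_of_le_of_lt (abs_nonneg _) h1
    have hj' : |j| = j := abs_of_pos hj
    rw [act_sub, act_e hodd (by omega) (by omega), act_e hodd h0 (by omega), neg_sub]
    exact e_sub_e_mem_posRoots (hne _ h0) (hne _ hj.ne') (hle _ (by omega)) (hle _ (by omega))
      (habs _ _ (by omega))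
  have himg : {α ∈ posRoots n | p α ∧ -(act n σ α) ∈ posRoots n} =
      (fun x : ℤ × ℤ => e n x.2 - e n x.1) ''
        {x : ℤ × ℤ | IsPosPair n x.1 x.2 ∧ q x.1 x.2 ∧ σ x.2 < σ x.1} := by
    ext α
    constructor
    · rintro ⟨h1, h2, h3⟩
      obtain ⟨i, j, hp, rfl⟩ := mem_posRoots_iff.mp h1
      exact ⟨(i, j), ⟨hp, (hpq i j hp).mp h2, (hkey i j hp).mp h3⟩, rfl⟩
    · rintro ⟨⟨i, j⟩, ⟨hp, h2, h3⟩, rfl⟩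
      exact ⟨hp.mem_posRoots, (hpq i j hp).mpr h2, (hkey i j hp).mpr h3⟩
  rw [himg]
  refine Set.InjOn.ncard_image ?_
  rintro ⟨i, j⟩ h ⟨i', j'⟩ h' heq
  obtain ⟨h1, h2⟩ := h.1.eq_of_eq h'.1 heq
  exact Prod.ext h1 h2

theorem length_eq_len {n : ℕ} {σ : Equiv.Perm ℤ} (hσ : σ ∈ evenSignedPerms n) :
    length n σ = len n σ := by
  have h := (ncard_roots hσ (fun _ => True) (fun _ _ => True) (fun _ _ _ => Iff.rfl)).trans
    (ncard_posPairs n σ hσ.2.1 (fun _ => True) (by simp))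
  simpa [length, len] using h

theorem oddLength_eq_oddLen {n : ℕ} {σ : Equiv.Perm ℤ} (hσ : σ ∈ evenSignedPerms n) :
    oddLength n σ = oddLen n σ :=
  (ncard_roots hσ (fun α => ∃ h : ℤ, HasHeight n α h ∧ Odd h) (fun i j => Odd (j - i))
    fun _ _ h => h.hasHeight_odd).trans
    (ncard_posPairs n σ hσ.2.1 (fun k => Odd k)
      (by intro i j; simp [Int.odd_sub, Int.odd_add]))

/-! ### Sums over pairs of positions when two entries change. -/

/-- The positions of `1, …, n` other than `q` and `l`. -/
noncomputable def others (n : ℕ) (q l : ℤ) : Finset ℤ := (Finset.Icc (1 : ℤ) n).filter fun t => t ≠ q ∧ t ≠ l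

theorem mem_others {n : ℕ} {q l t : ℤ} :
    t ∈ others n q l ↔ (1 ≤ t ∧ t ≤ n) ∧ t ≠ q ∧ t ≠ l := by
  simp [others]

theorem Icc_eq_insert_others {n : ℕ} {q l : ℤ} (h1 : 1 ≤ q) (h2 : q < l) (h3 : l ≤ n) :
    Finset.Icc (1 : ℤ) n = insert q (insert l (others n q l)) := by
  ext t
  simp only [Finset.mem_insert, mem_others, Finset.mem_Icc]
  omega

theorem others_notMem {n : ℕ} {q l : ℤ} (h2 : q < l) :
    q ∉ insert l (others n q l) ∧ l ∉ others n q l := by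
  simp only [Finset.mem_insert, mem_others]
  omega

/-- The summand of the pair of positions `i ≠ j`, taken in increasing order. -/
def symPair (h : ℤ → ℤ → ℕ) (i j : ℤ) : ℕ := if i < j then h i j else if j < i then h j i else 0

theorem symPair_comm (h : ℤ → ℤ → ℕ) (i j : ℤ) : symPair h i j = symPair h j i := by
  unfold symPair
  split_ifs <;> first | rfl | omega

/-- Doubling replaces the sum over i < j by a symmetric sum over all ordered pairs, from which two
positions can be removed without regard to their place in the order. -/
theorem two_mul_pairSum (n : ℕ) (h : ℤ → ℤ → ℕ) :
    2 * pairSum n h = ∑ i ∈ Finset.Icc (1 : ℤ) n, ∑ j ∈ Finset.Icc (1 : ℤ) n, symPair h i j := by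
  have h1 : pairSum n h =
      ∑ j ∈ Finset.Icc (1 : ℤ) n, ∑ i ∈ Finset.Icc (1 : ℤ) n, if i < j then h i j else 0 := by
    refine Finset.sum_congr rfl fun j hj => ?_
    rw [← Finset.sum_filter]
    refine Finset.sum_congr ?_ fun _ _ => rfl
    ext i
    simp only [Finset.mem_Icc, Finset.mem_Ico, Finset.mem_filter] at *
    omega
  have h2 := congrArg₂ (· + ·) (h1.trans Finset.sum_comm) h1
  rw [two_mul, h2, ← Finset.sum_add_distrib]
  refine Finset.sum_congr rfl fun i _ => ?_
  rw [← Finset.sum_add_distrib]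
  refine Finset.sum_congr rfl fun j _ => ?_
  unfold symPair
  split_ifs <;> omega

theorem pairSum_split {n : ℕ} {q l : ℤ} (h1 : 1 ≤ q) (h2 : q < l) (h3 : l ≤ n)
    (h : ℤ → ℤ → ℕ) :
    2 * pairSum n h = (∑ i ∈ others n q l, ∑ j ∈ others n q l, symPair h i j) +
      2 * h q l + 2 * ∑ t ∈ others n q l, (symPair h t q + symPair h t l) := by
  obtain ⟨hq, hl⟩ := others_notMem (n := n) h2
  rw [two_mul_pairSum, Icc_eq_insert_others h1 h2 h3]
  simp only [Finset.sum_insert hq, Finset.sum_insert hl, Finset.sum_add_distrib]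
  have e1 : ∀ k, ∑ i ∈ others n q l, symPair h k i = ∑ i ∈ others n q l, symPair h i k :=
    fun k => Finset.sum_congr rfl fun i _ => symPair_comm _ _ _
  have e2 : symPair h q q = 0 := by simp [symPair]
  have e3 : symPair h l l = 0 := by simp [symPair]
  have e4 : symPair h l q = h q l := by simp [symPair, h2, h2.not_gt]
  have e5 : symPair h q l = h q l := by simp [symPair, h2]
  rw [e1, e1, e2, e3, e4, e5]
  ring

theorem sum_others_congr {n : ℕ} {q l : ℤ} {h h' : ℤ → ℤ → ℕ}
    (hh : ∀ i j, i ∈ others n q l → j ∈ others n q l → h i j = h' i j) :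
    (∑ i ∈ others n q l, ∑ j ∈ others n q l, symPair h i j) =
      ∑ i ∈ others n q l, ∑ j ∈ others n q l, symPair h' i j := by
  refine Finset.sum_congr rfl fun i hi => Finset.sum_congr rfl fun j hj => ?_
  unfold symPair
  rw [hh i j hi hj, hh j i hj hi]

/-- The contribution to the length of the positions `i ≠ j`. -/
def posInv (f : ℤ → ℤ) (i j : ℤ) : ℕ :=
  if i < j then pairInv (f i) (f j) else pairInv (f j) (f i)

/-- Since l - q is even, the pair (q, l) is not counted, and a third position is at odd distance
from both or from neither. Only joint contributions with q and l therefore have to be compared. -/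
theorem oddLen_congr {n : ℕ} {q l : ℤ} (h1 : 1 ≤ q) (h2 : q < l) (h3 : l ≤ n)
    (hpar : Even (l - q)) {f g : ℤ → ℤ} (hfg : ∀ t ∈ others n q l, f t = g t)
    (H : ∀ t ∈ others n q l, Odd (t - q) →
      posInv f t q + posInv f t l = posInv g t q + posInv g t l) :
    oddLen n f = oddLen n g := by
  unfold oddLen
  have a1 := pairSum_split h1 h2 h3 (fun i j => if Odd (j - i) then pairInv (f i) (f j) else 0)
  have a2 := pairSum_split h1 h2 h3 (fun i j => if Odd (j - i) then pairInv (g i) (g j) else 0)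
  rw [sum_others_congr (h' := fun i j => if Odd (j - i) then pairInv (g i) (g j) else 0)] at a1
  · have hlq : ¬ Odd (l - q) := by simpa using hpar
    simp only [hlq, if_false] at a1 a2
    have : ∀ t ∈ others n q l,
        symPair (fun i j => if Odd (j - i) then pairInv (f i) (f j) else 0) t q +
        symPair (fun i j => if Odd (j - i) then pairInv (f i) (f j) else 0) t l =
        symPair (fun i j => if Odd (j - i) then pairInv (g i) (g j) else 0) t q +
        symPair (fun i j => if Odd (j - i) then pairInv (g i) (g j) else 0) t l := by
      intro t ht
      have hH := H t ht
      rw [mem_others] at ht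
      have s : ∀ F : ℤ → ℤ, ∀ k, k ≠ t →
          symPair (fun i j => if Odd (j - i) then pairInv (F i) (F j) else 0) t k =
          if Odd (t - k) then posInv F t k else 0 := by
        intro F k hk
        unfold symPair posInv
        have : Odd (k - t) ↔ Odd (t - k) := by rw [Int.odd_iff, Int.odd_iff]; omega
        rcases lt_or_gt_of_ne hk with h | h
        · simp [h, h.not_gt]
        · simp [h, this]
      rw [s f q (by omega), s f l (by omega), s g q (by omega), s g l (by omega)]
      have : Odd (t - l) ↔ Odd (t - q) := by
        have : t - l = t - q - (l - q) := by ring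
        rw [this, Int.odd_sub]
        simp [hpar]
      by_cases ho : Odd (t - q)
      · simpa [ho, this] using hH ho
      · simp [ho, this]
    rw [Finset.sum_congr rfl this] at a1
    omega
  · intro i j hi hj
    rw [hfg i hi, hfg j hj]

/-- The value of `pairInv u v` is 1 if |v| < |u| and 0 or 2 if |u| < |v|. Hence the length has the
parity of the number of inversions among the absolute values. -/
theorem pairInv_parity {u v : ℤ} (h : |u| ≠ |v|) :
    (pairInv u v + (if |v| < |u| then 1 else 0)) % 2 = 0 := by
  rcases abs_cases u with h | h <;> rcases abs_cases v with h' | h' <;>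
    unfold pairInv <;> split_ifs <;> omega

theorem pairInv_exchange {x u v u' v' : ℤ} (h1 : |x| ≠ |u|) (h2 : |x| ≠ |v|) (h3 : |u'| = |v|)
    (h4 : |v'| = |u|) :
    (pairInv x u + pairInv x v + (pairInv x u' + pairInv x v')) % 2 = 0 ∧
    (pairInv u x + pairInv x v + (pairInv u' x + pairInv x v')) % 2 = 0 ∧
    (pairInv u x + pairInv v x + (pairInv u' x + pairInv v' x)) % 2 = 0 := by
  have c1 := pairInv_parity h1
  have c2 := pairInv_parity h2
  have c3 := pairInv_parity (u := x) (v := u') (by rwa [h3])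
  have c4 := pairInv_parity (u := x) (v := v') (by rwa [h4])
  have c5 := pairInv_parity h1.symm
  have c6 := pairInv_parity h2.symm
  have c7 := pairInv_parity (v := x) (u := u') (by rw [h3]; exact h2.symm)
  have c8 := pairInv_parity (v := x) (u := v') (by rw [h4]; exact h1.symm)
  rw [h3] at c3 c7
  rw [h4] at c4 c8
  split_ifs at c1 c2 c3 c4 c5 c6 c7 c8 <;> omega

/-- Modulo 2 only absolute values count, and exchanging two entries of a word with distinct entries
changes its number of inversions by an odd number. -/
theorem len_add_odd {n : ℕ} {q l : ℤ} (h1 : 1 ≤ q) (h2 : q < l) (h3 : l ≤ n)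
    {f g : ℤ → ℤ} (hfg : ∀ t ∈ others n q l, f t = g t)
    (hinj : ∀ i ∈ Finset.Icc (1 : ℤ) n, ∀ j ∈ Finset.Icc (1 : ℤ) n, |f i| = |f j| → i = j)
    (hq : |g q| = |f l|) (hl : |g l| = |f q|) : Odd (len n f + len n g) := by
  unfold len
  have a1 := pairSum_split h1 h2 h3 (fun i j => pairInv (f i) (f j))
  have a2 := pairSum_split h1 h2 h3 (fun i j => pairInv (g i) (g j))
  rw [sum_others_congr (h' := fun i j => pairInv (g i) (g j))] at a1
  · have hne : |f q| ≠ |f l| := fun h => by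
      have := hinj q (by simp; omega) l (by simp; omega) h
      omega
    have k1 := pairInv_parity hne
    have k2 := pairInv_parity (u := g q) (v := g l) (by rw [hq, hl]; exact hne.symm)
    rw [hq, hl] at k2
    have hsum : ∀ t ∈ others n q l,
        (symPair (fun i j => pairInv (f i) (f j)) t q +
        symPair (fun i j => pairInv (f i) (f j)) t l +
        (symPair (fun i j => pairInv (g i) (g j)) t q +
        symPair (fun i j => pairInv (g i) (g j)) t l)) % 2 = 0 := by
      intro t ht
      have hfgt := hfg t ht
      rw [mem_others] at ht
      have n1 : |f t| ≠ |f q| := fun h => by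
        have := hinj t (by simp; omega) q (by simp; omega) h
        omega
      have n2 : |f t| ≠ |f l| := fun h => by
        have := hinj t (by simp; omega) l (by simp; omega) h
        omega
      obtain ⟨c1, c2, c3⟩ := pairInv_exchange n1 n2 hq hl
      unfold symPair
      simp only [← hfgt]
      split_ifs <;> omega
    have hsum' := Finset.sum_nat_mod (others n q l) 2 fun t =>
        (symPair (fun i j => pairInv (f i) (f j)) t q +
        symPair (fun i j => pairInv (f i) (f j)) t l +
        (symPair (fun i j => pairInv (g i) (g j)) t q +
        symPair (fun i j => pairInv (g i) (g j)) t l))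
    rw [Finset.sum_congr rfl hsum, Finset.sum_add_distrib] at hsum'
    simp only [Finset.sum_const_zero, Nat.zero_mod] at hsum'
    rw [Nat.odd_iff]
    split_ifs at k1 k2 <;> omega
  · intro i j hi hj
    rw [hfg i hi, hfg j hj]

/-! ### Even signed permutations and signed transpositions. -/

/-- `𝓓_n` as a finset. -/
noncomputable def D (n : ℕ) : Finset (Equiv.Perm ℤ) := (evenSignedPerms_finite n).toFinset

/-- The sign of an integer, with value `1` at `0`. -/
def sg (k : ℤ) : ℤ := if k < 0 then -1 else 1

theorem mem_D {n : ℕ} {σ : Equiv.Perm ℤ} : σ ∈ D n ↔ (∀ k : ℤ, ¬ |k| ≤ n → σ k = k) ∧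
    (∀ k : ℤ, σ (-k) = -σ k) ∧ ∏ i ∈ Finset.Icc (1 : ℤ) n, sg (σ i) = 1 := by
  have : ∏ i ∈ Finset.Icc (1 : ℤ) n, sg (σ i) =
      (-1) ^ ((Finset.Icc (1 : ℤ) n).filter (fun i => σ i < 0)).card := by
    simp [sg, Finset.prod_ite]
  rw [this, neg_one_pow_eq_one_iff_even (by norm_num)]
  simp [D, evenSignedPerms]

theorem D_odd {n : ℕ} {σ : Equiv.Perm ℤ} (h : σ ∈ D n) (k : ℤ) : σ (-k) = -σ k :=
  (mem_D.mp h).2.1 k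

theorem D_zero {n : ℕ} {σ : Equiv.Perm ℤ} (h : σ ∈ D n) : σ 0 = 0 := by
  have := D_odd h 0
  simp at this
  omega

theorem D_abs_inj {n : ℕ} {σ : Equiv.Perm ℤ} (h : σ ∈ D n) {i j : ℤ} (hij : |σ i| = |σ j|) :
    |i| = |j| := by
  rcases abs_eq_abs.mp hij with h' | h'
  · rw [σ.injective h']
  · rw [← D_odd h] at h'
    rw [σ.injective h', abs_neg]

theorem D_inj {n : ℕ} {σ : Equiv.Perm ℤ} (h : σ ∈ D n) {i j : ℤ} (hi : 0 < i) (hj : 0 < j)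
    (hij : |σ i| = |σ j|) : i = j := by
  have := D_abs_inj h hij
  rwa [abs_of_pos hi, abs_of_pos hj] at this

theorem D_ne_zero {n : ℕ} {σ : Equiv.Perm ℤ} (h : σ ∈ D n) {k : ℤ} (hk : k ≠ 0) : σ k ≠ 0 :=
  fun h' => hk (σ.injective (h'.trans (D_zero h).symm))

theorem D_abs_le {n : ℕ} {σ : Equiv.Perm ℤ} (h : σ ∈ D n) {k : ℤ} (hk : |k| ≤ n) :
    |σ k| ≤ n := by
  by_contra h'
  have := σ.injective ((mem_D.mp h).1 (σ k) h')
  exact h' (by rwa [this])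

/-- The parity of the number of negative entries is a product of signs, so it suffices to compare
the two factors at q and l. -/
theorem mul_mem_D {n : ℕ} {q l : ℤ} (h1 : 1 ≤ q) (h2 : q < l) (h3 : l ≤ n)
    {σ s : Equiv.Perm ℤ} (hσ : σ ∈ D n) (hs : ∀ k, |k| ≠ q → |k| ≠ l → s k = k)
    (hodd : ∀ k, s (-k) = -s k)
    (hsg : sg (σ (s q)) * sg (σ (s l)) = sg (σ q) * sg (σ l)) : σ * s ∈ D n := by
  rw [mem_D] at *
  obtain ⟨a1, a2, a3⟩ := hσ
  refine ⟨fun k hk => ?_, fun k => ?_, ?_⟩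
  · rw [Equiv.Perm.mul_apply, hs k (by omega) (by omega), a1 k hk]
  · simp [hodd, a2]
  · obtain ⟨hq, hl⟩ := others_notMem (n := n) h2
    rw [Icc_eq_insert_others h1 h2 h3, Finset.prod_insert hq, Finset.prod_insert hl, ← mul_assoc]
      at *
    rw [← a3, Equiv.Perm.mul_apply, Equiv.Perm.mul_apply, hsg]
    congr 1
    refine Finset.prod_congr rfl fun t ht => ?_
    rw [mem_others] at ht
    have : |t| = t := abs_of_pos (by omega)
    rw [Equiv.Perm.mul_apply, hs t (by omega) (by omega)]

/-- The signed transposition `(q, l)(-q, -l)`. -/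
def signedSwap (q l : ℤ) : Equiv.Perm ℤ := Equiv.swap q l * Equiv.swap (-q) (-l)

theorem signedSwap_apply {q l : ℤ} (hq : q ≠ 0) (hl : l ≠ 0) (h : |q| ≠ |l|) (k : ℤ) :
    signedSwap q l k = if k = q then l else if k = l then q else if k = -q then -l else
      if k = -l then -q else k := by
  have h1 : q ≠ l := fun h' => h (by rw [h'])
  have h2 : q ≠ -l := fun h' => h (by rw [h', abs_neg])
  rw [signedSwap, Equiv.Perm.mul_apply, Equiv.swap_apply_def, Equiv.swap_apply_def]
  split_ifs <;> omega

theorem signedSwap_neg {q l : ℤ} (hq : q ≠ 0) (hl : l ≠ 0) (h : |q| ≠ |l|) (k : ℤ) :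
    signedSwap q l (-k) = -signedSwap q l k := by
  have h1 : q ≠ l := fun h' => h (by rw [h'])
  have h2 : q ≠ -l := fun h' => h (by rw [h', abs_neg])
  rw [signedSwap_apply hq hl h, signedSwap_apply hq hl h]
  split_ifs <;> omega

theorem signedSwap_of_ne {q l k : ℤ} (hq : q ≠ 0) (hl : l ≠ 0) (h : |q| ≠ |l|)
    (h1 : |k| ≠ |q|) (h2 : |k| ≠ |l|) : signedSwap q l k = k := by
  rw [signedSwap_apply hq hl h, if_neg, if_neg, if_neg, if_neg]
  · rintro rfl; simp at h2
  · rintro rfl; simp at h1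
  · rintro rfl; simp at h2
  · rintro rfl; simp at h1

theorem signedSwap_mul_self {q l : ℤ} (hq : q ≠ 0) (hl : l ≠ 0) (h : |q| ≠ |l|) :
    signedSwap q l * signedSwap q l = 1 := by
  have h1 : q ≠ l := fun h' => h (by rw [h'])
  have h2 : q ≠ -l := fun h' => h (by rw [h', abs_neg])
  ext k
  rw [Equiv.Perm.mul_apply, signedSwap_apply hq hl h, signedSwap_apply hq hl h,
    Equiv.Perm.one_apply]
  split_ifs <;> omega

/-! ### Signed weights, ascents and the passage from `genFun` to `F`. -/

/-- The signed weight of a word. -/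
noncomputable def wt (n : ℕ) (f : ℤ → ℤ) : ℤ[X] := (-1) ^ len n f * Polynomial.X ^ oddLen n f

theorem wt_eq_neg {n : ℕ} {f g : ℤ → ℤ} (h1 : Odd (len n f + len n g))
    (h2 : oddLen n f = oddLen n g) : wt n f = -wt n g := by
  have : (-1 : ℤ[X]) ^ len n f = -(-1) ^ len n g := by
    rcases Nat.even_or_odd (len n g) with h | h
    · rw [Nat.odd_add'] at h1
      rw [h.neg_one_pow, Odd.neg_one_pow]
      by_contra h'
      exact (Nat.not_odd_iff_even.mpr h) (h1.mpr (Nat.not_odd_iff_even.mp h'))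
    · rw [Nat.odd_add] at h1
      rw [h.neg_one_pow, Even.neg_one_pow, neg_neg]
      by_contra h'
      exact (Nat.not_even_iff_odd.mpr h) (h1.mp (Nat.not_even_iff_odd.mp h'))
  rw [wt, wt, this, h2, neg_mul]

/-- There is an ascent at `i`: no descent of the even signed permutation `f` by `s_i`. -/
def Asc (f : ℤ → ℤ) (i : ℕ) : Prop := f (if i = 0 then -1 else i) < f ((i : ℤ) + if i = 0 then 2 else 1)

open Classical in
/-- The even signed permutations with ascents in `I`. -/
noncomputable def ascSet (n : ℕ) (I : Finset ℕ) : Finset (Equiv.Perm ℤ) :=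
  (D n).filter fun σ => ∀ i ∈ I, Asc σ i

theorem mem_ascSet {n : ℕ} {I : Finset ℕ} {σ : Equiv.Perm ℤ} :
    σ ∈ ascSet n I ↔ σ ∈ D n ∧ ∀ i ∈ I, Asc σ i := by
  simp [ascSet]

/-- The signed weight enumerator of the even signed permutations with ascents in `I`. -/
noncomputable def F (n : ℕ) (I : Finset ℕ) : ℤ[X] := ∑ σ ∈ ascSet n I, wt n σ

/-- Fixed points need not be excluded: there g = -g, which forces g = 0 in ℤ[X]. -/
theorem sum_eq_zero_of_involution {S : Finset (Equiv.Perm ℤ)} {g : Equiv.Perm ℤ → ℤ[X]}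
    (φ : Equiv.Perm ℤ → Equiv.Perm ℤ) (h1 : ∀ σ ∈ S, φ σ ∈ S) (h2 : ∀ σ ∈ S, φ (φ σ) = σ)
    (h3 : ∀ σ ∈ S, g (φ σ) = -g σ) : ∑ σ ∈ S, g σ = 0 := by
  refine Finset.sum_involution (fun σ _ => φ σ) (fun σ hσ => ?_) (fun σ hσ hne heq => ?_) h1 h2
  · rw [h3 σ hσ]; ring
  · have h := h3 σ hσ
    rw [heq] at h
    exact hne (self_eq_neg.mp h)

theorem gen_succ (i : ℕ) : gen (i + 1) = signedSwap ((i : ℤ) + 1) (i + 2) := rfl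

theorem gen_zero : gen 0 = signedSwap 1 (-2) := by
  rw [gen, signedSwap, neg_neg, Equiv.swap_comm 2 (-1)]

/-- Right multiplication by a generator changes two adjacent positions: s_i exchanges their entries,
and s_0 turns (σ 1, σ 2) into (-σ 2, -σ 1). The joint contribution of these positions with any third
one is unchanged, so the lengths differ only in the one pair. -/
theorem lt_len_mul_gen {n : ℕ} (hn : 2 ≤ n) {i : ℕ} (hi : i < n) {σ : Equiv.Perm ℤ}
    (hσ : σ ∈ D n) : σ * gen i ∈ D n ∧ (len n σ < len n ↑(σ * gen i) ↔ Asc σ i) := by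
  have hodd := D_odd hσ
  rcases i with _ | i
  · have hs : ∀ k, gen 0 k = if k = 1 then -2 else if k = -2 then 1 else if k = -1 then 2 else
        if k = 2 then -1 else k := by
      intro k
      rw [gen_zero, signedSwap_apply (by norm_num) (by norm_num) (by norm_num)]
      simp
    have s1 : gen 0 1 = -2 := by rw [hs]; norm_num
    have s2 : gen 0 2 = -1 := by rw [hs]; norm_num
    have n1 := D_ne_zero hσ (k := 1) (by norm_num)
    have n2 := D_ne_zero hσ (k := 2) (by norm_num)
    have hne : σ 1 ≠ -σ 2 := by
      rw [← hodd]; intro h; have := σ.injective h; omega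
    refine ⟨mul_mem_D (q := 1) (l := 2) le_rfl (by norm_num) (by exact_mod_cast hn) hσ
      (fun k h1 h2 => ?_) (fun k => ?_) ?_, ?_⟩
    · rw [hs, if_neg, if_neg, if_neg, if_neg] <;> rintro rfl <;> simp at h1 h2
    · rw [gen_zero, signedSwap_neg (by norm_num) (by norm_num) (by norm_num)]
    · rw [s1, s2, hodd, hodd]
      unfold sg
      split_ifs <;> omega
    · have a1 := pairSum_split (n := n) (q := 1) (l := 2) le_rfl (by norm_num)
        (by exact_mod_cast hn) (fun i j => pairInv (σ i) (σ j))
      have a2 := pairSum_split (n := n) (q := 1) (l := 2) le_rfl (by norm_num)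
        (by exact_mod_cast hn) (fun i j => pairInv ((σ * gen 0) i) ((σ * gen 0) j))
      have ht : ∀ t ∈ others n 1 2, (σ * gen 0) t = σ t := by
        intro t ht
        rw [mem_others] at ht
        rw [Equiv.Perm.mul_apply, hs, if_neg, if_neg, if_neg, if_neg] <;> omega
      rw [sum_others_congr (h' := fun i j => pairInv (σ i) (σ j))
        (fun i j hi hj => by rw [ht i hi, ht j hj])] at a2
      have hsum : ∀ t ∈ others n 1 2,
          symPair (fun i j => pairInv ((σ * gen 0) i) ((σ * gen 0) j)) t 1 +
          symPair (fun i j => pairInv ((σ * gen 0) i) ((σ * gen 0) j)) t 2 =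
          symPair (fun i j => pairInv (σ i) (σ j)) t 1 +
          symPair (fun i j => pairInv (σ i) (σ j)) t 2 := by
        intro t hT
        have hT' := ht t hT
        rw [mem_others] at hT
        unfold symPair
        rw [if_neg (by omega), if_pos (by omega), if_neg (by omega), if_pos (by omega),
          if_neg (by omega), if_pos (by omega), if_neg (by omega), if_pos (by omega)]
        simp only [hT']
        simp only [Equiv.Perm.mul_apply, s1, s2, hodd]
        unfold pairInv
        simp only [neg_neg]
        ring
      rw [Finset.sum_congr rfl hsum] at a2
      simp only [Equiv.Perm.mul_apply, s1, s2, hodd] at a2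
      have h3 : len n σ < len n ↑(σ * gen 0) ↔
          pairInv (σ 1) (σ 2) < pairInv (-σ 2) (-σ 1) := by
        simp only [len, Equiv.Perm.mul_apply] at *
        omega
      rw [h3]
      simp only [Asc, if_true, hodd, pairInv]
      norm_num
      split_ifs <;> omega
  · have hq : ((i : ℤ) + 1) ≠ 0 := by omega
    have hl : ((i : ℤ) + 2) ≠ 0 := by omega
    have hql : |((i : ℤ) + 1)| ≠ |((i : ℤ) + 2)| := by
      rw [abs_of_pos (by omega), abs_of_pos (by omega)]; omega
    have hs := signedSwap_apply hq hl hql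
    rw [← gen_succ] at hs
    have s1 : gen (i + 1) ((i : ℤ) + 1) = i + 2 := by rw [hs, if_pos rfl]
    have s2 : gen (i + 1) ((i : ℤ) + 2) = i + 1 := by rw [hs, if_neg (by omega), if_pos rfl]
    have hne : σ ((i : ℤ) + 1) ≠ σ (i + 2) := by
      intro h; have := σ.injective h; omega
    refine ⟨mul_mem_D (q := i + 1) (l := i + 2) (by omega) (by omega) (by omega) hσ
      (fun k h1 h2 => ?_) (fun k => ?_) ?_, ?_⟩
    · rw [gen_succ]
      exact signedSwap_of_ne hq hl hql (by rwa [abs_of_pos (a := (i : ℤ) + 1) (by omega)])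
        (by rwa [abs_of_pos (a := (i : ℤ) + 2) (by omega)])
    · rw [gen_succ, signedSwap_neg hq hl hql]
    · rw [s1, s2, mul_comm]
    · have a1 := pairSum_split (n := n) (q := i + 1) (l := i + 2) (by omega) (by omega)
        (by omega) (fun i j => pairInv (σ i) (σ j))
      have a2 := pairSum_split (n := n) (q := i + 1) (l := i + 2) (by omega) (by omega)
        (by omega) (fun a b => pairInv ((σ * gen (i + 1)) a) ((σ * gen (i + 1)) b))
      have ht : ∀ t ∈ others n (i + 1) (i + 2), (σ * gen (i + 1)) t = σ t := by
        intro t ht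
        rw [mem_others] at ht
        rw [Equiv.Perm.mul_apply, hs, if_neg, if_neg, if_neg, if_neg] <;> omega
      rw [sum_others_congr (h' := fun i j => pairInv (σ i) (σ j))
        (fun i j hi hj => by rw [ht i hi, ht j hj])] at a2
      have hsum : ∀ t ∈ others n (i + 1) (i + 2),
          symPair (fun a b => pairInv ((σ * gen (i + 1)) a) ((σ * gen (i + 1)) b)) t (i + 1) +
          symPair (fun a b => pairInv ((σ * gen (i + 1)) a) ((σ * gen (i + 1)) b)) t (i + 2) =
          symPair (fun i j => pairInv (σ i) (σ j)) t (i + 1) +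
          symPair (fun i j => pairInv (σ i) (σ j)) t (i + 2) := by
        intro t hT
        have := ht t hT
        rw [mem_others] at hT
        unfold symPair
        have e1 : (σ * gen (i + 1)) ((i : ℤ) + 1) = σ (i + 2) := by
          rw [Equiv.Perm.mul_apply, s1]
        have e2 : (σ * gen (i + 1)) ((i : ℤ) + 2) = σ (i + 1) := by
          rw [Equiv.Perm.mul_apply, s2]
        simp only [this, e1, e2]
        split_ifs <;> omega
      rw [Finset.sum_congr rfl hsum] at a2
      simp only [Equiv.Perm.mul_apply, s1, s2] at a2
      have h3 : len n σ < len n ↑(σ * gen (i + 1)) ↔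
          pairInv (σ (i + 1)) (σ (i + 2)) < pairInv (σ (i + 2)) (σ (i + 1)) := by
        simp only [len, Equiv.Perm.mul_apply] at *
        omega
      rw [h3]
      simp only [Asc, Nat.succ_ne_zero, if_false, pairInv]
      push_cast
      rw [show (i : ℤ) + 1 + 1 = i + 2 by ring]
      split_ifs <;> omega

theorem genFun_eq_F {n : ℕ} (hn : 2 ≤ n) {I : Finset ℕ} (hI : I ⊆ Finset.range n) :
    genFun n I = F n I := by
  have hD : ∀ σ, σ ∈ D n ↔ σ ∈ evenSignedPerms n := fun σ => by simp [D]
  unfold genFun F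
  refine Finset.sum_congr ?_ ?_
  · ext σ
    simp only [Set.Finite.mem_toFinset, mem_ascSet]
    constructor
    · rintro ⟨h1, h2⟩
      rw [← hD] at h1
      refine ⟨h1, fun i hi => ?_⟩
      have h3 := lt_len_mul_gen hn (Finset.mem_range.mp (hI hi)) h1
      have h4 := h2 i hi
      rw [length_eq_len ((hD _).mp h1), length_eq_len ((hD _).mp h3.1)] at h4
      exact h3.2.mp h4
    · rintro ⟨h1, h2⟩
      refine ⟨(hD _).mp h1, fun i hi => ?_⟩
      have h3 := lt_len_mul_gen hn (Finset.mem_range.mp (hI hi)) h1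
      rw [length_eq_len ((hD _).mp h1), length_eq_len ((hD _).mp h3.1)]
      exact h3.2.mpr (h2 i hi)
  · intro σ hσ
    rw [mem_ascSet, hD] at hσ
    rw [length_eq_len hσ.1, oddLength_eq_oddLen hσ.1]
    rfl

theorem asc_iff {f : ℤ → ℤ} {j : ℕ} (hj : j ≠ 0) : Asc f j ↔ f j < f ((j : ℤ) + 1) := by
  simp [Asc, hj]

theorem asc_zero_iff {f : ℤ → ℤ} : Asc f 0 ↔ f (-1) < f 2 := by
  simp [Asc]

/-- A word increases along an interval of ascents. -/
theorem lt_of_asc {f : ℤ → ℤ} {u v : ℤ} (hu : 1 ≤ u)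
    (h : ∀ j : ℕ, u ≤ j → (j : ℤ) < v → Asc f j) {a b : ℤ} (ha : u ≤ a) (hab : a < b)
    (hb : b ≤ v) : f a < f b := by
  obtain ⟨d, rfl⟩ : ∃ d : ℕ, b = a + 1 + d := ⟨(b - a - 1).toNat, by omega⟩
  have step : ∀ c : ℤ, u ≤ c → c < v → f c < f (c + 1) := by
    intro c h1 h2
    have := (asc_iff (f := f) (j := c.toNat) (by omega)).mp (h _ (by omega) (by omega))
    rwa [show ((c.toNat : ℕ) : ℤ) = c by omega] at this
  induction d with
  | zero => simpa using step a ha (by simpa using hb)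
  | succ d ih =>
    push_cast at hb ⊢
    refine (ih (by omega) (by omega)).trans ?_
    have := step (a + 1 + d) (by omega) (by omega)
    rwa [add_assoc (a + 1)] at this

theorem signedSwap_facts {q l : ℤ} (h1 : 1 ≤ q) (h2 : q < l) :
    q ≠ 0 ∧ l ≠ 0 ∧ |q| ≠ |l| := by
  rw [abs_of_pos (by omega), abs_of_pos (by omega)]
  omega

theorem mul_signedSwap_mem_D {n : ℕ} {q l : ℤ} (h1 : 1 ≤ q) (h2 : q < l) (h3 : l ≤ n)
    {σ : Equiv.Perm ℤ} (hσ : σ ∈ D n) : σ * signedSwap q l ∈ D n := by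
  obtain ⟨a, b, c⟩ := signedSwap_facts h1 h2
  refine mul_mem_D h1 h2 h3 hσ (fun k hq hl => ?_) (signedSwap_neg a b c) ?_
  · exact signedSwap_of_ne a b c (by rwa [abs_of_pos (a := q) (by omega)])
      (by rwa [abs_of_pos (a := l) (by omega)])
  · rw [signedSwap_apply a b c, signedSwap_apply a b c, if_pos rfl, if_neg (by omega), if_pos rfl,
      mul_comm]

theorem mul_signedSwap_apply {q l : ℤ} (h1 : 1 ≤ q) (h2 : q < l) (σ : Equiv.Perm ℤ) :
    (σ * signedSwap q l) q = σ l ∧ (σ * signedSwap q l) l = σ q ∧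
    ∀ t, |t| ≠ q → |t| ≠ l → (σ * signedSwap q l) t = σ t := by
  obtain ⟨a, b, c⟩ := signedSwap_facts h1 h2
  simp only [Equiv.Perm.mul_apply]
  refine ⟨?_, ?_, fun t h3 h4 => ?_⟩
  · rw [signedSwap_apply a b c, if_pos rfl]
  · rw [signedSwap_apply a b c, if_neg (by omega), if_pos rfl]
  · rw [signedSwap_of_ne a b c (by rwa [abs_of_pos (a := q) (by omega)])
      (by rwa [abs_of_pos (a := l) (by omega)])]

/-- Exchanging the entries in two positions of the same parity reverses the signed weight if no
entry in between separates them. -/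
theorem wt_mul_signedSwap {n : ℕ} {q l : ℤ} (h1 : 1 ≤ q) (h2 : q < l) (h3 : l ≤ n)
    (hpar : Even (l - q)) {σ : Equiv.Perm ℤ} (hσ : σ ∈ D n)
    (hbtw : ∀ t, q < t → t < l → Odd (t - q) → (σ t < σ q ↔ σ t < σ l)) :
    wt n ↑(σ * signedSwap q l) = -wt n σ := by
  obtain ⟨e1, e2, e3⟩ := mul_signedSwap_apply h1 h2 σ
  have e3' : ∀ t ∈ others n q l, σ t = (σ * signedSwap q l) t := by
    intro t ht
    rw [mem_others] at ht
    have : |t| = t := abs_of_pos (by omega)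
    exact (e3 t (by omega) (by omega)).symm
  have hinj : ∀ i ∈ Finset.Icc (1 : ℤ) n, ∀ j ∈ Finset.Icc (1 : ℤ) n, |σ i| = |σ j| → i = j := by
    intro i hi j hj
    rw [Finset.mem_Icc] at hi hj
    exact D_inj hσ (by omega) (by omega)
  refine wt_eq_neg ?_ ?_
  · rw [add_comm]
    exact len_add_odd h1 h2 h3 e3' hinj (by rw [e1]) (by rw [e2])
  · refine (oddLen_congr h1 h2 h3 hpar e3' fun t ht hodd => ?_).symm
    have e4 := e3' t ht
    rw [mem_others] at ht
    have hb := hbtw t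
    have n1 : σ t ≠ σ q := fun h => ht.2.1 (σ.injective h)
    have n2 : σ t ≠ σ l := fun h => ht.2.2 (σ.injective h)
    unfold posInv
    rw [e1, e2, ← e4]
    -- Outside the interval the two contributions of t are merely interchanged. Between q and l, the
    -- summand of `pairInv` that tests u + v < 0 is symmetric, and `hbtw` takes care of the other
    -- one.
    rcases lt_or_gt_of_ne ht.2.1 with h | h <;> rcases lt_or_gt_of_ne ht.2.2 with h' | h'
    · simp only [h, h', if_true]; ring
    · omega
    · simp only [h.not_gt, h', if_true, if_false]
      have hb' := hb h h' hodd
      unfold pairInv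
      split_ifs <;> omega
    · simp only [h.not_gt, h'.not_gt, if_false]; ring

theorem sum_wt_eq_zero_of_signedSwap {n : ℕ} {q l : ℤ} (h1 : 1 ≤ q) (h2 : q < l) (h3 : l ≤ n)
    (hpar : Even (l - q)) {S : Finset (Equiv.Perm ℤ)} (hS : S ⊆ D n)
    (hinv : ∀ σ ∈ S, σ * signedSwap q l ∈ S)
    (hbtw : ∀ σ ∈ S, ∀ t, q < t → t < l → (σ t < σ q ↔ σ t < σ l)) :
    ∑ σ ∈ S, wt n σ = 0 := by
  obtain ⟨a, b, c⟩ := signedSwap_facts h1 h2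
  refine sum_eq_zero_of_involution (fun σ => σ * signedSwap q l) hinv (fun σ _ => ?_)
    fun σ hσ => wt_mul_signedSwap h1 h2 h3 hpar (hS hσ) fun t ht ht' _ => hbtw σ hσ t ht ht'
  rw [mul_assoc, signedSwap_mul_self a b c, mul_one]

/-! ### Joining a free position to a later block. -/

open Classical in
/-- The elements of `S` with the property `P`. -/
noncomputable def sel (S : Finset (Equiv.Perm ℤ)) (P : Equiv.Perm ℤ → Prop) :
    Finset (Equiv.Perm ℤ) := S.filter P

theorem mem_sel {S : Finset (Equiv.Perm ℤ)} {P : Equiv.Perm ℤ → Prop} {σ : Equiv.Perm ℤ} :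
    σ ∈ sel S P ↔ σ ∈ S ∧ P σ := by
  simp [sel]

theorem sum_sel_add_sum_sel_not (S : Finset (Equiv.Perm ℤ)) (P : Equiv.Perm ℤ → Prop)
    (g : Equiv.Perm ℤ → ℤ[X]) :
    ∑ σ ∈ sel S P, g σ + ∑ σ ∈ sel S (fun σ => ¬ P σ), g σ = ∑ σ ∈ S, g σ := by
  classical
  unfold sel
  convert Finset.sum_filter_add_sum_filter_not S P g

/-- The conditions K i form an increasing chain starting from the empty set, and the sum telescopes
over its layers. The chain is needed because each layer has its own sign-reversing exchange, with
its own pair of positions. -/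
theorem sum_sel_eq_zero_of_steps {S : Finset (Equiv.Perm ℤ)} {g : Equiv.Perm ℤ → ℤ[X]}
    (K : ℕ → Equiv.Perm ℤ → Prop) (k : ℕ) (h0 : ∀ σ ∈ S, ¬ K 0 σ)
    (hmono : ∀ i < k, ∀ σ ∈ S, K i σ → K (i + 1) σ)
    (hstep : ∀ i < k, ∑ σ ∈ sel S (fun σ => K (i + 1) σ ∧ ¬ K i σ), g σ = 0) :
    ∑ σ ∈ sel S (K k), g σ = 0 := by
  induction k with
  | zero =>
    have : sel S (K 0) = ∅ := by
      ext σ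
      simpa [mem_sel] using h0 σ
    rw [this, Finset.sum_empty]
  | succ k ih =>
    have e1 : sel (sel S (K (k + 1))) (K k) = sel S (K k) := by
      ext σ
      simp only [mem_sel]
      exact ⟨fun h => ⟨h.1.1, h.2⟩, fun h => ⟨⟨h.1, hmono k (by omega) σ h.1 h.2⟩, h.2⟩⟩
    have e2 : sel (sel S (K (k + 1))) (fun σ => ¬ K k σ) =
        sel S (fun σ => K (k + 1) σ ∧ ¬ K k σ) := by
      ext σ
      simp only [mem_sel, and_assoc]
    rw [← sum_sel_add_sum_sel_not _ (K k), e1, e2, hstep k (by omega), add_zero]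
    exact ih (fun i hi => hmono i (by omega)) (fun i hi => hstep i (by omega))

theorem F_eq_of_sum_eq_zero {n : ℕ} {I : Finset ℕ} {j : ℕ} (hj : j ≠ 0)
    (h : ∑ σ ∈ sel (ascSet n I) (fun σ => σ ((j : ℤ) + 1) < σ j), wt n σ = 0) :
    F n I = F n (insert j I) := by
  unfold F
  rw [← sum_sel_add_sum_sel_not (ascSet n I) (fun σ => σ ((j : ℤ) + 1) < σ j), h, zero_add]
  refine Finset.sum_congr ?_ fun _ _ => rfl
  ext σ
  rw [mem_sel, mem_ascSet, mem_ascSet, Finset.forall_mem_insert, asc_iff hj]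
  have : σ ((j : ℤ) + 1) ≠ σ j := fun h => by have := σ.injective h; omega
  constructor
  · rintro ⟨⟨h1, h2⟩, h3⟩
    exact ⟨h1, by omega, h2⟩
  · rintro ⟨h1, h2, h3⟩
    exact ⟨⟨h1, h3⟩, by omega⟩

/-- A free position after a block of even length may be joined to the block. -/
theorem F_append {n p k : ℕ} (hp : 2 ≤ p) (hk : 1 ≤ k) (hn : p + 2 * k + 1 ≤ n) {I₀ : Finset ℕ}
    (h0 : ∀ i ∈ I₀, i < p ∨ p + 2 * k + 1 < i) :
    F n (I₀ ∪ Finset.Icc (p + 1) (p + 2 * k - 1)) = F n (I₀ ∪ Finset.Icc (p + 1) (p + 2 * k)) := by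
  have hins : I₀ ∪ Finset.Icc (p + 1) (p + 2 * k) =
      insert (p + 2 * k) (I₀ ∪ Finset.Icc (p + 1) (p + 2 * k - 1)) := by
    ext i
    simp only [Finset.mem_union, Finset.mem_insert, Finset.mem_Icc]
    grind
  rw [hins]
  refine F_eq_of_sum_eq_zero (by omega) ?_
  have hblock : ∀ σ ∈ ascSet n (I₀ ∪ Finset.Icc (p + 1) (p + 2 * k - 1)), ∀ a b : ℤ,
      p + 1 ≤ a → a < b → b ≤ p + 2 * k → σ a < σ b := by
    intro σ hσ a b ha hab hb
    refine lt_of_asc (f := σ) (u := p + 1) (v := p + 2 * k) (by omega) (fun j h1 h2 => ?_)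
      ha hab hb
    refine (mem_ascSet.mp hσ).2 j ?_
    rw [Finset.mem_union, Finset.mem_Icc]
    refine Or.inr ?_
    omega
  -- The conjunct 1 ≤ i makes K 0 empty. Layer i consists of the σ with σ(p+2i) < σ(p+2k+1) <
  -- σ(p+2i+2), without the lower bound if i = 0. The entry at p+2i+1 lies in the same gap, so it
  -- can be exchanged with the free entry at p+2k+1 without leaving the layer, and the distance
  -- 2(k-i) is even.
  have hz := sum_sel_eq_zero_of_steps
    (S := ascSet n (I₀ ∪ Finset.Icc (p + 1) (p + 2 * k - 1))) (g := fun σ => wt n σ)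
    (fun i σ => 1 ≤ i ∧ σ ((p : ℤ) + 2 * k + 1) < σ ((p : ℤ) + 2 * i)) k (by simp) ?_ ?_
  · convert hz using 4
    simp [hk]
  · rintro i hi σ hσ ⟨h1, h2⟩
    refine ⟨by omega, h2.trans (hblock σ hσ _ _ ?_ ?_ ?_)⟩ <;> push_cast <;> omega
  · intro i hi
    have hlt : (p : ℤ) + 2 * i + 1 < p + 2 * k + 1 := by omega
    refine sum_wt_eq_zero_of_signedSwap (q := p + 2 * i + 1) (l := p + 2 * k + 1) (by omega)
      hlt (by omega) ⟨(k : ℤ) - i, by ring⟩ ?_ ?_ ?_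
    · intro σ hσ
      exact (mem_ascSet.mp (mem_sel.mp hσ).1).1
    · intro σ hσ
      obtain ⟨hσ1, hσ2, hσ3⟩ := mem_sel.mp hσ
      obtain ⟨e1, e2, e3⟩ := mul_signedSwap_apply (q := p + 2 * i + 1) (by omega) hlt σ
      have hb := hblock σ hσ1
      obtain ⟨hD, hA⟩ := mem_ascSet.mp hσ1
      have c1 : σ (p + 2 * k + 1) < σ (p + 2 * i + 1 + 1) := by
        have := hσ2.2
        push_cast at this
        rwa [show (p : ℤ) + 2 * i + 1 + 1 = p + 2 * (i + 1) by ring]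
      have c2 : 1 ≤ i → σ (p + 2 * i) < σ (p + 2 * k + 1) := fun h => by
        have hne : σ ((p : ℤ) + 2 * i) ≠ σ (p + 2 * k + 1) := fun h => by
          have := σ.injective h; omega
        by_contra h'
        exact hσ3 ⟨h, by omega⟩
      refine mem_sel.mpr ⟨mem_ascSet.mpr
        ⟨mul_signedSwap_mem_D (by omega) hlt (by omega) hD, fun j hj => ?_⟩, ⟨by omega, ?_⟩, ?_⟩
      · have hAj := hA j hj
        rcases Nat.eq_zero_or_pos j with rfl | hj0
        -- As p ≥ 2, the exchange does not touch positions 1 and 2, on which the ascent at 0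
        -- depends.
        · rw [asc_zero_iff] at hAj ⊢
          rwa [e3, e3] <;> norm_num <;> omega
        · have a1 : |(j : ℤ)| = j := abs_of_pos (by omega)
          have a2 : |(j : ℤ) + 1| = j + 1 := abs_of_pos (by omega)
          rw [asc_iff (by omega)] at hAj ⊢
          -- No ascent is required at p, nor on the right of the free position, and none yet at
          -- p+2k. For i = 0 the first block entry therefore has no left neighbour to respect.
          have hj' : ((j : ℤ) ≠ p + 2 * k + 1 ∧ (j : ℤ) + 1 ≠ p + 2 * k + 1) ∧
              ((j : ℤ) + 1 = p + 2 * i + 1 → 1 ≤ i) := by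
            rw [Finset.mem_union, Finset.mem_Icc] at hj
            rcases hj with hj | hj
            · have := h0 j hj; omega
            · omega
          by_cases hq : (j : ℤ) = p + 2 * i + 1
          · rw [hq, e1, e3]
            · exact c1
            · rw [← hq, a2]; omega
            · rw [← hq, a2]; omega
          · by_cases hq' : (j : ℤ) + 1 = p + 2 * i + 1
            · rw [hq', e1, e3 _ (by omega) (by omega)]
              rw [show (j : ℤ) = p + 2 * i by omega]
              exact c2 (hj'.2 hq')
            · rwa [e3, e3] <;> omega
      · rw [e2, e3]
        · exact hb _ _ (by omega) (by push_cast; omega) (by push_cast; omega)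
        · rw [abs_of_pos (by positivity)]; push_cast; omega
        · rw [abs_of_pos (by positivity)]; push_cast; omega
      · rintro ⟨h, h'⟩
        rw [e2, e3] at h'
        · exact absurd (hb (p + 2 * i) (p + 2 * i + 1) (by omega) (by omega) (by omega)) (by omega)
        · rw [abs_of_pos (by positivity)]; omega
        · rw [abs_of_pos (by positivity)]; omega
    · intro σ hσ t ht1 ht2
      obtain ⟨hσ1, hσ2, hσ3⟩ := mem_sel.mp hσ
      have hb := hblock σ hσ1
      -- All block entries to the right of p+2i+1 exceed both exchanged entries, so none separates
      -- them.
      have b1 := hb (p + 2 * i + 1) t (by omega) ht1 (by omega)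
      have b2 : σ (p + 2 * k + 1) < σ t := by
        refine lt_of_lt_of_le hσ2.2 ?_
        rcases eq_or_lt_of_le (show (p : ℤ) + 2 * (i + 1 : ℕ) ≤ t by push_cast; omega) with h | h
        · rw [h]
        · exact (hb _ _ (by push_cast; omega) h (by omega)).le
      omega

/-- A free position before a block of even length may be joined to the block. -/
theorem F_prepend {n p k : ℕ} (hp : 2 ≤ p) (hk : 1 ≤ k) (hn : p + 2 * k + 1 ≤ n) {I₀ : Finset ℕ}
    (h0 : ∀ i ∈ I₀, i < p ∨ p + 2 * k + 1 < i) :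
    F n (I₀ ∪ Finset.Icc (p + 2) (p + 2 * k)) = F n (I₀ ∪ Finset.Icc (p + 1) (p + 2 * k)) := by
  have hins : I₀ ∪ Finset.Icc (p + 1) (p + 2 * k) =
      insert (p + 1) (I₀ ∪ Finset.Icc (p + 2) (p + 2 * k)) := by
    ext i
    simp only [Finset.mem_union, Finset.mem_insert, Finset.mem_Icc]
    grind
  rw [hins]
  refine F_eq_of_sum_eq_zero (by omega) ?_
  have hblock : ∀ σ ∈ ascSet n (I₀ ∪ Finset.Icc (p + 2) (p + 2 * k)), ∀ a b : ℤ,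
      p + 2 ≤ a → a < b → b ≤ p + 2 * k + 1 → σ a < σ b := by
    intro σ hσ a b ha hab hb
    refine lt_of_asc (f := σ) (u := p + 2) (v := p + 2 * k + 1) (by omega) (fun j h1 h2 => ?_)
      ha hab hb
    refine (mem_ascSet.mp hσ).2 j ?_
    rw [Finset.mem_union, Finset.mem_Icc]
    refine Or.inr ?_
    omega
  -- This mirrors `F_append`: in layer i, σ(p+2k-2i) < σ(p+1) < σ(p+2k+2-2i), without the upper
  -- bound if i = 0, and the free entry at p+1 is exchanged with the entry at p+2k+1-2i.
  have hz := sum_sel_eq_zero_of_steps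
    (S := ascSet n (I₀ ∪ Finset.Icc (p + 2) (p + 2 * k))) (g := fun σ => wt n σ)
    (fun i σ => 1 ≤ i ∧ σ ((p : ℤ) + 2 * k + 2 - 2 * i) < σ ((p : ℤ) + 1)) k (by simp) ?_ ?_
  · convert hz using 4
    simp only [hk, true_and]
    push_cast
    rw [show (p : ℤ) + 2 * k + 2 - 2 * k = p + 1 + 1 by ring]
  · rintro i hi σ hσ ⟨h1, h2⟩
    refine ⟨by omega, lt_trans (hblock σ hσ _ _ ?_ ?_ ?_) h2⟩ <;> push_cast <;> omega
  · intro i hi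
    have hlt : (p : ℤ) + 1 < p + 2 * k + 1 - 2 * i := by omega
    refine sum_wt_eq_zero_of_signedSwap (q := p + 1) (l := p + 2 * k + 1 - 2 * i) (by omega)
      hlt (by omega) ⟨(k : ℤ) - i, by ring⟩ ?_ ?_ ?_
    · intro σ hσ
      exact (mem_ascSet.mp (mem_sel.mp hσ).1).1
    · intro σ hσ
      obtain ⟨hσ1, hσ2, hσ3⟩ := mem_sel.mp hσ
      obtain ⟨e1, e2, e3⟩ := mul_signedSwap_apply (q := p + 1) (by omega) hlt σ
      have hb := hblock σ hσ1
      obtain ⟨hD, hA⟩ := mem_ascSet.mp hσ1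
      have c1 : σ (p + 2 * k - 2 * i) < σ (p + 1) := by
        have := hσ2.2
        push_cast at this
        rwa [show (p : ℤ) + 2 * k + 2 - 2 * (i + 1) = p + 2 * k - 2 * i by ring] at this
      have c2 : 1 ≤ i → σ (p + 1) < σ (p + 2 * k + 1 - 2 * i + 1) := fun h => by
        have hne : σ ((p : ℤ) + 1) ≠ σ (p + 2 * k + 2 - 2 * i) := fun h => by
          have := σ.injective h; omega
        rw [show (p : ℤ) + 2 * k + 1 - 2 * i + 1 = p + 2 * k + 2 - 2 * i by ring]
        by_contra h'
        exact hσ3 ⟨h, by omega⟩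
      refine mem_sel.mpr ⟨mem_ascSet.mpr
        ⟨mul_signedSwap_mem_D (by omega) hlt (by omega) hD, fun j hj => ?_⟩, ⟨by omega, ?_⟩, ?_⟩
      · have hAj := hA j hj
        rcases Nat.eq_zero_or_pos j with rfl | hj0
        · rw [asc_zero_iff] at hAj ⊢
          rwa [e3, e3] <;> norm_num <;> omega
        · have a1 : |(j : ℤ)| = j := abs_of_pos (by omega)
          have a2 : |(j : ℤ) + 1| = j + 1 := abs_of_pos (by omega)
          rw [asc_iff (by omega)] at hAj ⊢
          have hj' : ((j : ℤ) ≠ p + 1 ∧ (j : ℤ) + 1 ≠ p + 1) ∧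
              ((j : ℤ) = p + 2 * k + 1 - 2 * i → 1 ≤ i) := by
            rw [Finset.mem_union, Finset.mem_Icc] at hj
            rcases hj with hj | hj
            · have := h0 j hj; omega
            · omega
          by_cases hq : (j : ℤ) = p + 2 * k + 1 - 2 * i
          · rw [e3 (j + 1) (by omega) (by omega), hq, e2]
            exact c2 (hj'.2 hq)
          · by_cases hq' : (j : ℤ) + 1 = p + 2 * k + 1 - 2 * i
            · rw [hq', e2, e3 _ (by omega) (by omega)]
              rw [show (j : ℤ) = p + 2 * k - 2 * i by omega]
              exact c1
            · rwa [e3, e3] <;> omega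
      · rw [e1, e3]
        · exact hb _ _ (by push_cast; omega) (by push_cast; omega) (by omega)
        · rw [abs_of_pos (by push_cast; omega)]; push_cast; omega
        · rw [abs_of_pos (by push_cast; omega)]; push_cast; omega
      · rintro ⟨h, h'⟩
        rw [e1, e3] at h'
        · exact absurd (hb (p + 2 * k + 1 - 2 * i) (p + 2 * k + 2 - 2 * i) (by omega) (by omega)
            (by omega)) (by omega)
        · rw [abs_of_pos (by omega)]; omega
        · rw [abs_of_pos (by omega)]; omega
    · intro σ hσ t ht1 ht2
      obtain ⟨hσ1, hσ2, hσ3⟩ := mem_sel.mp hσ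
      have hb := hblock σ hσ1
      have b1 := hb t (p + 2 * k + 1 - 2 * i) (by omega) ht2 (by omega)
      have b2 : σ t < σ (p + 1) := by
        refine lt_of_le_of_lt ?_ hσ2.2
        rcases eq_or_lt_of_le
          (show t ≤ (p : ℤ) + 2 * k + 2 - 2 * (i + 1 : ℕ) by push_cast; omega) with h | h
        · rw [h]
        · exact (hb _ _ (by omega) h (by push_cast; omega)).le
      omega

/-! ### A free position after a first block of even length. -/

theorem pairInv_neg_left (u v : ℤ) : pairInv (-u) v = pairInv u v := by
  unfold pairInv
  rw [neg_neg, add_comm]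

theorem pairInv_congr_left {u u' : ℤ} (h : |u| = |u'|) (v : ℤ) : pairInv u v = pairInv u' v := by
  rcases abs_eq_abs.mp h with rfl | rfl
  · rfl
  · exact pairInv_neg_left _ _

/-- Together with `pairInv_of_abs_gt`: the sign of an entry matters to a pair only if the entry
stands on the right and has the larger absolute value. -/
theorem pairInv_of_abs_lt {u v : ℤ} (h : |u| < |v|) : pairInv u v = if v < 0 then 2 else 0 := by
  rcases abs_cases u with h1 | h1 <;> rcases abs_cases v with h2 | h2 <;> unfold pairInv <;>
    split_ifs <;> omega

theorem pairInv_of_abs_gt {u v : ℤ} (h : |v| < |u|) : pairInv u v = 1 := by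
  rcases abs_cases u with h1 | h1 <;> rcases abs_cases v with h2 | h2 <;> unfold pairInv <;>
    split_ifs <;> omega

open Classical in
/-- Exchange the absolute values of the entries in positions `q` and `l`, keeping the signs. -/
noncomputable def absSwap (q l : ℤ) (σ : Equiv.Perm ℤ) : Equiv.Perm ℤ :=
  if 0 < σ q ↔ 0 < σ l then σ * signedSwap q l else σ * signedSwap q (-l)

/-- If the two signs differ, then -σ l has the sign of σ q and -σ q that of σ l. Exchanging with
both signs reversed thus preserves the sign at each position. -/
theorem absSwap_facts {n : ℕ} {q l : ℤ} (h1 : 1 ≤ q) (h2 : q < l) (h3 : l ≤ n)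
    {σ : Equiv.Perm ℤ} (hσ : σ ∈ D n) :
    absSwap q l σ ∈ D n ∧ |absSwap q l σ q| = |σ l| ∧ |absSwap q l σ l| = |σ q| ∧
    (0 < absSwap q l σ q ↔ 0 < σ q) ∧ (0 < absSwap q l σ l ↔ 0 < σ l) ∧
    (∀ t, |t| ≠ q → |t| ≠ l → absSwap q l σ t = σ t) ∧ absSwap q l (absSwap q l σ) = σ := by
  obtain ⟨a, b, c⟩ := signedSwap_facts h1 h2
  have b' : -l ≠ 0 := by omega
  have c' : |q| ≠ |-l| := by rwa [abs_neg]
  have d1 : |q| = q := abs_of_pos (by omega)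
  have d2 : |l| = l := abs_of_pos (by omega)
  have n1 := D_ne_zero hσ a
  have n2 := D_ne_zero hσ b
  by_cases h : 0 < σ q ↔ 0 < σ l
  · obtain ⟨e1, e2, e3⟩ := mul_signedSwap_apply h1 h2 σ
    have e : absSwap q l σ = σ * signedSwap q l := by simp [absSwap, h]
    rw [e]
    refine ⟨mul_signedSwap_mem_D h1 h2 h3 hσ, by rw [e1], by rw [e2], by rw [e1, h],
      by rw [e2, h], e3, ?_⟩
    rw [absSwap, if_pos (by rw [e1, e2, h]), mul_assoc, signedSwap_mul_self a b c, mul_one]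
  · have e : absSwap q l σ = σ * signedSwap q (-l) := by simp [absSwap, h]
    have s1 : signedSwap q (-l) q = -l := by rw [signedSwap_apply a b' c', if_pos rfl]
    have s2 : signedSwap q (-l) l = -q := by
      rw [signedSwap_apply a b' c', if_neg (by omega), if_neg (by omega), if_neg (by omega),
        if_pos (by omega)]
    have s3 : ∀ t, |t| ≠ q → |t| ≠ l → signedSwap q (-l) t = t := fun t ht ht' =>
      signedSwap_of_ne a b' c' (by omega) (by rw [abs_neg]; omega)
    have e1 : absSwap q l σ q = -σ l := by rw [e, Equiv.Perm.mul_apply, s1, D_odd hσ]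
    have e2 : absSwap q l σ l = -σ q := by rw [e, Equiv.Perm.mul_apply, s2, D_odd hσ]
    refine ⟨?_, by rw [e1, abs_neg], by rw [e2, abs_neg], by rw [e1]; omega, by rw [e2]; omega,
      fun t h h' => by rw [e, Equiv.Perm.mul_apply, s3 t h h'], ?_⟩
    · rw [e]
      refine mul_mem_D h1 h2 h3 hσ s3 (signedSwap_neg a b' c') ?_
      rw [s1, s2, D_odd hσ, D_odd hσ]
      unfold sg
      split_ifs <;> omega
    · rw [absSwap, if_neg (by rw [e1, e2]; omega), e, mul_assoc, signedSwap_mul_self a b' c',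
        mul_one]

/-- The reversal of the signs in positions `q` and `l`. -/
def signFlip (q l : ℤ) : Equiv.Perm ℤ := Equiv.swap q (-q) * Equiv.swap l (-l)

theorem signFlip_apply {q l : ℤ} (h1 : 1 ≤ q) (h2 : q < l) (k : ℤ) :
    signFlip q l k = if k = q ∨ k = l ∨ k = -q ∨ k = -l then -k else k := by
  rw [signFlip, Equiv.Perm.mul_apply, Equiv.swap_apply_def, Equiv.swap_apply_def]
  split_ifs <;> omega

theorem signFlip_mul_self {q l : ℤ} (h1 : 1 ≤ q) (h2 : q < l) :
    signFlip q l * signFlip q l = 1 := by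
  ext k
  rw [Equiv.Perm.mul_apply, signFlip_apply h1 h2, signFlip_apply h1 h2, Equiv.Perm.one_apply]
  split_ifs <;> omega

theorem mul_signFlip_facts {n : ℕ} {q l : ℤ} (h1 : 1 ≤ q) (h2 : q < l) (h3 : l ≤ n)
    {σ : Equiv.Perm ℤ} (hσ : σ ∈ D n) :
    σ * signFlip q l ∈ D n ∧ (σ * signFlip q l) q = -σ q ∧ (σ * signFlip q l) l = -σ l ∧
    (σ * signFlip q l) (-q) = σ q ∧
    (∀ t, |t| ≠ q → |t| ≠ l → (σ * signFlip q l) t = σ t) := by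
  have s1 : signFlip q l q = -q := by rw [signFlip_apply h1 h2, if_pos (by simp)]
  have s2 : signFlip q l l = -l := by rw [signFlip_apply h1 h2, if_pos (by simp)]
  have s4 : signFlip q l (-q) = q := by rw [signFlip_apply h1 h2, if_pos (by simp), neg_neg]
  have s3 : ∀ t, |t| ≠ q → |t| ≠ l → signFlip q l t = t := by
    intro t ht ht'
    rw [signFlip_apply h1 h2, if_neg]
    rcases abs_cases t with h | h <;> omega
  refine ⟨?_, by rw [Equiv.Perm.mul_apply, s1, D_odd hσ],
    by rw [Equiv.Perm.mul_apply, s2, D_odd hσ], by rw [Equiv.Perm.mul_apply, s4],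
    fun t h h' => by rw [Equiv.Perm.mul_apply, s3 t h h']⟩
  refine mul_mem_D h1 h2 h3 hσ s3 (fun k => ?_) ?_
  · rw [signFlip_apply h1 h2, signFlip_apply h1 h2]
    split_ifs <;> omega
  · have n1 := D_ne_zero hσ (k := q) (by omega)
    have n2 := D_ne_zero hσ (k := l) (by omega)
    rw [s1, s2, D_odd hσ, D_odd hσ]
    unfold sg
    split_ifs <;> omega

/-- The even positions are those at odd distance from 2c+1. Each adds 2 to the odd length when a
dominating entry at 2c+1 becomes negative. -/
theorem sum_even_two (c : ℕ) :
    ∑ i ∈ Finset.Ico (1 : ℤ) (2 * c + 1), (if Even i then 2 else 0) = 2 * c := by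
  induction c with
  | zero => simp
  | succ c ih =>
    have : Finset.Ico (1 : ℤ) (2 * (c + 1 : ℕ) + 1) =
        insert (2 * (c : ℤ) + 1) (insert (2 * (c : ℤ) + 2) (Finset.Ico (1 : ℤ) (2 * (c : ℤ) + 1))) := by
      ext i
      simp only [Finset.mem_insert, Finset.mem_Ico]
      push_cast
      omega
    rw [this, Finset.sum_insert, Finset.sum_insert, ih, if_neg, if_pos]
    · ring
    · exact ⟨(c : ℤ) + 1, by ring⟩
    · rw [Int.not_even_iff_odd]; exact ⟨(c : ℤ), by ring⟩
    · simp
    · simp only [Finset.mem_insert, Finset.mem_Ico]; omega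

/-- Adding a positive entry with sign reversed that dominates all entries on its left. -/
theorem wt_mul_signFlip {n c : ℕ} (hc : 1 ≤ c) (hn : 2 * c + 1 ≤ n) {σ : Equiv.Perm ℤ}
    (hσ : σ ∈ D n) (hdom : ∀ t : ℤ, 1 ≤ t → t < 2 * c + 1 → |σ t| < σ (2 * c + 1)) :
    wt n ↑(σ * signFlip 1 (2 * c + 1)) = wt n σ * Polynomial.X ^ (2 * c) := by
  have hlt : (1 : ℤ) < 2 * c + 1 := by omega
  obtain ⟨-, e1, e2, -, e3⟩ := mul_signFlip_facts (n := n) le_rfl hlt (by omega) hσ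
  have habs : ∀ t : ℤ, 1 ≤ t → |(σ * signFlip 1 (2 * c + 1)) t| = |σ t| := by
    intro t ht
    by_cases h1 : t = 1
    · rw [h1, e1, abs_neg]
    · by_cases h2 : t = 2 * c + 1
      · rw [h2, e2, abs_neg]
      · have : |t| = t := abs_of_pos (by omega)
        rw [e3 t (by omega) (by omega)]
  have hpos : 0 < σ (2 * c + 1) := lt_of_le_of_lt (abs_nonneg _) (hdom 1 le_rfl hlt)
  -- The sign at position 1 is invisible, because that position is the left one in all its pairs.
  -- Only the 2c pairs ending at 2c+1 change, each from 0 to 2.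
  have hpair : ∀ i j : ℤ, 1 ≤ i → i < j →
      pairInv ((σ * signFlip 1 (2 * c + 1)) i) ((σ * signFlip 1 (2 * c + 1)) j) =
      pairInv (σ i) (σ j) + if j = 2 * c + 1 then 2 else 0 := by
    intro i j hi hij
    rw [pairInv_congr_left (habs i hi)]
    split_ifs with hj
    · have hd := hdom i hi (by omega)
      rw [hj, e2, pairInv_of_abs_lt (by rwa [abs_neg, abs_of_pos hpos]),
        pairInv_of_abs_lt (by rwa [abs_of_pos hpos]), if_pos (by omega), if_neg (by omega)]
    · have : |j| = j := abs_of_pos (by omega)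
      rw [e3 j (by omega) (by omega), add_zero]
  have hmem : (2 * (c : ℤ) + 1) ∈ Finset.Icc (1 : ℤ) n := by
    rw [Finset.mem_Icc]; omega
  have h1 : len n ↑(σ * signFlip 1 (2 * c + 1)) = len n σ + 2 * (2 * c) := by
    unfold len pairSum
    have : ∀ j ∈ Finset.Icc (1 : ℤ) n, (∑ i ∈ Finset.Ico 1 j,
        pairInv ((σ * signFlip 1 (2 * c + 1)) i) ((σ * signFlip 1 (2 * c + 1)) j)) =
        (∑ i ∈ Finset.Ico 1 j, pairInv (σ i) (σ j)) +
          if j = 2 * c + 1 then 2 * (2 * c) else 0 := by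
      intro j _
      rw [Finset.sum_congr rfl fun i hi => hpair i j (Finset.mem_Ico.mp hi).1
        (Finset.mem_Ico.mp hi).2, Finset.sum_add_distrib]
      congr 1
      split_ifs with hj
      · rw [Finset.sum_const, hj, Int.card_Ico, smul_eq_mul]
        omega
      · simp
    rw [Finset.sum_congr rfl this, Finset.sum_add_distrib, Finset.sum_ite_eq', if_pos hmem]
  have h2 : oddLen n ↑(σ * signFlip 1 (2 * c + 1)) = oddLen n σ + 2 * c := by
    unfold oddLen pairSum
    have : ∀ j ∈ Finset.Icc (1 : ℤ) n, (∑ i ∈ Finset.Ico 1 j, if Odd (j - i) then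
        pairInv ((σ * signFlip 1 (2 * c + 1)) i) ((σ * signFlip 1 (2 * c + 1)) j) else 0) =
        (∑ i ∈ Finset.Ico 1 j, if Odd (j - i) then pairInv (σ i) (σ j) else 0) +
          if j = 2 * c + 1 then 2 * c else 0 := by
      intro j _
      have : (if j = 2 * c + 1 then 2 * c else 0) = ∑ i ∈ Finset.Ico 1 j,
          if j = 2 * c + 1 then (if Even i then 2 else 0) else 0 := by
        split_ifs with hj
        · rw [hj, sum_even_two]
        · simp
      rw [this, ← Finset.sum_add_distrib]
      refine Finset.sum_congr rfl fun i hi => ?_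
      rw [Finset.mem_Ico] at hi
      rw [hpair i j hi.1 hi.2]
      by_cases hj : j = 2 * c + 1
      · have : Odd (j - i) ↔ Even i := by
          rw [Int.odd_iff, Int.even_iff]; omega
        simp only [hj, if_true] at this ⊢
        simp only [this]
        split_ifs <;> rfl
      · simp [hj]
    rw [Finset.sum_congr rfl this, Finset.sum_add_distrib, Finset.sum_ite_eq', if_pos hmem]
  rw [wt, wt, h1, h2, pow_add, pow_add, pow_mul (-1 : ℤ[X]) 2, neg_one_sq, one_pow]
  ring

/-- In a first block with at least two entries the entries increase in absolute value. -/
theorem abs_lt_of_asc {n a : ℕ} (ha : 2 ≤ a) {I : Finset ℕ} (hI : Finset.range a ⊆ I)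
    {σ : Equiv.Perm ℤ} (hσ : σ ∈ ascSet n I) {s t : ℤ} (hs : 1 ≤ s) (hst : s < t) (ht : t ≤ a) :
    |σ s| < σ t := by
  obtain ⟨hD, hA⟩ := mem_ascSet.mp hσ
  have hA' : ∀ j : ℕ, j < a → Asc σ j := fun j hj => hA j (hI (Finset.mem_range.mpr hj))
  have h0 := asc_zero_iff.mp (hA' 0 (by omega))
  rw [D_odd hD] at h0
  have hinc : ∀ b c : ℤ, 1 ≤ b → b < c → c ≤ a → σ b < σ c := fun b c hb hbc hc =>
    lt_of_asc (f := σ) (u := 1) (v := a) le_rfl (fun j _ hj => hA' j (by omega)) hb hbc hc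
  have h2 : σ 2 ≤ σ t := by
    rcases eq_or_lt_of_le (show (2 : ℤ) ≤ t by omega) with h | h
    · rw [h]
    · exact (hinc 2 t (by omega) h ht).le
  have h1 : σ 1 ≤ σ s := by
    rcases eq_or_lt_of_le hs with h | h
    · rw [h]
    · exact (hinc 1 s le_rfl h (by omega)).le
  have h3 := hinc s t hs hst ht
  rw [abs_lt]
  omega

/-- Ascents at 0 and 1 amount to |σ 1| < σ 2, which leaves the sign of σ 1 free. It can compensate a
change of sign at l, a position that no required ascent involves. -/
theorem mul_signFlip_mem_ascSet {n : ℕ} {l : ℤ} (hl : 3 ≤ l) (hn : l ≤ n) {I : Finset ℕ}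
    (h0 : 0 ∈ I) (h1 : 1 ∈ I) (hI : ∀ j ∈ I, (j : ℤ) ≠ l ∧ (j : ℤ) + 1 ≠ l)
    {σ : Equiv.Perm ℤ} (hσ : σ ∈ ascSet n I) : σ * signFlip 1 l ∈ ascSet n I := by
  have h12 := abs_lt_of_asc (n := n) (I := I) (a := 2) le_rfl (fun i hi => by
    rw [Finset.mem_range] at hi
    interval_cases i <;> assumption) hσ (s := 1) (t := 2) le_rfl (by norm_num) (by norm_num)
  obtain ⟨hD, hAs⟩ := mem_ascSet.mp hσ
  obtain ⟨f1, f2, f3, f4, f5⟩ := mul_signFlip_facts le_rfl (by omega : (1 : ℤ) < l) hn hD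
  rw [abs_lt] at h12
  refine mem_ascSet.mpr ⟨f1, fun j hj => ?_⟩
  have hj' := hAs j hj
  have hj'' := hI j hj
  have f52 := f5 2 (by norm_num) (by norm_num; omega)
  rcases Nat.eq_zero_or_pos j with rfl | hj0
  · rw [asc_zero_iff, f4, f52]
    omega
  · have a1 : |(j : ℤ)| = j := abs_of_pos (by omega)
    have a2 : |(j : ℤ) + 1| = j + 1 := abs_of_pos (by omega)
    rw [asc_iff (by omega)] at hj' ⊢
    rw [f5 (j + 1) (by omega) (by omega)]
    by_cases h1 : j = 1
    · subst h1
      norm_num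
      norm_num at f2
      rw [f2]
      omega
    · rwa [f5 j (by omega) (by omega)]

/-- This is the cancellation of `F_append` with absolute values. In layer i, σ(2i) < |σ(2c+1)| <
σ(2i+2), without the lower bound if i = 0, and `absSwap` acts on the positions 2i+1 and 2c+1.
Keeping the signs in place is what preserves the odd length. -/
theorem sum_dominated_eq_zero {n c : ℕ} (hc : 1 ≤ c) (hn : 2 * c + 1 ≤ n) {I₀ : Finset ℕ}
    (h0 : ∀ i ∈ I₀, 2 * c + 2 ≤ i) :
    ∑ σ ∈ sel (ascSet n (Finset.range (2 * c) ∪ I₀))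
      (fun σ => |σ (2 * (c : ℤ) + 1)| < σ (2 * (c : ℤ))), wt n σ = 0 := by
  have hz := sum_sel_eq_zero_of_steps
    (S := ascSet n (Finset.range (2 * c) ∪ I₀)) (g := fun σ => wt n σ)
    (fun i σ => 1 ≤ i ∧ |σ (2 * (c : ℤ) + 1)| < σ (2 * (i : ℤ))) c (by simp) ?_ ?_
  · convert hz using 4
    simp [hc]
  · rintro i hi σ hσ ⟨h1, h2⟩
    refine ⟨by omega, h2.trans (lt_of_abs_lt (abs_lt_of_asc (a := 2 * c) (by omega)
      Finset.subset_union_left hσ ?_ ?_ ?_))⟩ <;> push_cast <;> omega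
  · intro i hi
    have h1 : (1 : ℤ) ≤ 2 * i + 1 := by omega
    have h2 : 2 * (i : ℤ) + 1 < 2 * c + 1 := by omega
    have h3 : 2 * (c : ℤ) + 1 ≤ n := by omega
    have hpar : Even (2 * (c : ℤ) + 1 - (2 * i + 1)) := ⟨(c : ℤ) - i, by ring⟩
    refine sum_eq_zero_of_involution (absSwap (2 * i + 1) (2 * c + 1)) (fun σ hσ => ?_)
      (fun σ hσ => ?_) (fun σ hσ => ?_)
    · obtain ⟨hσ1, ⟨-, hσ2⟩, hσ3⟩ := mem_sel.mp hσ
      obtain ⟨hD, hA⟩ := mem_ascSet.mp hσ1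
      obtain ⟨f1, f2, f3, f4, f5, f6, -⟩ := absSwap_facts h1 h2 h3 hD
      have hb := fun {s t : ℤ} => abs_lt_of_asc (a := 2 * c) (by omega)
        Finset.subset_union_left hσ1 (s := s) (t := t)
      push_cast at hb hσ2
      have u1 : |σ (2 * i + 1)| < σ (2 * (i + 1)) := hb h1 (by omega) (by omega)
      have u2 : absSwap (2 * i + 1) (2 * c + 1) σ (2 * (i + 1)) = σ (2 * (i + 1)) := by
        refine f6 _ ?_ ?_ <;> rw [abs_of_pos (by omega)] <;> omega
      have u3 : 1 ≤ i →
          absSwap (2 * i + 1) (2 * c + 1) σ (2 * i) = σ (2 * i) ∧ 0 < σ (2 * i + 1) ∧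
          σ (2 * i) < |σ (2 * c + 1)| ∧ |σ (2 * i)| = σ (2 * i) ∧ σ (2 * i) < σ (2 * i + 1) := by
        intro h
        have k1 : |σ 1| < σ (2 * i) := hb le_rfl (by omega) (by omega)
        have k2 : |σ 1| < σ (2 * i + 1) := hb le_rfl (by omega) (by omega)
        have k3 := abs_nonneg (σ 1)
        have k4 : |σ (2 * i)| = σ (2 * i) := abs_of_pos (by omega)
        have k5 : |σ (2 * (i : ℤ))| < σ (2 * i + 1) := hb (by omega) (by omega) (by omega)
        refine ⟨?_, by omega, ?_, k4, by omega⟩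
        · refine f6 _ ?_ ?_ <;> rw [abs_of_pos (by omega)] <;> omega
        · have k4 : |σ (2 * i)| ≠ |σ (2 * c + 1)| := fun h => by
            have := D_inj hD (by omega) (by omega) h
            omega
          by_contra h'
          exact hσ3 ⟨h, by omega⟩
      refine mem_sel.mpr ⟨mem_ascSet.mpr ⟨f1, fun j hj => ?_⟩, ⟨by omega, ?_⟩, ?_⟩
      · have hAj := hA j hj
        rw [Finset.mem_union, Finset.mem_range] at hj
        rcases Nat.eq_zero_or_pos j with rfl | hj0
        · rw [asc_zero_iff] at hAj ⊢
          rw [D_odd f1]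
          rcases Nat.eq_zero_or_pos i with rfl | hi0
          · norm_num at u2 f2 hσ2 ⊢
            rw [u2]
            rw [← f2, abs_lt] at hσ2
            omega
          · rw [f6 1, f6 2, ← D_odd hD]
            · exact hAj
            all_goals norm_num
            all_goals omega
        · have a1 : |(j : ℤ)| = j := abs_of_pos (by omega)
          have a2 : |(j : ℤ) + 1| = j + 1 := abs_of_pos (by omega)
          rw [asc_iff (by omega)] at hAj ⊢
          have hj' : (j : ℤ) ≠ 2 * c + 1 ∧ (j : ℤ) + 1 ≠ 2 * c + 1 := by
            rcases hj with hj | hj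
            · omega
            · have := h0 j hj; omega
          by_cases hq : (j : ℤ) = 2 * i + 1
          · rw [hq, show (2 * (i : ℤ) + 1 + 1) = 2 * (i + 1) by ring, u2]
            rw [← f2] at hσ2
            exact lt_of_abs_lt hσ2
          · by_cases hq' : (j : ℤ) + 1 = 2 * i + 1
            · obtain ⟨k1, k2, k3, k4, k5⟩ := u3 (by omega)
              rw [hq', show (j : ℤ) = 2 * i by omega, k1]
              rw [← f2, abs_of_pos (f4.mpr k2)] at k3
              exact k3
            · rwa [f6, f6] <;> omega
      · push_cast
        rw [f3, u2]
        exact u1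
      · rintro ⟨h, h'⟩
        obtain ⟨k1, k2, k3, k4, k5⟩ := u3 h
        rw [f3, k1, abs_of_pos k2] at h'
        omega
    · exact (absSwap_facts h1 h2 h3 (mem_ascSet.mp (mem_sel.mp hσ).1).1).2.2.2.2.2.2
    · obtain ⟨hσ1, ⟨-, hσ2⟩, hσ3⟩ := mem_sel.mp hσ
      obtain ⟨hD, hA⟩ := mem_ascSet.mp hσ1
      obtain ⟨f1, f2, f3, f4, f5, f6, -⟩ := absSwap_facts h1 h2 h3 hD
      have hb := fun {s t : ℤ} => abs_lt_of_asc (a := 2 * c) (by omega)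
        Finset.subset_union_left hσ1 (s := s) (t := t)
      push_cast at hb hσ2
      have n1 := D_ne_zero hD (k := 2 * i + 1) (by omega)
      have n2 := D_ne_zero hD (k := 2 * c + 1) (by omega)
      have n3 := D_ne_zero f1 (k := 2 * i + 1) (by omega)
      have n4 := D_ne_zero f1 (k := 2 * c + 1) (by omega)
      have hoff : ∀ t ∈ others n (2 * i + 1) (2 * c + 1),
          σ t = absSwap (2 * i + 1) (2 * c + 1) σ t := by
        intro t ht
        rw [mem_others] at ht
        have : |t| = t := abs_of_pos (by omega)
        exact (f6 t (by omega) (by omega)).symm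
      refine wt_eq_neg ?_ ?_
      · rw [add_comm]
        refine len_add_odd h1 h2 h3 hoff (fun x hx y hy => ?_) f2 f3
        rw [Finset.mem_Icc] at hx hy
        exact D_inj hD (by omega) (by omega)
      · refine (oddLen_congr h1 h2 h3 hpar hoff fun t ht _ => ?_).symm
        have e4 := hoff t ht
        rw [mem_others] at ht
        unfold posInv
        rw [← e4]
        -- To the left of both positions, |σ t| is smaller than both absolute values and only the
        -- preserved signs count. Between them, |σ t| is larger than both. To the right, only the
        -- two absolute values count, and these are interchanged.
        rcases lt_or_gt_of_ne ht.2.1 with h | h <;> rcases lt_or_gt_of_ne ht.2.2 with h' | h'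
        · have k1 : |σ t| < σ (2 * i + 1) := hb ht.1.1 h (by omega)
          have k2 : |σ t| < |σ (2 * c + 1)| := by
            have m1 : σ (2 * (i : ℤ)) ≤ |σ (2 * c + 1)| := by
              by_contra h'
              exact hσ3 ⟨by omega, by omega⟩
            refine lt_of_le_of_lt ?_ (lt_of_le_of_ne m1 ?_)
            · rcases eq_or_lt_of_le (show t ≤ 2 * (i : ℤ) by omega) with h | h
              · rw [h, abs_of_pos]
                exact lt_of_le_of_lt (abs_nonneg _) (hb le_rfl (show 1 < 2 * (i : ℤ) by omega)
                  (by omega))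
              · exact (hb (by omega) h (by omega)).le
            · intro h
              have : |σ (2 * (i : ℤ))| = |σ (2 * c + 1)| := by rw [h, abs_abs]
              have := D_inj hD (by omega) (by omega) this
              omega
          have k3 := k1.trans_le (le_abs_self _)
          simp only [h, h', if_true]
          rw [pairInv_of_abs_lt k3, pairInv_of_abs_lt k2, pairInv_of_abs_lt (by rwa [f2]),
            pairInv_of_abs_lt (by rwa [f3])]
          split_ifs <;> omega
        · omega
        · have k1 : |σ (2 * i + 1)| < |σ t| :=
            (hb h1 h (by omega)).trans_le (le_abs_self _)
          have k2 : |σ (2 * c + 1)| < σ t := by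
            refine hσ2.trans_le ?_
            rcases eq_or_lt_of_le (show 2 * ((i : ℤ) + 1) ≤ t by omega) with h | h
            · rw [h]
            · exact (lt_of_abs_lt (hb (by omega) h (by omega))).le
          have k3 := k2.trans_le (le_abs_self _)
          have k4 := lt_of_le_of_lt (abs_nonneg _) k2
          simp only [h.not_gt, h', if_true, if_false]
          rw [pairInv_of_abs_lt k1, pairInv_of_abs_gt k3, pairInv_of_abs_lt (by rwa [f2]),
            pairInv_of_abs_gt (by rwa [f3])]
        · simp only [h.not_gt, h'.not_gt, if_false]
          rw [pairInv_congr_left f2, pairInv_congr_left f3, add_comm]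

/-- Joining a free position to a first block of even length. -/
theorem F_join_first {n c : ℕ} (hc : 1 ≤ c) (hn : 2 * c + 1 ≤ n) {I₀ : Finset ℕ}
    (h0 : ∀ i ∈ I₀, 2 * c + 2 ≤ i) :
    F n (Finset.range (2 * c) ∪ I₀) =
      (1 + Polynomial.X ^ (2 * c)) * F n (Finset.range (2 * c + 1) ∪ I₀) := by
  have hlt : (1 : ℤ) < 2 * c + 1 := by omega
  have hA : ∀ σ, σ ∈ ascSet n (Finset.range (2 * c + 1) ∪ I₀) ↔
      σ ∈ ascSet n (Finset.range (2 * c) ∪ I₀) ∧ σ (2 * (c : ℤ)) < σ (2 * c + 1) := by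
    intro σ
    have : Finset.range (2 * c + 1) ∪ I₀ = insert (2 * c) (Finset.range (2 * c) ∪ I₀) := by
      rw [Finset.range_add_one, Finset.insert_union]
    rw [this, mem_ascSet, mem_ascSet, Finset.forall_mem_insert, asc_iff (by omega)]
    push_cast
    tauto
  -- Put y = σ(2c) > 0 and x = σ(2c+1). The case y < x is the enlarged block, the case |x| < y
  -- cancels, and the case x < -y corresponds to y < x under the reversal of the signs at 1 and
  -- 2c+1, which costs X^{2c}.
  have hsplit : F n (Finset.range (2 * c) ∪ I₀) =
      F n (Finset.range (2 * c + 1) ∪ I₀) +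
      ∑ σ ∈ sel (ascSet n (Finset.range (2 * c) ∪ I₀))
        (fun σ => σ (2 * (c : ℤ) + 1) < -σ (2 * c)), wt n σ := by
    unfold F
    rw [← sum_sel_add_sum_sel_not (ascSet n (Finset.range (2 * c) ∪ I₀))
      (fun σ => |σ (2 * (c : ℤ) + 1)| < σ (2 * (c : ℤ))), sum_dominated_eq_zero hc hn h0,
      zero_add, ← sum_sel_add_sum_sel_not _ (fun σ => σ (2 * (c : ℤ)) < σ (2 * c + 1))]
    have hpos : ∀ σ ∈ ascSet n (Finset.range (2 * c) ∪ I₀), 0 < σ (2 * (c : ℤ)) := by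
      intro σ hσ
      refine lt_of_le_of_lt (abs_nonneg (σ 1)) (abs_lt_of_asc (a := 2 * c) (by omega)
        Finset.subset_union_left hσ le_rfl ?_ ?_) <;> push_cast <;> omega
    have hne : ∀ σ ∈ ascSet n (Finset.range (2 * c) ∪ I₀),
        |σ (2 * (c : ℤ))| ≠ |σ (2 * c + 1)| := by
      intro σ hσ h
      have := D_inj (mem_ascSet.mp hσ).1 (by omega) (by omega) h
      omega
    congr 1
    · refine Finset.sum_congr ?_ fun _ _ => rfl
      ext σ
      rw [mem_sel, mem_sel, hA, and_assoc]
      refine and_congr_right fun hσ => ?_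
      have := hpos σ hσ
      rcases abs_cases (σ (2 * (c : ℤ) + 1)) with h | h <;> omega
    · refine Finset.sum_congr ?_ fun _ _ => rfl
      ext σ
      rw [mem_sel, mem_sel, mem_sel, and_assoc]
      refine and_congr_right fun hσ => ?_
      have h1 := hpos σ hσ
      have h2 := hne σ hσ
      rw [abs_of_pos h1] at h2
      rcases abs_cases (σ (2 * (c : ℤ) + 1)) with h | h <;> omega
  rw [hsplit, add_mul, one_mul]
  congr 1
  unfold F
  rw [Finset.mul_sum]
  have hflip : ∀ σ ∈ ascSet n (Finset.range (2 * c) ∪ I₀),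
      σ * signFlip 1 (2 * c + 1) ∈ ascSet n (Finset.range (2 * c) ∪ I₀) := by
    intro σ hσ
    refine mul_signFlip_mem_ascSet (by omega) (by omega) ?_ ?_ (fun j hj => ?_) hσ
    · exact Finset.mem_union_left _ (Finset.mem_range.mpr (by omega))
    · exact Finset.mem_union_left _ (Finset.mem_range.mpr (by omega))
    · rw [Finset.mem_union, Finset.mem_range] at hj
      rcases hj with hj | hj
      · omega
      · have := h0 j hj; omega
  have hmul : ∀ σ : Equiv.Perm ℤ,
      σ * signFlip 1 (2 * c + 1) * signFlip 1 (2 * c + 1) = σ := fun σ => by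
    rw [mul_assoc, signFlip_mul_self le_rfl hlt, mul_one]
  symm
  refine Finset.sum_bij' (fun σ _ => σ * signFlip 1 (2 * c + 1))
    (fun σ _ => σ * signFlip 1 (2 * c + 1)) ?_ ?_ (fun σ _ => hmul σ) (fun σ _ => hmul σ) ?_
  · intro σ hσ
    obtain ⟨h1, h2⟩ := (hA σ).mp hσ
    obtain ⟨f1, f2, f3, f4, f5⟩ := mul_signFlip_facts (n := n) le_rfl hlt (by omega)
      (mem_ascSet.mp h1).1
    refine mem_sel.mpr ⟨hflip σ h1, ?_⟩
    rw [f3, f5 (2 * c)]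
    · omega
    all_goals rw [abs_of_pos (by omega)]; omega
  · intro σ hσ
    obtain ⟨h1, h2⟩ := mem_sel.mp hσ
    obtain ⟨f1, f2, f3, f4, f5⟩ := mul_signFlip_facts (n := n) le_rfl hlt (by omega)
      (mem_ascSet.mp h1).1
    refine (hA _).mpr ⟨hflip σ h1, ?_⟩
    rw [f3, f5 (2 * c)]
    · omega
    all_goals rw [abs_of_pos (by omega)]; omega
  · intro σ hσ
    rw [wt_mul_signFlip hc hn (mem_ascSet.mp hσ).1, mul_comm]
    intro t h1 h2
    refine abs_lt_of_asc (a := 2 * c + 1) (by omega) Finset.subset_union_left hσ h1 h2 ?_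
    push_cast
    omega

/-! ### Inserting a last entry. -/

/-- The signed cycle of values `N ↦ j`, `v ↦ v + 1` for `j ≤ v < N`. -/
def insertCycle (N j : ℤ) (hj : 1 ≤ j) (hN : j ≤ N) : Equiv.Perm ℤ where
  toFun v := if v = N then j else if v = -N then -j else if j ≤ v ∧ v < N then v + 1 else
    if -N < v ∧ v ≤ -j then v - 1 else v
  invFun v := if v = j then N else if v = -j then -N else if j < v ∧ v ≤ N then v - 1 else
    if -N ≤ v ∧ v < -j then v + 1 else v
  left_inv v := by
    dsimp only
    split_ifs <;> omega
  right_inv v := by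
    dsimp only
    split_ifs <;> omega

section insertCycle

variable {N j : ℤ} (hj : 1 ≤ j) (hN : j ≤ N)

theorem insertCycle_apply (v : ℤ) : insertCycle N j hj hN v =
    if v = N then j else if v = -N then -j else if j ≤ v ∧ v < N then v + 1 else
    if -N < v ∧ v ≤ -j then v - 1 else v := rfl

theorem insertCycle_neg (v : ℤ) : insertCycle N j hj hN (-v) = -insertCycle N j hj hN v := by
  rw [insertCycle_apply, insertCycle_apply]
  split_ifs <;> omega

theorem insertCycle_self : insertCycle N j hj hN N = j := by
  rw [insertCycle_apply, if_pos rfl]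

theorem insertCycle_of_abs_gt {v : ℤ} (hv : N < |v|) : insertCycle N j hj hN v = v := by
  rw [insertCycle_apply]
  rcases abs_cases v with h | h <;> split_ifs <;> omega

/-- Below N in absolute value the relabelling only skips ±j, so it is monotone. Ascents and pair
contributions among the first n positions therefore survive the insertion. -/
theorem insertCycle_lt_iff {u v : ℤ} (hu : |u| < N) (hv : |v| < N) :
    insertCycle N j hj hN u < insertCycle N j hj hN v ↔ u < v := by
  rw [abs_lt] at hu hv
  rw [insertCycle_apply, insertCycle_apply]
  split_ifs <;> omega

theorem abs_insertCycle {v : ℤ} (hv : |v| < N) :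
    |insertCycle N j hj hN v| = if j ≤ |v| then |v| + 1 else |v| := by
  rw [abs_lt] at hv
  rw [insertCycle_apply]
  rcases abs_cases v with h | h <;> split_ifs <;> first | omega | (rw [abs_of_pos (by omega)]; omega) | (rw [abs_of_neg (by omega)]; omega)

theorem sg_insertCycle (v : ℤ) : sg (insertCycle N j hj hN v) = sg v := by
  rw [insertCycle_apply]
  unfold sg
  split_ifs <;> omega

end insertCycle

theorem Icc_succ (n : ℕ) :
    Finset.Icc (1 : ℤ) ((n + 1 : ℕ) : ℤ) = insert ((n : ℤ) + 1) (Finset.Icc (1 : ℤ) n) := by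
  ext i
  simp only [Finset.mem_insert, Finset.mem_Icc]
  push_cast
  omega

theorem succ_notMem_Icc (n : ℕ) : ((n : ℤ) + 1) ∉ Finset.Icc (1 : ℤ) n := by
  simp

theorem Ico_eq_Icc (n : ℕ) : Finset.Ico (1 : ℤ) ((n : ℤ) + 1) = Finset.Icc (1 : ℤ) n := by
  ext i
  simp only [Finset.mem_Ico, Finset.mem_Icc]
  omega

theorem pairSum_succ (n : ℕ) (h : ℤ → ℤ → ℕ) :
    pairSum (n + 1) h = pairSum n h + ∑ i ∈ Finset.Icc (1 : ℤ) n, h i (n + 1) := by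
  unfold pairSum
  rw [Icc_succ, Finset.sum_insert (succ_notMem_Icc n), Ico_eq_Icc, add_comm]

theorem pairSum_congr {n : ℕ} {h h' : ℤ → ℤ → ℕ}
    (H : ∀ i j : ℤ, 1 ≤ i → i < j → j ≤ n → h i j = h' i j) : pairSum n h = pairSum n h' := by
  refine Finset.sum_congr rfl fun j hj => Finset.sum_congr rfl fun i hi => ?_
  rw [Finset.mem_Icc] at hj
  rw [Finset.mem_Ico] at hi
  exact H i j hi.1 hi.2 hj.2

theorem D_fix {n : ℕ} {τ : Equiv.Perm ℤ} (hτ : τ ∈ D n) {k : ℤ} (hk : (n : ℤ) < |k|) : τ k = k :=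
  (mem_D.mp hτ).1 k (by omega)

theorem insertCycle_mul_mem_D_iff {n : ℕ} {j : ℤ} (hj : 1 ≤ j) (hN : j ≤ (n : ℤ) + 1)
    {τ : Equiv.Perm ℤ} (hfix : τ ((n : ℤ) + 1) = n + 1) :
    insertCycle (n + 1) j hj hN * τ ∈ D (n + 1) ↔ τ ∈ D n := by
  have hprod : ∏ i ∈ Finset.Icc (1 : ℤ) ((n + 1 : ℕ) : ℤ),
      sg ((insertCycle (n + 1) j hj hN * τ) i) = ∏ i ∈ Finset.Icc (1 : ℤ) n, sg (τ i) := by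
    rw [Icc_succ, Finset.prod_insert (succ_notMem_Icc n)]
    simp only [Equiv.Perm.mul_apply, sg_insertCycle]
    rw [hfix, sg, if_neg (by omega), one_mul]
  rw [mem_D, mem_D, hprod]
  constructor
  · rintro ⟨h1, h2, h3⟩
    have hodd : ∀ k, τ (-k) = -τ k := by
      intro k
      have := h2 k
      rw [Equiv.Perm.mul_apply, Equiv.Perm.mul_apply, ← insertCycle_neg] at this
      exact (insertCycle (n + 1) j hj hN).injective this
    refine ⟨fun k hk => ?_, hodd, h3⟩
    by_cases hk' : |k| = n + 1
    · rcases abs_cases k with h | h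
      · rw [show k = n + 1 by omega, hfix]
      · rw [show k = -((n : ℤ) + 1) by omega, hodd, hfix]
    · have h4 := h1 k (by push_cast; omega)
      have h5 : insertCycle (n + 1) j hj hN k = k := insertCycle_of_abs_gt hj hN (by omega)
      rw [Equiv.Perm.mul_apply] at h4
      exact (insertCycle (n + 1) j hj hN).injective (h4.trans h5.symm)
  · rintro ⟨h1, h2, h3⟩
    refine ⟨fun k hk => ?_, fun k => ?_, h3⟩
    · push_cast at hk
      rw [Equiv.Perm.mul_apply, h1 k (by omega), insertCycle_of_abs_gt hj hN (by omega)]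
    · rw [Equiv.Perm.mul_apply, Equiv.Perm.mul_apply, h2, insertCycle_neg]

theorem insertCycle_mul_mem_ascSet_iff {n : ℕ} {j : ℤ} (hj : 1 ≤ j) (hN : j ≤ (n : ℤ) + 1)
    (hn : 2 ≤ n) {I : Finset ℕ} (hI : I ⊆ Finset.range n)
    {τ : Equiv.Perm ℤ} (hfix : τ ((n : ℤ) + 1) = n + 1) :
    insertCycle (n + 1) j hj hN * τ ∈ ascSet (n + 1) I ↔ τ ∈ ascSet n I := by
  rw [mem_ascSet, mem_ascSet, insertCycle_mul_mem_D_iff hj hN hfix]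
  refine and_congr_right fun hD => forall₂_congr fun i hi => ?_
  have hi := Finset.mem_range.mp (hI hi)
  have hlt : ∀ k : ℤ, |k| ≤ n → |τ k| < n + 1 := fun k hk => by
    have := D_abs_le hD hk
    omega
  rcases Nat.eq_zero_or_pos i with rfl | h0
  · rw [asc_zero_iff, asc_zero_iff, Equiv.Perm.mul_apply, Equiv.Perm.mul_apply,
      insertCycle_lt_iff hj hN (hlt _ (by norm_num; omega)) (hlt _ (by norm_num; omega))]
  · rw [asc_iff (by omega), asc_iff (by omega), Equiv.Perm.mul_apply, Equiv.Perm.mul_apply,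
      insertCycle_lt_iff hj hN (hlt _ _) (hlt _ _)]
    · rw [abs_of_pos (by omega)]; omega
    · rw [abs_of_pos (by omega)]; omega

/-- The insertion of a last entry `j + 1`. -/
def insertLast (n j : ℕ) (τ : Equiv.Perm ℤ) : Equiv.Perm ℤ :=
  if h : j ≤ n then insertCycle (n + 1) (j + 1) (by omega) (by omega) * τ else τ

/-- Position n+1 is free because I ⊆ [0, n-1]. Words with a positive last entry j+1 arise uniquely
by insertion. Those with a negative one arise from these by reversing the signs at 1 and n+1, which
respects the ascents since 0, 1 ∈ I. -/
theorem sum_ascSet_succ {n : ℕ} (hn : 2 ≤ n) {I : Finset ℕ} (hI : I ⊆ Finset.range n)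
    (h0 : 0 ∈ I) (h1 : 1 ∈ I) (g : Equiv.Perm ℤ → ℤ[X]) :
    ∑ σ ∈ ascSet (n + 1) I, g σ = ∑ τ ∈ ascSet n I, ∑ j ∈ Finset.range (n + 1),
      (g (insertLast n j τ) + g (insertLast n j τ * signFlip 1 (n + 1))) := by
  have hlt : (1 : ℤ) < (n : ℤ) + 1 := by omega
  have hflip : ∀ σ ∈ ascSet (n + 1) I, σ * signFlip 1 (n + 1) ∈ ascSet (n + 1) I := by
    intro σ hσ
    refine mul_signFlip_mem_ascSet (by omega) (by push_cast; omega) h0 h1 (fun j hj => ?_) hσ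
    have := Finset.mem_range.mp (hI hj)
    omega
  have hlast : ∀ σ ∈ ascSet (n + 1) I, (σ * signFlip 1 (n + 1)) ((n : ℤ) + 1) = -σ (n + 1) :=
    fun σ hσ => (mul_signFlip_facts (n := n + 1) le_rfl hlt (by push_cast; omega)
      (mem_ascSet.mp hσ).1).2.2.1
  have hne : ∀ σ ∈ ascSet (n + 1) I, σ ((n : ℤ) + 1) ≠ 0 := fun σ hσ =>
    D_ne_zero (mem_ascSet.mp hσ).1 (by omega)
  have hmul : ∀ σ : Equiv.Perm ℤ,
      σ * signFlip 1 (n + 1) * signFlip 1 (n + 1) = σ := fun σ => by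
    rw [mul_assoc, signFlip_mul_self le_rfl hlt, mul_one]
  rw [← sum_sel_add_sum_sel_not _ (fun σ => 0 < σ ((n : ℤ) + 1))]
  have hneg : ∑ σ ∈ sel (ascSet (n + 1) I) (fun σ => ¬ 0 < σ ((n : ℤ) + 1)), g σ =
      ∑ σ ∈ sel (ascSet (n + 1) I) (fun σ => 0 < σ ((n : ℤ) + 1)),
        g (σ * signFlip 1 (n + 1)) := by
    refine Finset.sum_bij' (fun σ _ => σ * signFlip 1 (n + 1))
      (fun σ _ => σ * signFlip 1 (n + 1)) ?_ ?_ (fun σ _ => hmul σ) (fun σ _ => hmul σ)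
      (fun σ _ => by rw [hmul])
    · intro σ hσ
      obtain ⟨a1, a2⟩ := mem_sel.mp hσ
      have := hne σ a1
      exact mem_sel.mpr ⟨hflip σ a1, by rw [hlast σ a1]; omega⟩
    · intro σ hσ
      obtain ⟨a1, a2⟩ := mem_sel.mp hσ
      exact mem_sel.mpr ⟨hflip σ a1, by rw [hlast σ a1]; omega⟩
  rw [hneg, ← Finset.sum_add_distrib, ← Finset.sum_product']
  symm
  refine Finset.sum_bij (fun x _ => insertLast n x.2 x.1) ?_ ?_ ?_ (fun _ _ => rfl)
  · rintro ⟨τ, j⟩ hx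
    obtain ⟨hτ, hj⟩ := Finset.mem_product.mp hx
    have hj' : j ≤ n := by have := Finset.mem_range.mp hj; omega
    have hfix : τ ((n : ℤ) + 1) = n + 1 :=
      D_fix (mem_ascSet.mp hτ).1 (by rw [abs_of_pos (by omega)]; omega)
    simp only [insertLast, hj', dif_pos]
    refine mem_sel.mpr ⟨(insertCycle_mul_mem_ascSet_iff _ _ hn hI hfix).mpr hτ, ?_⟩
    rw [Equiv.Perm.mul_apply, hfix, insertCycle_self]
    omega
  · rintro ⟨τ, j⟩ hx ⟨τ', j'⟩ hx' heq
    obtain ⟨hτ, hj⟩ := Finset.mem_product.mp hx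
    obtain ⟨hτ', hj'⟩ := Finset.mem_product.mp hx'
    have k1 : j ≤ n := by have := Finset.mem_range.mp hj; omega
    have k2 : j' ≤ n := by have := Finset.mem_range.mp hj'; omega
    have hfix : ∀ τ ∈ ascSet n I, τ ((n : ℤ) + 1) = n + 1 := fun τ hτ =>
      D_fix (mem_ascSet.mp hτ).1 (by rw [abs_of_pos (by omega)]; omega)
    simp only [insertLast, k1, k2, dif_pos] at heq
    have h := congrArg (fun σ : Equiv.Perm ℤ => σ ((n : ℤ) + 1)) heq
    simp only [Equiv.Perm.mul_apply, hfix τ hτ, hfix τ' hτ', insertCycle_self] at h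
    have : j = j' := by omega
    subst this
    rw [mul_left_cancel heq]
  · intro σ hσ
    obtain ⟨a1, a2⟩ := mem_sel.mp hσ
    have hle := D_abs_le (mem_ascSet.mp a1).1 (k := (n : ℤ) + 1)
      (by rw [abs_of_pos (by omega)]; push_cast; omega)
    rw [abs_of_pos a2] at hle
    push_cast at hle
    have hj : (σ ((n : ℤ) + 1) - 1).toNat ≤ n := by omega
    have hjc : (((σ ((n : ℤ) + 1) - 1).toNat : ℕ) : ℤ) + 1 = σ ((n : ℤ) + 1) := by omega
    have hc := insertCycle_self (N := (n : ℤ) + 1)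
      (j := (((σ ((n : ℤ) + 1) - 1).toNat : ℕ) : ℤ) + 1) (by omega) (by omega)
    refine ⟨((insertCycle (n + 1) ((((σ ((n : ℤ) + 1) - 1).toNat : ℕ) : ℤ) + 1) (by omega)
      (by omega))⁻¹ * σ, (σ ((n : ℤ) + 1) - 1).toNat), ?_, ?_⟩
    · refine Finset.mem_product.mpr ⟨?_, Finset.mem_range.mpr (by dsimp only; omega)⟩
      dsimp only
      rw [← insertCycle_mul_mem_ascSet_iff (j := (((σ ((n : ℤ) + 1) - 1).toNat : ℕ) : ℤ) + 1)
        (by omega) (by omega) hn hI, mul_inv_cancel_left]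
      · exact a1
      · rw [Equiv.Perm.mul_apply, Equiv.Perm.inv_eq_iff_eq, hc, hjc]
    · simp only [insertLast, hj, dif_pos, mul_inv_cancel_left]

theorem sum_abs_D {n : ℕ} {τ : Equiv.Perm ℤ} (hτ : τ ∈ D n) (f : ℤ → ℕ) :
    ∑ i ∈ Finset.Icc (1 : ℤ) n, f |τ i| = ∑ v ∈ Finset.Icc (1 : ℤ) n, f v := by
  have hmaps : Set.MapsTo (fun i => |τ i|) (Finset.Icc (1 : ℤ) n : Set ℤ)
      (Finset.Icc (1 : ℤ) n : Set ℤ) := by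
    intro i hi
    simp only [Finset.coe_Icc, Set.mem_Icc] at hi ⊢
    have h1 := D_abs_le hτ (k := i) (by rw [abs_of_pos (by omega)]; omega)
    have h2 := abs_pos.mpr (D_ne_zero hτ (k := i) (by omega))
    omega
  have hinj : Set.InjOn (fun i => |τ i|) (Finset.Icc (1 : ℤ) n : Set ℤ) := by
    intro i hi k hk h
    simp only [Finset.coe_Icc, Set.mem_Icc] at hi hk
    exact D_inj hτ (by omega) (by omega) h
  exact Finset.sum_nbij (fun i => |τ i|) hmaps hinj
    (Finset.surjOn_of_injOn_of_card_le _ hmaps hinj le_rfl) fun _ _ => rfl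

/-- The set of absolute values of the entries in even positions. -/
noncomputable def evenVals (n : ℕ) (τ : ℤ → ℤ) : Finset ℤ :=
  ((Finset.Icc (1 : ℤ) n).filter fun i => Even i).image fun i => |τ i|

theorem abs_mem_evenVals {n : ℕ} {τ : Equiv.Perm ℤ} (hτ : τ ∈ D n) {i : ℤ} (h1 : 1 ≤ i)
    (h2 : i ≤ n) : |τ i| ∈ evenVals n τ ↔ Even i := by
  simp only [evenVals, Finset.mem_image, Finset.mem_filter, Finset.mem_Icc]
  constructor
  · rintro ⟨k, ⟨h3, h4⟩, h5⟩
    rwa [← D_inj hτ (by omega) (by omega) h5]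
  · exact fun h => ⟨i, ⟨⟨h1, h2⟩, h⟩, rfl⟩

/-- The number of values `v ≥ j` in positions whose parity differs from that of `n + 1`, where `V`
is the set of values in even positions. -/
noncomputable def numOpp (n : ℕ) (V : Finset ℤ) (j : ℕ) : ℕ :=
  ∑ v ∈ Finset.Icc (1 : ℤ) n, if (Even n ↔ v ∈ V) ∧ (j : ℤ) ≤ v then 1 else 0

theorem sum_opp_parity (n : ℕ) :
    ∑ i ∈ Finset.Icc (1 : ℤ) n, (if Odd ((n : ℤ) + 1 - i) then 1 else 0) = (n + 1) / 2 := by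
  induction n with
  | zero => simp
  | succ n ih =>
    rw [Icc_succ, Finset.sum_insert (succ_notMem_Icc n), if_pos (by push_cast; simp)]
    have : ∀ i ∈ Finset.Icc (1 : ℤ) n,
        (if Odd (((n + 1 : ℕ) : ℤ) + 1 - i) then 1 else 0) +
        (if Odd ((n : ℤ) + 1 - i) then 1 else 0) = 1 := by
      intro i _
      push_cast
      simp only [Int.odd_iff]
      split_ifs <;> omega
    have h := Finset.sum_congr rfl this
    rw [Finset.sum_add_distrib, ih] at h
    simp only [Finset.sum_const, Int.card_Icc, smul_eq_mul, mul_one] at h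
    omega

theorem insertLast_apply {n j : ℕ} (hj : j ≤ n) (τ : Equiv.Perm ℤ) (i : ℤ) :
    insertLast n j τ i = insertCycle (n + 1) (j + 1) (by omega) (by omega) (τ i) := by
  simp only [insertLast, hj, dif_pos]
  rfl

theorem insertLast_facts {n j : ℕ} (hn : 2 ≤ n) (hj : j ≤ n) {τ : Equiv.Perm ℤ} (hτ : τ ∈ D n) :
    insertLast n j τ ∈ D (n + 1) ∧ insertLast n j τ ((n : ℤ) + 1) = j + 1 ∧
    (∀ i : ℤ, 1 ≤ i → i ≤ n → |insertLast n j τ i| =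
      if (j : ℤ) + 1 ≤ |τ i| then |τ i| + 1 else |τ i|) ∧
    ∀ i : ℤ, 1 ≤ i → |(insertLast n j τ * signFlip 1 (n + 1)) i| = |insertLast n j τ i| := by
  have hlt : (1 : ℤ) < (n : ℤ) + 1 := by omega
  have hfix : τ ((n : ℤ) + 1) = n + 1 := D_fix hτ (by rw [abs_of_pos (by omega)]; omega)
  have hσ : insertLast n j τ ∈ D (n + 1) := by
    simp only [insertLast, hj, dif_pos]
    exact (insertCycle_mul_mem_D_iff _ _ hfix).mpr hτ
  obtain ⟨-, e1, e2, -, e3⟩ := mul_signFlip_facts (n := n + 1) le_rfl hlt (by push_cast; omega) hσ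
  refine ⟨hσ, ?_, fun i h1 h2 => ?_, fun t ht => ?_⟩
  · rw [insertLast_apply hj, hfix, insertCycle_self]
  · rw [insertLast_apply hj, abs_insertCycle]
    have := D_abs_le hτ (k := i) (by rw [abs_of_pos (by omega)]; omega)
    omega
  · by_cases h1 : t = 1
    · rw [h1, e1, abs_neg]
    · by_cases h2 : t = n + 1
      · rw [h2, e2, abs_neg]
      · have : |t| = t := abs_of_pos (by omega)
        rw [e3 t (by omega) (by omega)]

/-- A last entry j+1 adds 1 for each larger absolute value. A last entry -(j+1) adds 1 for each
larger and 2 for each smaller one, which is 2 minus the former contribution position by position.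
Both change the length by n - j modulo 2. -/
theorem wt_insertLast {n j : ℕ} (hn : 2 ≤ n) (hj : j ≤ n) {τ : Equiv.Perm ℤ} (hτ : τ ∈ D n) :
    wt (n + 1) (insertLast n j τ) =
      wt n τ * ((-1) ^ (n + j) * Polynomial.X ^ numOpp n (evenVals n τ) (j + 1)) ∧
    wt (n + 1) ↑(insertLast n j τ * signFlip 1 (n + 1)) =
      wt n τ * ((-1) ^ (n + j) *
        Polynomial.X ^ (2 * ((n + 1) / 2) - numOpp n (evenVals n τ) (j + 1))) := by
  have hlt : (1 : ℤ) < (n : ℤ) + 1 := by omega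
  have hj1 : (1 : ℤ) ≤ (j : ℤ) + 1 := by omega
  have hjN : (j : ℤ) + 1 ≤ (n : ℤ) + 1 := by omega
  obtain ⟨hσ, hσN, habs', habs⟩ := insertLast_facts hn hj hτ
  have hσi := insertLast_apply hj τ
  obtain ⟨-, e1, e2, -, e3⟩ := mul_signFlip_facts (n := n + 1) le_rfl hlt (by push_cast; omega) hσ
  have hle : ∀ i : ℤ, 1 ≤ i → i ≤ n → |τ i| < (n : ℤ) + 1 := fun i h1 h2 => by
    have := D_abs_le hτ (k := i) (by rw [abs_of_pos (by omega)]; omega)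
    omega
  have hin : ∀ i k : ℤ, 1 ≤ i → i < k → k ≤ n →
      pairInv (insertLast n j τ i) (insertLast n j τ k) = pairInv (τ i) (τ k) := by
    intro i k h1 h2 h3
    rw [hσi, hσi]
    unfold pairInv
    simp only [← insertCycle_neg,
      insertCycle_lt_iff hj1 hjN (hle k (by omega) h3) (hle i h1 (by omega)),
      insertCycle_lt_iff hj1 hjN (hle k (by omega) h3)
        (show |-τ i| < _ by rw [abs_neg]; exact hle i h1 (by omega))]
  have hin' : ∀ i k : ℤ, 1 ≤ i → i < k → k ≤ n →
      pairInv ((insertLast n j τ * signFlip 1 (n + 1)) i)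
        ((insertLast n j τ * signFlip 1 (n + 1)) k) = pairInv (τ i) (τ k) := by
    intro i k h1 h2 h3
    have : |k| = k := abs_of_pos (by omega)
    rw [pairInv_congr_left (habs i h1), e3 k (by omega) (by omega), hin i k h1 h2 h3]
  have hlast : ∀ i ∈ Finset.Icc (1 : ℤ) n,
      pairInv (insertLast n j τ i) (insertLast n j τ (n + 1)) =
        if (j : ℤ) + 1 ≤ |τ i| then 1 else 0 := by
    intro i hi
    rw [Finset.mem_Icc] at hi
    have h := habs' i hi.1 hi.2
    have hj' : |(j : ℤ) + 1| = j + 1 := abs_of_pos (by omega)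
    rw [hσN]
    split_ifs at h ⊢
    · rw [pairInv_of_abs_gt (by omega)]
    · rw [pairInv_of_abs_lt (by omega), if_neg (by omega)]
  have hlast' : ∀ i ∈ Finset.Icc (1 : ℤ) n,
      pairInv ((insertLast n j τ * signFlip 1 (n + 1)) i)
        ((insertLast n j τ * signFlip 1 (n + 1)) (n + 1)) +
        (if (j : ℤ) + 1 ≤ |τ i| then 1 else 0) = 2 := by
    intro i hi
    rw [Finset.mem_Icc] at hi
    have h := habs' i hi.1 hi.2
    have hj' : |-((j : ℤ) + 1)| = j + 1 := by rw [abs_neg, abs_of_pos (by omega)]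
    rw [pairInv_congr_left (habs i hi.1), e2, hσN]
    split_ifs at h ⊢
    · rw [pairInv_of_abs_gt (by omega)]
    · rw [pairInv_of_abs_lt (by omega), if_pos (by omega)]
  have hcount : ∑ i ∈ Finset.Icc (1 : ℤ) n, (if (j : ℤ) + 1 ≤ |τ i| then 1 else 0) = n - j := by
    rw [sum_abs_D hτ (fun v => if (j : ℤ) + 1 ≤ v then 1 else 0), ← Finset.card_filter]
    have : (Finset.Icc (1 : ℤ) n).filter (fun v => (j : ℤ) + 1 ≤ v) =
        Finset.Icc ((j : ℤ) + 1) n := by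
      ext v
      simp only [Finset.mem_filter, Finset.mem_Icc]
      omega
    rw [this, Int.card_Icc]
    omega
  have hcount2 : ∑ i ∈ Finset.Icc (1 : ℤ) n, (if Odd ((n : ℤ) + 1 - i) then
      (if (j : ℤ) + 1 ≤ |τ i| then 1 else 0) else 0) = numOpp n (evenVals n τ) (j + 1) := by
    unfold numOpp
    rw [← sum_abs_D hτ (fun v =>
      if (Even n ↔ v ∈ evenVals n τ) ∧ ((j + 1 : ℕ) : ℤ) ≤ v then 1 else 0)]
    refine Finset.sum_congr rfl fun i hi => ?_
    rw [Finset.mem_Icc] at hi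
    simp only [abs_mem_evenVals hτ hi.1 hi.2, ← ite_and]
    push_cast
    have : Odd ((n : ℤ) + 1 - i) ↔ (Even n ↔ Even i) := by
      rw [Int.odd_iff, Nat.even_iff, Int.even_iff]
      omega
    simp only [this]
  have L1 : len (n + 1) (insertLast n j τ) = len n τ + (n - j) := by
    unfold len
    rw [pairSum_succ, pairSum_congr hin, Finset.sum_congr rfl hlast, hcount]
  have L2 : len (n + 1) ↑(insertLast n j τ * signFlip 1 (n + 1)) + (n - j) = len n τ + 2 * n := by
    unfold len
    have := Finset.sum_congr rfl hlast'
    rw [Finset.sum_add_distrib, hcount] at this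
    rw [pairSum_succ, pairSum_congr hin', add_assoc, this]
    simp [mul_comm]
  have O1 : oddLen (n + 1) (insertLast n j τ) =
      oddLen n τ + numOpp n (evenVals n τ) (j + 1) := by
    unfold oddLen
    rw [pairSum_succ, ← hcount2]
    congr 1
    · exact pairSum_congr fun i k h1 h2 h3 => by rw [hin i k h1 h2 h3]
    · exact Finset.sum_congr rfl fun i hi => by rw [hlast i hi]
  have O2 : oddLen (n + 1) ↑(insertLast n j τ * signFlip 1 (n + 1)) +
      numOpp n (evenVals n τ) (j + 1) = oddLen n τ + 2 * ((n + 1) / 2) := by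
    unfold oddLen
    rw [pairSum_succ, ← hcount2, add_assoc, ← Finset.sum_add_distrib, ← sum_opp_parity n,
      Finset.mul_sum]
    congr 1
    · exact pairSum_congr fun i k h1 h2 h3 => by rw [hin' i k h1 h2 h3]
    · refine Finset.sum_congr rfl fun i hi => ?_
      have := hlast' i hi
      split_ifs at this ⊢ <;> omega
  have hle2 : numOpp n (evenVals n τ) (j + 1) ≤ 2 * ((n + 1) / 2) := by
    rw [← hcount2, ← sum_opp_parity n, Finset.mul_sum]
    refine Finset.sum_le_sum fun i _ => ?_
    split_ifs <;> omega
  have hs : (-1 : ℤ[X]) ^ (n - j) = (-1) ^ (n + j) := by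
    rw [show n + j = n - j + 2 * j by omega, pow_add, pow_mul, neg_one_sq, one_pow, mul_one]
  constructor
  · rw [wt, wt, L1, O1, pow_add, pow_add, hs]
    ring
  · have : (-1 : ℤ[X]) ^ len (n + 1) ↑(insertLast n j τ * signFlip 1 (n + 1)) =
        (-1) ^ len n τ * (-1) ^ (n - j) := by
      rw [show len (n + 1) ↑(insertLast n j τ * signFlip 1 (n + 1)) = len n τ + (n - j) + 2 * j by
        omega, pow_add, pow_mul, neg_one_sq, one_pow, mul_one, pow_add]
    rw [wt, wt, this, hs, show oddLen (n + 1) ↑(insertLast n j τ * signFlip 1 (n + 1)) =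
      oddLen n τ + (2 * ((n + 1) / 2) - numOpp n (evenVals n τ) (j + 1)) by omega, pow_add]
    ring

/-- The contribution of an inserted last entry `±(j + 1)`, where `V` is the set of values in even
positions. -/
noncomputable def lastFactor (n : ℕ) (V : Finset ℤ) (j : ℕ) : ℤ[X] :=
  (-1) ^ (n + j) * (Polynomial.X ^ numOpp n V (j + 1) +
    Polynomial.X ^ (2 * ((n + 1) / 2) - numOpp n V (j + 1)))

/-- The factor φ makes it possible to insert two entries in succession: the contribution of the
second depends on the even values left by the first, but not on the sign of the first. -/
theorem sum_wt_succ {n : ℕ} (hn : 2 ≤ n) {I : Finset ℕ} (hI : I ⊆ Finset.range n)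
    (h0 : 0 ∈ I) (h1 : 1 ∈ I) (φ : Equiv.Perm ℤ → ℤ[X]) (ψ : ℕ → Equiv.Perm ℤ → ℤ[X])
    (hφ : ∀ τ ∈ ascSet n I, ∀ j ≤ n, φ (insertLast n j τ) = ψ j τ ∧
      φ (insertLast n j τ * signFlip 1 (n + 1)) = ψ j τ) :
    ∑ σ ∈ ascSet (n + 1) I, wt (n + 1) σ * φ σ = ∑ τ ∈ ascSet n I, wt n τ *
      ∑ j ∈ Finset.range (n + 1), lastFactor n (evenVals n τ) j * ψ j τ := by
  rw [sum_ascSet_succ hn hI h0 h1]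
  refine Finset.sum_congr rfl fun τ hτ => ?_
  rw [Finset.mul_sum]
  refine Finset.sum_congr rfl fun j hj => ?_
  have hj' : j ≤ n := by have := Finset.mem_range.mp hj; omega
  obtain ⟨w1, w2⟩ := wt_insertLast hn hj' (mem_ascSet.mp hτ).1
  obtain ⟨p1, p2⟩ := hφ τ hτ j hj'
  rw [w1, w2, p1, p2, lastFactor]
  ring

theorem F_succ {n : ℕ} (hn : 2 ≤ n) {I : Finset ℕ} (hI : I ⊆ Finset.range n)
    (h0 : 0 ∈ I) (h1 : 1 ∈ I) :
    F (n + 1) I = ∑ τ ∈ ascSet n I, wt n τ *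
      ∑ j ∈ Finset.range (n + 1), lastFactor n (evenVals n τ) j := by
  have := sum_wt_succ hn hI h0 h1 (fun _ => 1) (fun _ _ => 1) fun _ _ _ _ => ⟨rfl, rfl⟩
  simp only [mul_one] at this
  exact this

/-! ### Cancellation by exchanging adjacent values. -/

theorem signedSwap_lt_iff {v u w : ℤ} (hv : 1 ≤ v)
    (h1 : ¬ (|u| = v ∧ |w| = v + 1)) (h2 : ¬ (|u| = v + 1 ∧ |w| = v)) (h3 : u = w ∨ |u| ≠ |w|) :
    signedSwap v (v + 1) u < signedSwap v (v + 1) w ↔ u < w := by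
  obtain ⟨a, b, c⟩ := signedSwap_facts hv (lt_add_one v)
  rw [signedSwap_apply a b c, signedSwap_apply a b c]
  rcases abs_cases u with h | h <;> rcases abs_cases w with h' | h' <;>
    split_ifs <;> omega

theorem abs_signedSwap {v : ℤ} (hv : 1 ≤ v) (u : ℤ) :
    |signedSwap v (v + 1) u| = signedSwap v (v + 1) |u| := by
  obtain ⟨a, b, c⟩ := signedSwap_facts hv (lt_add_one v)
  rcases abs_cases u with h | h
  · rw [h.1, abs_of_nonneg]
    rw [signedSwap_apply a b c]
    split_ifs <;> omega
  · rw [h.1, signedSwap_neg a b c, abs_of_neg]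
    rw [signedSwap_apply a b c]
    split_ifs <;> omega

theorem sg_signedSwap {v : ℤ} (hv : 1 ≤ v) (u : ℤ) : sg (signedSwap v (v + 1) u) = sg u := by
  obtain ⟨a, b, c⟩ := signedSwap_facts hv (lt_add_one v)
  rw [signedSwap_apply a b c]
  unfold sg
  split_ifs <;> omega

/-- Exchanging the values `v` and `v + 1` when they are in positions of the same parity. -/
theorem signedSwap_mul_facts {n : ℕ} {I : Finset ℕ} (hI : I ⊆ Finset.range n) (hn : 2 ≤ n) {v : ℤ}
    (hv : 1 ≤ v) (hv' : v < n)
    {τ : Equiv.Perm ℤ} (hτ : τ ∈ ascSet n I)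
    (hV : v ∈ evenVals n τ ↔ v + 1 ∈ evenVals n τ) :
    signedSwap v (v + 1) * τ ∈ ascSet n I ∧
    evenVals n ↑(signedSwap v (v + 1) * τ) = evenVals n τ ∧
    wt n ↑(signedSwap v (v + 1) * τ) = -wt n τ := by
  obtain ⟨a, b, c⟩ := signedSwap_facts hv (lt_add_one v)
  obtain ⟨hD, hA⟩ := mem_ascSet.mp hτ
  have hD' : signedSwap v (v + 1) * τ ∈ D n := by
    obtain ⟨h1, h2, h3⟩ := mem_D.mp hD
    refine mem_D.mpr ⟨fun k hk => ?_, fun k => ?_, ?_⟩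
    · rw [Equiv.Perm.mul_apply, h1 k hk, signedSwap_of_ne a b c]
      · rw [abs_of_pos (a := v) (by omega)]; omega
      · rw [abs_of_pos (a := v + 1) (by omega)]; omega
    · rw [Equiv.Perm.mul_apply, h2, signedSwap_neg a b c, Equiv.Perm.mul_apply]
    · simpa only [Equiv.Perm.mul_apply, sg_signedSwap hv] using h3
  -- Ascents and odd length only compare positions of opposite parity. Exchanging adjacent values
  -- changes no comparison except the one between their own positions, which have the same parity.
  have hsep : ∀ i k : ℤ, 1 ≤ i → i ≤ n → 1 ≤ k → k ≤ n → Odd (k - i) →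
      ¬ (|τ i| = v ∧ |τ k| = v + 1) := by
    rintro i k h1 h2 h3 h4 h5 ⟨h6, h7⟩
    rw [← h7, ← h6, abs_mem_evenVals hD h1 h2, abs_mem_evenVals hD h3 h4] at hV
    rw [Int.odd_sub] at h5
    simp only [← Int.not_even_iff_odd] at h5
    tauto
  have hord : ∀ i k : ℤ, 1 ≤ |i| → |i| ≤ n → 1 ≤ |k| → |k| ≤ n → Odd (|k| - |i|) →
      ((signedSwap v (v + 1) * τ) i < (signedSwap v (v + 1) * τ) k ↔ τ i < τ k) := by
    intro i k h1 h2 h3 h4 h5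
    have habs : ∀ i : ℤ, |τ (|i|)| = |τ i| := by
      intro i
      rcases abs_cases i with h | h
      · rw [h.1]
      · rw [h.1, D_odd hD, abs_neg]
    have k1 := hsep |i| |k| h1 h2 h3 h4 h5
    have k2 := hsep |k| |i| h3 h4 h1 h2 (by rw [Int.odd_iff] at *; omega)
    rw [habs, habs] at k1 k2
    rw [Equiv.Perm.mul_apply, Equiv.Perm.mul_apply]
    refine signedSwap_lt_iff hv k1 (fun h => k2 ⟨h.2, h.1⟩) (Or.inr fun h => ?_)
    rw [D_abs_inj hD h] at h5
    simp at h5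
  refine ⟨mem_ascSet.mpr ⟨hD', fun j hj => ?_⟩, ?_, wt_eq_neg ?_ ?_⟩
  · have hAj := hA j hj
    have hjn := Finset.mem_range.mp (hI hj)
    rcases Nat.eq_zero_or_pos j with rfl | h0
    · rw [asc_zero_iff] at hAj ⊢
      refine (hord _ _ ?_ ?_ ?_ ?_ ?_).mpr hAj
      all_goals norm_num
      all_goals omega
    · rw [asc_iff (by omega)] at hAj ⊢
      have a1 : |(j : ℤ)| = j := abs_of_pos (by omega)
      have a2 : |(j : ℤ) + 1| = j + 1 := abs_of_pos (by omega)
      refine (hord _ _ ?_ ?_ ?_ ?_ ?_).mpr hAj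
      all_goals first | omega | (rw [a1, a2]; simp)
  · have himg : evenVals n ↑(signedSwap v (v + 1) * τ) =
        (evenVals n τ).image (signedSwap v (v + 1)) := by
      unfold evenVals
      rw [Finset.image_image]
      refine Finset.image_congr fun i _ => ?_
      simp only [Equiv.Perm.mul_apply, Function.comp_apply, abs_signedSwap hv]
    have hpos : ∀ u ∈ evenVals n τ, 0 ≤ u := by
      intro u hu
      obtain ⟨i, -, rfl⟩ := Finset.mem_image.mp hu
      exact abs_nonneg _
    have hs : ∀ u, 0 ≤ u → (u ∈ evenVals n τ ↔ signedSwap v (v + 1) u ∈ evenVals n τ) := by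
      intro u hu
      rw [signedSwap_apply a b c]
      split_ifs with h1 h2 h3 h4
      · rw [h1, hV]
      · rw [h2, hV]
      · omega
      · omega
      · rfl
    rw [himg]
    ext u
    rw [Finset.mem_image]
    have hss : ∀ u, signedSwap v (v + 1) (signedSwap v (v + 1) u) = u := fun u => by
      rw [← Equiv.Perm.mul_apply, signedSwap_mul_self a b c, Equiv.Perm.one_apply]
    constructor
    · rintro ⟨w, hw, rfl⟩
      exact (hs w (hpos w hw)).mp hw
    · intro hu
      exact ⟨_, (hs u (hpos u hu)).mp hu, hss u⟩
  · have hmem : ∀ v : ℤ, 1 ≤ v → v ≤ n → ∃ q : ℤ, 1 ≤ q ∧ q ≤ n ∧ |τ q| = v := by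
      intro v h1 h2
      have hne : τ.symm v ≠ 0 := fun h => by
        have := τ.apply_symm_apply v
        rw [h, D_zero hD] at this
        omega
      refine ⟨|τ.symm v|, abs_pos.mpr hne, ?_, ?_⟩
      · by_contra h
        have := (mem_D.mp hD).1 _ h
        rw [τ.apply_symm_apply] at this
        rw [← this, abs_of_pos (by omega)] at h
        exact h h2
      · rcases abs_cases (τ.symm v) with h | h
        · rw [h.1, τ.apply_symm_apply, abs_of_pos (by omega)]
        · rw [h.1, D_odd hD, abs_neg, τ.apply_symm_apply, abs_of_pos (by omega)]
    obtain ⟨q, hq1, hq2, hq3⟩ := hmem v hv (by omega)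
    obtain ⟨l, hl1, hl2, hl3⟩ := hmem (v + 1) (by omega) (by omega)
    have hql : q ≠ l := fun h => by rw [h] at hq3; omega
    have hgq : |(signedSwap v (v + 1) * τ) q| = v + 1 := by
      rw [Equiv.Perm.mul_apply, abs_signedSwap hv, hq3, signedSwap_apply a b c, if_pos rfl]
    have hgl : |(signedSwap v (v + 1) * τ) l| = v := by
      rw [Equiv.Perm.mul_apply, abs_signedSwap hv, hl3, signedSwap_apply a b c, if_neg (by omega),
        if_pos rfl]
    have hoff : ∀ t : ℤ, 1 ≤ t → t ≠ q → t ≠ l → τ t = (signedSwap v (v + 1) * τ) t := by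
      intro t h1 h2 h3
      rw [Equiv.Perm.mul_apply, signedSwap_of_ne a b c]
      · rw [abs_of_pos (a := v) (by omega), ← hq3]
        exact fun h => h2 (D_inj hD (by omega) (by omega) h)
      · rw [abs_of_pos (a := v + 1) (by omega), ← hl3]
        exact fun h => h3 (D_inj hD (by omega) (by omega) h)
    have hinj : ∀ i ∈ Finset.Icc (1 : ℤ) n, ∀ j ∈ Finset.Icc (1 : ℤ) n,
        |τ i| = |τ j| → i = j := by
      intro x hx y hy
      rw [Finset.mem_Icc] at hx hy
      exact D_inj hD (by omega) (by omega)
    rw [add_comm]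
    rcases lt_or_gt_of_ne hql with h | h
    · refine len_add_odd hq1 h hl2 (fun t ht => ?_) hinj (by omega) (by omega)
      rw [mem_others] at ht
      exact hoff t ht.1.1 ht.2.1 ht.2.2
    · refine len_add_odd hl1 h hq2 (fun t ht => ?_) hinj (by omega) (by omega)
      rw [mem_others] at ht
      exact hoff t ht.1.1 ht.2.2 ht.2.1
  · refine pairSum_congr fun i k h1 h2 h3 => ?_
    split_ifs with ho
    · have a1 : |i| = i := abs_of_pos (by omega)
      have a2 : |k| = k := abs_of_pos (by omega)
      have a3 : |-i| = i := by rw [abs_neg, a1]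
      have o1 : Odd (i - k) := by rw [Int.odd_iff] at *; omega
      have k1 := hord k i (by omega) (by omega) (by omega) (by omega) (by rwa [a1, a2])
      have k2 := hord k (-i) (by omega) (by omega) (by omega) (by omega) (by rwa [a3, a2])
      rw [D_odd hD, D_odd hD'] at k2
      unfold pairInv
      simp only [k1, k2]
    · rfl

/-- The even numbers in `[1, n]`. -/
noncomputable def evens (n : ℕ) : Finset ℤ := (Finset.Icc (1 : ℤ) n).filter fun i => Even i

theorem card_odds (M : ℕ) :
    ((Finset.Icc (1 : ℤ) ((2 * M + 1 : ℕ) : ℤ)).filter fun i => Odd i).card =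
      (evens (2 * M + 1)).card + 1 := by
  have : (Finset.Icc (1 : ℤ) ((2 * M + 1 : ℕ) : ℤ)).filter (fun i => Odd i) =
      insert 1 ((evens (2 * M + 1)).map (addRightEmbedding 1)) := by
    ext i
    simp only [Finset.mem_filter, Finset.mem_Icc, Finset.mem_insert, Finset.mem_map, evens,
      addRightEmbedding_apply, Int.odd_iff, Int.even_iff]
    constructor
    · rintro ⟨h1, h2⟩
      by_cases hi : i = 1
      · exact Or.inl hi
      · exact Or.inr ⟨i - 1, by omega, by omega⟩
    · rintro (rfl | ⟨k, h1, rfl⟩)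
      · omega
      · push_cast at *
        omega
  rw [this, Finset.card_insert_of_notMem, Finset.card_map]
  simp [evens]

/-- If the parity of positions alternates along the values of a permutation of odd degree, then
the even values are in the even positions. -/
theorem evenVals_eq_evens {M : ℕ} {τ : Equiv.Perm ℤ} (hτ : τ ∈ D (2 * M + 1))
    (halt : ∀ v : ℤ, 1 ≤ v → v < (2 * M + 1 : ℕ) →
      ¬ (v ∈ evenVals (2 * M + 1) τ ↔ v + 1 ∈ evenVals (2 * M + 1) τ)) :
    evenVals (2 * M + 1) τ = evens (2 * M + 1) := by
  have hsub : evenVals (2 * M + 1) τ ⊆ Finset.Icc (1 : ℤ) ((2 * M + 1 : ℕ) : ℤ) := by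
    intro u hu
    obtain ⟨i, hi, rfl⟩ := Finset.mem_image.mp hu
    rw [Finset.mem_filter, Finset.mem_Icc] at hi
    rw [Finset.mem_Icc]
    exact ⟨abs_pos.mpr (D_ne_zero hτ (by omega)),
      D_abs_le hτ (by rw [abs_of_pos (by omega)]; omega)⟩
  have hcard : (evenVals (2 * M + 1) τ).card = (evens (2 * M + 1)).card := by
    refine Finset.card_image_of_injOn fun i hi k hk h => ?_
    simp only [Finset.coe_filter, Finset.mem_Icc, Set.mem_ofPred_eq] at hi hk
    exact D_inj hτ (by omega) (by omega) h
  have hind : ∀ u : ℕ, 1 ≤ u → u ≤ 2 * M + 1 → ((u : ℤ) ∈ evenVals (2 * M + 1) τ ↔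
      (Odd u ↔ (1 : ℤ) ∈ evenVals (2 * M + 1) τ)) := by
    intro u h1
    induction u, h1 using Nat.le_induction with
    | base => simp
    | succ u h1 ih =>
      intro h2
      have h3 := halt u (by omega) (by omega)
      have h4 := ih (by omega)
      push_cast
      rw [Nat.odd_add_one]
      tauto
  -- Alternation leaves only the even or the odd values. The interval [1, 2M+1] has one more odd
  -- number than even positions, which excludes the odd values.
  by_cases h1 : (1 : ℤ) ∈ evenVals (2 * M + 1) τ
  · exfalso
    have : evenVals (2 * M + 1) τ =
        (Finset.Icc (1 : ℤ) ((2 * M + 1 : ℕ) : ℤ)).filter fun i => Odd i := by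
      ext u
      rw [Finset.mem_filter]
      constructor
      · intro hu
        have hu' := Finset.mem_Icc.mp (hsub hu)
        have h := hind u.toNat (by omega) (by omega)
        rw [show ((u.toNat : ℕ) : ℤ) = u by omega] at h
        refine ⟨hsub hu, ?_⟩
        have := (h.mp hu).mpr h1
        rw [Nat.odd_iff] at this
        rw [Int.odd_iff]
        omega
      · rintro ⟨hu', ho⟩
        rw [Finset.mem_Icc] at hu'
        have h := hind u.toNat (by omega) (by omega)
        rw [show ((u.toNat : ℕ) : ℤ) = u by omega] at h
        refine h.mpr (iff_of_true ?_ h1)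
        rw [Int.odd_iff] at ho
        rw [Nat.odd_iff]
        omega
    rw [this, card_odds] at hcard
    omega
  · ext u
    rw [evens, Finset.mem_filter]
    constructor
    · intro hu
      have hu' := Finset.mem_Icc.mp (hsub hu)
      have h := hind u.toNat (by omega) (by omega)
      rw [show ((u.toNat : ℕ) : ℤ) = u by omega] at h
      refine ⟨hsub hu, ?_⟩
      have := mt (h.mp hu).mp
      have h' := this h1
      rw [Nat.odd_iff] at h'
      rw [Int.even_iff]
      omega
    · rintro ⟨hu', ho⟩
      rw [Finset.mem_Icc] at hu'
      have h := hind u.toNat (by omega) (by omega)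
      rw [show ((u.toNat : ℕ) : ℤ) = u by omega] at h
      refine h.mpr (iff_of_false ?_ h1)
      rw [Int.even_iff] at ho
      rw [Nat.odd_iff]
      omega

/-- In odd degree, only the permutations with the even values in the even positions contribute to
a signed sum that is weighted by a function of the values in even positions. -/
theorem sum_wt_evenVals {M : ℕ} (hM : 1 ≤ M) {I : Finset ℕ} (hI : I ⊆ Finset.range (2 * M + 1))
    (G : Finset ℤ → ℤ[X]) :
    ∑ τ ∈ ascSet (2 * M + 1) I, wt (2 * M + 1) τ * G (evenVals (2 * M + 1) τ) =
      F (2 * M + 1) I * G (evens (2 * M + 1)) := by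
  -- Grouped by the set of even values, every fibre except the one of `evens` has some v and v+1
  -- both inside or both outside that set, and cancels under their exchange. On the remaining fibre
  -- the second factor is zero.
  have key : ∑ τ ∈ ascSet (2 * M + 1) I, wt (2 * M + 1) τ *
      (G (evenVals (2 * M + 1) τ) - G (evens (2 * M + 1))) = 0 := by
    classical
    rw [← Finset.sum_fiberwise_of_maps_to (g := fun τ : Equiv.Perm ℤ => evenVals (2 * M + 1) τ)
      (t := (ascSet (2 * M + 1) I).image fun τ : Equiv.Perm ℤ => evenVals (2 * M + 1) τ)
      (fun τ hτ => Finset.mem_image_of_mem _ hτ)]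
    refine Finset.sum_eq_zero fun S hS => ?_
    obtain ⟨τ₀, hτ₀, rfl⟩ := Finset.mem_image.mp hS
    by_cases hev : evenVals (2 * M + 1) τ₀ = evens (2 * M + 1)
    · refine Finset.sum_eq_zero fun τ hτ => ?_
      rw [(Finset.mem_filter.mp hτ).2, hev, sub_self, mul_zero]
    · have : ∃ v : ℤ, 1 ≤ v ∧ v < (2 * M + 1 : ℕ) ∧
          (v ∈ evenVals (2 * M + 1) τ₀ ↔ v + 1 ∈ evenVals (2 * M + 1) τ₀) := by
        by_contra h
        push Not at h
        exact hev (evenVals_eq_evens (mem_ascSet.mp hτ₀).1 fun v h1 h2 h3 => by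
          rcases h v h1 h2 with h | h <;> tauto)
      obtain ⟨v, h1, h2, h3⟩ := this
      obtain ⟨a, b, c⟩ := signedSwap_facts h1 (lt_add_one v)
      refine sum_eq_zero_of_involution (fun τ => signedSwap v (v + 1) * τ) (fun τ hτ => ?_)
        (fun τ _ => ?_) (fun τ hτ => ?_)
      · obtain ⟨k1, k2⟩ := Finset.mem_filter.mp hτ
        obtain ⟨f1, f2, f3⟩ := signedSwap_mul_facts hI (by omega) h1 h2 k1 (by rwa [k2])
        exact Finset.mem_filter.mpr ⟨f1, f2.trans k2⟩
      · rw [← mul_assoc, signedSwap_mul_self a b c, one_mul]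
      · obtain ⟨k1, k2⟩ := Finset.mem_filter.mp hτ
        obtain ⟨f1, f2, f3⟩ := signedSwap_mul_facts hI (by omega) h1 h2 k1 (by rwa [k2])
        rw [f2, f3, neg_mul]
  simp only [mul_sub, Finset.sum_sub_distrib] at key
  rw [sub_eq_zero] at key
  rw [key, F, Finset.sum_mul]

/-! ### Telescoping sums and the product for free positions at the end. -/

theorem alternating_sum_succ_div_two (h : ℕ → ℤ[X]) (M : ℕ) :
    ∑ i ∈ Finset.range (2 * M + 2), (-1) ^ (2 * M + 1 + i) * h ((i + 1) / 2) =
      h (M + 1) - h 0 := by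
  have key : ∀ M : ℕ, ∑ i ∈ Finset.range (2 * M + 2), (-1) ^ (i + 1) * h ((i + 1) / 2) =
      h (M + 1) - h 0 := by
    intro M
    induction M with
    | zero => simp [Finset.sum_range_succ]; ring
    | succ M ih =>
      rw [show 2 * (M + 1) + 2 = 2 * M + 2 + 1 + 1 by ring, Finset.sum_range_succ,
        Finset.sum_range_succ, ih, show (2 * M + 2 + 1) / 2 = M + 1 by omega,
        show (2 * M + 2 + 1 + 1) / 2 = M + 1 + 1 by omega,
        Odd.neg_one_pow ⟨M + 1, by ring⟩, Even.neg_one_pow ⟨M + 2, by ring⟩]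
      ring
  rw [← key]
  refine Finset.sum_congr rfl fun i _ => ?_
  rw [show 2 * M + 1 + i = 2 * M + (i + 1) by ring, pow_add, pow_mul, neg_one_sq, one_pow, one_mul]

/-- As in `alternating_sum_succ_div_two`, equal neighbouring values of the quotient by 2 carry
opposite signs, so only unpaired end terms survive. -/
theorem alternating_sum_div_two (h : ℕ → ℤ[X]) (M : ℕ) :
    ∑ i ∈ Finset.range (2 * M + 3), (-1) ^ (2 * M + 2 + i) * h (i / 2) = h (M + 1) := by
  rw [Finset.sum_range_succ']
  have := alternating_sum_succ_div_two h M
  have e : ∀ i ∈ Finset.range (2 * M + 2), (-1 : ℤ[X]) ^ (2 * M + 2 + (i + 1)) * h ((i + 1) / 2) =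
      (-1) ^ (2 * M + 1 + i) * h ((i + 1) / 2) := by
    intro i _
    rw [show 2 * M + 2 + (i + 1) = 2 * M + 1 + i + 2 by ring, pow_add _ _ 2, neg_one_sq, mul_one]
  rw [Finset.sum_congr rfl e, this, Even.neg_one_pow ⟨M + 1, by ring⟩]
  simp

theorem alternating_sum_succ_div_two' (h : ℕ → ℤ[X]) (M : ℕ) :
    ∑ i ∈ Finset.range (2 * M + 3), (-1) ^ (2 * M + 2 + i) * h ((i + 1) / 2) = h 0 := by
  rw [Finset.sum_range_succ]
  have := alternating_sum_succ_div_two h M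
  have e : ∀ i ∈ Finset.range (2 * M + 2), (-1 : ℤ[X]) ^ (2 * M + 2 + i) * h ((i + 1) / 2) =
      -((-1) ^ (2 * M + 1 + i) * h ((i + 1) / 2)) := by
    intro i _
    rw [show 2 * M + 2 + i = 2 * M + 1 + i + 1 by ring, pow_add _ _ 1]
    ring
  rw [Finset.sum_congr rfl e, Finset.sum_neg_distrib, this, Even.neg_one_pow ⟨2 * M + 2, by ring⟩,
    show (2 * M + 2 + 1) / 2 = M + 1 by omega]
  ring

theorem count_odd (M j : ℕ) : ∑ v ∈ Finset.Icc (1 : ℤ) ((2 * M + 1 : ℕ) : ℤ),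
    (if Odd v ∧ (j : ℤ) ≤ v then 1 else 0) = M + 1 - j / 2 := by
  induction M with
  | zero =>
    simp only [Nat.mul_zero, Nat.zero_add, Nat.cast_one, Finset.Icc_self, Finset.sum_singleton,
      Int.odd_iff]
    split_ifs <;> omega
  | succ M ih =>
    rw [show 2 * (M + 1) + 1 = 2 * M + 1 + 1 + 1 by ring, Icc_succ,
      Finset.sum_insert (succ_notMem_Icc _), Icc_succ, Finset.sum_insert (succ_notMem_Icc _), ih]
    simp only [Int.odd_iff]
    push_cast
    split_ifs <;> omega

theorem count_even (M j : ℕ) : ∑ v ∈ Finset.Icc (1 : ℤ) ((2 * M : ℕ) : ℤ),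
    (if Even v ∧ ((j + 1 : ℕ) : ℤ) ≤ v then 1 else 0) = M - j / 2 := by
  induction M with
  | zero => simp
  | succ M ih =>
    rw [show 2 * (M + 1) = 2 * M + 1 + 1 by ring, Icc_succ,
      Finset.sum_insert (succ_notMem_Icc _), Icc_succ, Finset.sum_insert (succ_notMem_Icc _), ih]
    simp only [Int.even_iff]
    push_cast
    split_ifs <;> omega

/-- `X^(N - t) + X^(N + t)` for `t ≤ N`. -/
noncomputable def symPow (N t : ℕ) : ℤ[X] :=
  Polynomial.X ^ (N - t) + Polynomial.X ^ (2 * N - (N - t))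

/-- With the odd values in the odd positions, `numOpp` counts the odd values that are at least i+1.
The factor therefore depends on i only through its sign and ⌊(i+1)/2⌋, which is what makes the sum
telescope. -/
theorem lastFactor_evens (M i : ℕ) : lastFactor (2 * M + 1) (evens (2 * M + 1)) i =
    (-1) ^ (2 * M + 1 + i) * symPow (M + 1) ((i + 1) / 2) := by
  have : numOpp (2 * M + 1) (evens (2 * M + 1)) (i + 1) = M + 1 - (i + 1) / 2 := by
    rw [← count_odd M (i + 1)]
    refine Finset.sum_congr rfl fun v hv => ?_
    have h1 : (Even (2 * M + 1) ↔ v ∈ evens (2 * M + 1)) ↔ Odd v := by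
      rw [evens, Finset.mem_filter, ← Int.not_even_iff_odd]
      have : ¬ Even (2 * M + 1) := by rw [Nat.even_iff]; omega
      tauto
    simp only [h1]
  rw [lastFactor, this, symPow, show (2 * M + 1 + 1) / 2 = M + 1 by omega]

theorem lastFactor_even (M i : ℕ) {V : Finset ℤ}
    (hV : ∀ v ∈ Finset.Icc (1 : ℤ) ((2 * M + 2 : ℕ) : ℤ), v ∈ V ↔ Even v) :
    lastFactor (2 * M + 2) V i = (-1) ^ (2 * M + 2 + i) * symPow (M + 1) (i / 2) := by
  have : numOpp (2 * M + 2) V (i + 1) = M + 1 - i / 2 := by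
    rw [← count_even (M + 1) i]
    refine Finset.sum_congr rfl fun v hv => ?_
    have h1 : (Even (2 * M + 2) ↔ v ∈ V) ↔ Even v := by
      rw [hV v hv]
      have : Even (2 * M + 2) := by rw [Nat.even_iff]; omega
      tauto
    simp only [h1]
  rw [lastFactor, this, symPow, show (2 * M + 2 + 1) / 2 = M + 1 by omega]

theorem lastFactor_odd (M i : ℕ) {V : Finset ℤ}
    (hV : ∀ v ∈ Finset.Icc (1 : ℤ) ((2 * M + 2 : ℕ) : ℤ), v ∈ V ↔ Odd v) :
    lastFactor (2 * M + 2) V i = (-1) ^ (2 * M + 2 + i) * symPow (M + 1) ((i + 1) / 2) := by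
  have : numOpp (2 * M + 2) V (i + 1) = M + 1 - (i + 1) / 2 := by
    rw [← count_odd M (i + 1)]
    have : numOpp (2 * M + 2) V (i + 1) = ∑ v ∈ Finset.Icc (1 : ℤ) ((2 * M + 1 + 1 : ℕ) : ℤ),
        (if Odd v ∧ ((i + 1 : ℕ) : ℤ) ≤ v then 1 else 0) := by
      refine Finset.sum_congr rfl fun v hv => ?_
      have h1 : (Even (2 * M + 2) ↔ v ∈ V) ↔ Odd v := by
        rw [hV v hv]
        have : Even (2 * M + 2) := by rw [Nat.even_iff]; omega
        tauto
      simp only [h1]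
    rw [this, Icc_succ, Finset.sum_insert (succ_notMem_Icc _), if_neg, zero_add]
    rw [Int.odd_iff]
    push_cast
    omega
  rw [lastFactor, this, symPow, show (2 * M + 2 + 1) / 2 = M + 1 by omega]

/-- The end terms of the telescoping sum are `symPow (M + 1) (M + 1)` and `symPow (M + 1) 0`, with
difference 1 + X^{2M+2} - 2X^{M+1}. -/
theorem F_succ_of_odd {M : ℕ} (hM : 1 ≤ M) {I : Finset ℕ} (hI : I ⊆ Finset.range (2 * M + 1))
    (h0 : 0 ∈ I) (h1 : 1 ∈ I) :
    F (2 * M + 2) I = F (2 * M + 1) I * (1 - Polynomial.X ^ (M + 1)) ^ 2 := by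
  rw [F_succ (by omega) hI h0 h1, sum_wt_evenVals hM hI
    (fun V => ∑ j ∈ Finset.range (2 * M + 1 + 1), lastFactor (2 * M + 1) V j)]
  congr 1
  rw [Finset.sum_congr rfl fun j _ => lastFactor_evens M j, alternating_sum_succ_div_two]
  simp only [symPow, Nat.sub_self, Nat.sub_zero, pow_zero]
  rw [show 2 * (M + 1) - (M + 1) = M + 1 by omega, mul_comm 2 (M + 1), pow_mul]
  ring

/-- The even values after the insertion of a last entry `±(j + 1)` in an even position. -/
noncomputable def insertVal (j : ℕ) (V : Finset ℤ) : Finset ℤ :=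
  insert ((j : ℤ) + 1) (V.image fun v => if (j : ℤ) + 1 ≤ v then v + 1 else v)

theorem evenVals_insert {n j : ℕ} (hn : Odd n) {f τ : ℤ → ℤ} (hlast : |f (n + 1)| = j + 1)
    (h : ∀ i : ℤ, 1 ≤ i → i ≤ n → |f i| = if (j : ℤ) + 1 ≤ |τ i| then |τ i| + 1 else |τ i|) :
    evenVals (n + 1) f = insertVal j (evenVals n τ) := by
  have heven : Even ((n : ℤ) + 1) := by
    rw [Nat.odd_iff] at hn
    rw [Int.even_iff]
    omega
  unfold evenVals insertVal
  rw [Icc_succ, Finset.filter_insert, if_pos heven, Finset.image_insert, hlast, Finset.image_image]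
  congr 1
  refine Finset.image_congr fun i hi => ?_
  simp only [Finset.coe_filter, Finset.mem_Icc, Set.mem_ofPred_eq] at hi
  exact h i hi.1.1 hi.1.2

/-- Values up to j keep their parity and larger ones are shifted by one, while j+1 fits either
pattern. The set consists of even numbers up to 2t and odd numbers beyond, so it depends on j only
through t = ⌊(j+1)/2⌋. -/
theorem mem_insertVal_evens {M j : ℕ} (hj : j ≤ 2 * M + 1) {v : ℤ}
    (hv : v ∈ Finset.Icc (1 : ℤ) ((2 * M + 2 : ℕ) : ℤ)) :
    v ∈ insertVal j (evens (2 * M + 1)) ↔ (Even v ↔ v ≤ 2 * ((j + 1) / 2 : ℕ)) := by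
  rw [Finset.mem_Icc] at hv
  simp only [insertVal, evens, Finset.mem_insert, Finset.mem_image, Finset.mem_filter,
    Finset.mem_Icc, Int.even_iff]
  push_cast at *
  constructor
  · rintro (h | ⟨w, h1, h2⟩)
    · omega
    · split_ifs at h2 <;> omega
  · intro h
    by_cases h1 : v = j + 1
    · exact Or.inl h1
    · by_cases h2 : v ≤ j
      · exact Or.inr ⟨v, by omega, by rw [if_neg (by omega)]⟩
      · exact Or.inr ⟨v - 1, by omega, by rw [if_pos (by omega)]; ring⟩

theorem numOpp_congr {n : ℕ} {V W : Finset ℤ} (h : ∀ v ∈ Finset.Icc (1 : ℤ) n, v ∈ V ↔ v ∈ W)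
    (j : ℕ) : numOpp n V j = numOpp n W j :=
  Finset.sum_congr rfl fun v hv => by simp only [h v hv]

/-- The set of even values is under control only in odd degree, so two entries are inserted into
degree 2M+1. With Y = X^{M+1}, the double sum telescopes to (1 + Y²)² - (2Y)² = (1 - Y)²(1 + Y)²,
and `F_succ_of_odd` accounts for (1 - Y)². -/
theorem F_succ_succ_of_odd {M : ℕ} (hM : 1 ≤ M) {I : Finset ℕ}
    (hI : I ⊆ Finset.range (2 * M + 1)) (h0 : 0 ∈ I) (h1 : 1 ∈ I) :
    F (2 * M + 3) I = F (2 * M + 2) I * (1 + Polynomial.X ^ (M + 1)) ^ 2 := by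
  have hI' : I ⊆ Finset.range (2 * M + 2) :=
    hI.trans (Finset.range_subset_range.mpr (by omega))
  obtain ⟨G, hG⟩ : ∃ G : Finset ℤ → ℤ[X], G = fun V =>
    ∑ j ∈ Finset.range (2 * M + 2 + 1), lastFactor (2 * M + 2) V j := ⟨_, rfl⟩
  have hins : ∀ τ ∈ ascSet (2 * M + 1) I, ∀ j ≤ 2 * M + 1,
      G (evenVals (2 * M + 2) (insertLast (2 * M + 1) j τ)) =
        G (insertVal j (evenVals (2 * M + 1) τ)) ∧
      G (evenVals (2 * M + 2) ↑(insertLast (2 * M + 1) j τ *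
        signFlip 1 ((2 * M + 1 : ℕ) + 1))) = G (insertVal j (evenVals (2 * M + 1) τ)) := by
    intro τ hτ j hj
    obtain ⟨-, f1, f2, f3⟩ := insertLast_facts (by omega) hj (mem_ascSet.mp hτ).1
    have a1 : |(j : ℤ) + 1| = j + 1 := abs_of_pos (by omega)
    have hodd : Odd (2 * M + 1) := ⟨M, rfl⟩
    exact ⟨congrArg G (evenVals_insert hodd (by rw [f1, a1]) f2),
      congrArg G (evenVals_insert hodd (by rw [f3 _ (by omega), f1, a1])
        fun i h1 h2 => by rw [f3 i h1, f2 i h1 h2])⟩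
  have hbot : G (insertVal 0 (evens (2 * M + 1))) = symPow (M + 1) 0 := by
    have hV : ∀ v ∈ Finset.Icc (1 : ℤ) ((2 * M + 2 : ℕ) : ℤ),
        v ∈ insertVal 0 (evens (2 * M + 1)) ↔ Odd v := by
      intro v hv
      rw [mem_insertVal_evens (by omega) hv]
      rw [Finset.mem_Icc] at hv
      rw [Int.even_iff, Int.odd_iff]
      omega
    rw [hG]
    dsimp only
    rw [Finset.sum_congr rfl fun j _ => lastFactor_odd M j hV, alternating_sum_succ_div_two']
  have htop : G (insertVal (2 * M + 1) (evens (2 * M + 1))) = symPow (M + 1) (M + 1) := by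
    have hV : ∀ v ∈ Finset.Icc (1 : ℤ) ((2 * M + 2 : ℕ) : ℤ),
        v ∈ insertVal (2 * M + 1) (evens (2 * M + 1)) ↔ Even v := by
      intro v hv
      rw [mem_insertVal_evens le_rfl hv]
      rw [Finset.mem_Icc] at hv
      rw [Int.even_iff]
      omega
    rw [hG]
    dsimp only
    rw [Finset.sum_congr rfl fun j _ => lastFactor_even M j hV, alternating_sum_div_two]
  -- The index 2t - 1 represents all j with ⌊(j+1)/2⌋ = t. For t = 0 truncated subtraction gives 0,
  -- which is the right representative.
  have hiff : ∀ j < 2 * M + 2, ∀ v ∈ Finset.Icc (1 : ℤ) ((2 * M + 2 : ℕ) : ℤ),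
      v ∈ insertVal j (evens (2 * M + 1)) ↔
        v ∈ insertVal (2 * ((j + 1) / 2) - 1) (evens (2 * M + 1)) := by
    intro j hj v hv
    rw [mem_insertVal_evens (by omega) hv, mem_insertVal_evens (by omega) hv,
      show (2 * ((j + 1) / 2) - 1 + 1) / 2 = (j + 1) / 2 by omega]
  have hpair : ∀ j ∈ Finset.range (2 * M + 2), lastFactor (2 * M + 1) (evens (2 * M + 1)) j *
      G (insertVal j (evens (2 * M + 1))) = (-1) ^ (2 * M + 1 + j) *
      (fun t => symPow (M + 1) t * G (insertVal (2 * t - 1) (evens (2 * M + 1)))) ((j + 1) / 2) := by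
    intro j hj
    rw [Finset.mem_range] at hj
    rw [lastFactor_evens, mul_assoc]
    dsimp only
    have hGG : G (insertVal j (evens (2 * M + 1))) =
        G (insertVal (2 * ((j + 1) / 2) - 1) (evens (2 * M + 1))) := by
      rw [hG]
      refine Finset.sum_congr rfl fun i _ => ?_
      unfold lastFactor
      rw [numOpp_congr (hiff j hj)]
    rw [hGG]
  have hmain : F (2 * M + 3) I = F (2 * M + 1) I * (1 - Polynomial.X ^ (M + 1)) ^ 2 *
      (1 + Polynomial.X ^ (M + 1)) ^ 2 := by
    have hF := F_succ (n := 2 * M + 2) (by omega) hI' h0 h1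
    have hG' : ∀ V, ∑ j ∈ Finset.range (2 * M + 2 + 1), lastFactor (2 * M + 2) V j = G V :=
      fun V => by rw [hG]
    simp only [hG'] at hF
    rw [show 2 * M + 3 = 2 * M + 2 + 1 by rfl, hF,
      sum_wt_succ (n := 2 * M + 1) (by omega) hI h0 h1
        (fun σ => G (evenVals (2 * M + 2) σ))
        (fun j τ => G (insertVal j (evenVals (2 * M + 1) τ))) hins,
      sum_wt_evenVals hM hI (fun V => ∑ j ∈ Finset.range (2 * M + 1 + 1),
        lastFactor (2 * M + 1) V j * G (insertVal j V)), mul_assoc]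
    congr 1
    refine ((Finset.sum_congr rfl hpair).trans (alternating_sum_succ_div_two
      (fun t => symPow (M + 1) t * G (insertVal (2 * t - 1) (evens (2 * M + 1)))) M)).trans ?_
    rw [show 2 * (M + 1) - 1 = 2 * M + 1 by omega, htop, show 2 * 0 - 1 = 0 by rfl, hbot]
    simp only [symPow, Nat.sub_self, Nat.sub_zero, pow_zero]
    rw [show 2 * (M + 1) - (M + 1) = M + 1 by omega, mul_comm 2 (M + 1), pow_mul]
    ring
  rw [hmain, F_succ_of_odd hM hI h0 h1]

/-- The free positions at the end contribute a product. -/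
theorem F_eq_mul_prod {M : ℕ} (hM : 1 ≤ M) {I : Finset ℕ} (hI : I ⊆ Finset.range (2 * M + 1))
    (h0 : 0 ∈ I) (h1 : 1 ∈ I) (n : ℕ) (hn : 2 * M + 1 ≤ n) :
    F n I = F (2 * M + 1) I * ∏ j ∈ Finset.Icc (2 * M + 2) n,
      (1 + (-1 : ℤ[X]) ^ (j - 1) * Polynomial.X ^ (j / 2)) ^ 2 := by
  induction n, hn using Nat.le_induction with
  | base => simp
  | succ n hn ih =>
    rw [← Finset.insert_Icc_right_eq_Icc_add_one (by omega), Finset.prod_insert (by simp),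
      mul_left_comm, ← ih, mul_comm]
    obtain ⟨k, hk | hk⟩ := Nat.even_or_odd' n
    · obtain ⟨k, rfl⟩ : ∃ k', k = k' + 1 := ⟨k - 1, by omega⟩
      have := F_succ_succ_of_odd (M := k) (by omega)
        (hI.trans (Finset.range_subset_range.mpr (by omega))) h0 h1
      subst hk
      rw [show 2 * (k + 1) + 1 = 2 * k + 3 by ring, this,
        show 2 * k + 3 - 1 = 2 * (k + 1) by omega, show (2 * k + 3) / 2 = k + 1 by omega, pow_mul,
        neg_one_sq, one_pow, one_mul]
      rfl
    · have := F_succ_of_odd (M := k) (by omega)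
        (hI.trans (Finset.range_subset_range.mpr (by omega))) h0 h1
      subst hk
      rw [show 2 * k + 1 + 1 = 2 * k + 2 by ring, this,
        show 2 * k + 2 - 1 = 2 * k + 1 by omega, show (2 * k + 2) / 2 = k + 1 by omega,
        Odd.neg_one_pow ⟨k, rfl⟩]
      ring

/-! ### Components of a set of the form `blocks s a`. -/

theorem mem_blocks {s : ℕ} {a : ℕ → ℕ} {x : ℕ} :
    x ∈ blocks s a ↔ x < a 0 ∨ ∃ k < s, a k + 1 ≤ x ∧ x < a (k + 1) := by
  simp only [blocks, Finset.mem_union, Finset.mem_Ico, Finset.mem_biUnion, Finset.mem_Icc]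
  refine or_congr (by omega) ⟨?_, ?_⟩
  · rintro ⟨k, h1, h2⟩
    exact ⟨k - 1, by omega, by rwa [Nat.sub_add_cancel h1.1]⟩
  · rintro ⟨k, h1, h2⟩
    exact ⟨k + 1, by omega, by simpa using h2⟩

theorem blocks_succ (s : ℕ) (a : ℕ → ℕ) :
    blocks (s + 1) a = blocks s a ∪ Finset.Ico (a s + 1) (a (s + 1)) := by
  ext x
  rw [Finset.mem_union, mem_blocks, mem_blocks, Finset.mem_Ico, or_assoc]
  refine or_congr Iff.rfl ⟨?_, ?_⟩
  · rintro ⟨k, h1, h2⟩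
    rcases Nat.lt_succ_iff_lt_or_eq.mp h1 with h | rfl
    · exact Or.inl ⟨k, h, h2⟩
    · exact Or.inr h2
  · rintro (⟨k, h1, h2⟩ | h)
    · exact ⟨k, by omega, h2⟩
    · exact ⟨s, by omega, h⟩

theorem add_two_mul_le {s : ℕ} {a : ℕ → ℕ} (ha : ∀ k < s, a k + 2 ≤ a (k + 1)) {j k : ℕ}
    (hjk : j ≤ k) (hk : k ≤ s) : a j + 2 * (k - j) ≤ a k := by
  induction k, hjk using Nat.le_induction with
  | base => simp
  | succ k h ih =>
    have := ih (by omega)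
    have := ha k (by omega)
    omega

theorem blocks_subset_range {s : ℕ} {a : ℕ → ℕ} (ha : ∀ k < s, a k + 2 ≤ a (k + 1)) :
    blocks s a ⊆ Finset.range (a s) := by
  intro x hx
  rw [Finset.mem_range]
  rcases mem_blocks.mp hx with h | ⟨k, h1, h2⟩
  · have := add_two_mul_le ha (Nat.zero_le s) le_rfl
    omega
  · have := add_two_mul_le ha (j := k + 1) (by omega) le_rfl
    omega

theorem runFrom_eq {I : Finset ℕ} {a c : ℕ} (h1 : ∀ j, a ≤ j → j < a + c → j ∈ I)
    (h2 : a + c ∉ I) : runFrom I a = Finset.Ico a (a + c) := by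
  ext j
  simp only [runFrom, Finset.mem_filter, Finset.mem_Ico]
  constructor
  · rintro ⟨h3, h4, h5⟩
    refine ⟨h4, ?_⟩
    by_contra h
    exact h2 (h5 (Finset.mem_Icc.mpr (by omega)))
  · rintro ⟨h3, h4⟩
    refine ⟨h1 j h3 h4, h3, fun i hi => ?_⟩
    rw [Finset.mem_Icc] at hi
    exact h1 i hi.1 (by omega)

theorem exists_runFrom (I : Finset ℕ) (a : ℕ) : ∃ c, runFrom I a = Finset.Ico a (a + c) ∧
    (∀ j, a ≤ j → j < a + c → j ∈ I) ∧ a + c ∉ I := by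
  have hex : ∃ c, a + c ∉ I := by
    refine ⟨I.sup id + 1, fun h => ?_⟩
    have : a + (I.sup id + 1) ≤ I.sup id := Finset.le_sup (f := id) h
    omega
  refine ⟨Nat.find hex, ?_⟩
  have h1 : ∀ j, a ≤ j → j < a + Nat.find hex → j ∈ I := by
    intro j h1 h2
    have := Nat.find_min hex (m := j - a) (by omega)
    rwa [not_not, Nat.add_sub_cancel' h1] at this
  exact ⟨runFrom_eq h1 (Nat.find_spec hex), h1, Nat.find_spec hex⟩

theorem sum_starts (I : Finset ℕ) (f : ℕ → ℕ) :
    ∑ k ∈ Finset.range (numComponents I), f (Nat.nth (fun a => a ∈ starts I) k) =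
      ∑ a ∈ starts I, f a := by
  have hf : {a | a ∈ starts I}.Finite := (starts I).finite_toSet
  have hc : hf.toFinset.card = numComponents I := by
    rw [numComponents]
    congr 1
    ext a
    simp
  refine Finset.sum_bij (fun k _ => Nat.nth (fun a => a ∈ starts I) k) ?_ ?_ ?_ (fun _ _ => rfl)
  · intro k hk
    exact Nat.nth_mem_of_lt_card hf (by rw [hc]; exact Finset.mem_range.mp hk)
  · intro k hk l hl h
    rw [Finset.mem_range, ← hc] at hk hl
    exact Nat.nth_injOn hf hk hl h
  · intro a ha
    obtain ⟨k, hk, h⟩ := Nat.exists_lt_card_finite_nth_eq hf ha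
    exact ⟨k, Finset.mem_range.mpr (by rwa [← hc]), h⟩

theorem m_eq_sum_starts (I : Finset ℕ) :
    m I = ((runFrom I 0).card + 1) / 2 + ∑ a ∈ starts I, ((runFrom I a).card + 1) / 2 := by
  rw [m, Finset.sum_range_succ', add_comm, ← sum_starts]
  rfl

/-- Steps of at least 2 make every interval after the first nonempty, and the points a_k are
missing, so these intervals are exactly the components. -/
theorem m_blocks {s : ℕ} {a : ℕ → ℕ} (ha : ∀ k < s, a k + 2 ≤ a (k + 1)) :
    m (blocks s a) = (a 0 + 1) / 2 + ∑ k ∈ Finset.range s, (a (k + 1) - a k) / 2 := by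
  have hle := fun {j k : ℕ} => add_two_mul_le ha (j := j) (k := k)
  have hnot : ∀ j ≤ s, a j ∉ blocks s a := by
    intro j hj h
    rcases mem_blocks.mp h with h | ⟨k, h1, h2⟩
    · have := hle (Nat.zero_le j) hj; omega
    · rcases Nat.lt_or_ge j (k + 1) with h | h
      · have := hle (show j ≤ k by omega) (by omega); omega
      · have := hle h hj; omega
  have h0 : runFrom (blocks s a) 0 = Finset.Ico 0 (0 + a 0) :=
    runFrom_eq (fun j _ h => mem_blocks.mpr (Or.inl (by omega)))
      (by rw [zero_add]; exact hnot 0 (Nat.zero_le _))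
  have hk : ∀ k < s, runFrom (blocks s a) (a k + 1) =
      Finset.Ico (a k + 1) (a k + 1 + (a (k + 1) - a k - 1)) := by
    intro k hk
    have := ha k hk
    refine runFrom_eq (fun j h1 h2 => mem_blocks.mpr (Or.inr ⟨k, hk, h1, by omega⟩)) ?_
    rw [show a k + 1 + (a (k + 1) - a k - 1) = a (k + 1) by omega]
    exact hnot (k + 1) hk
  have hst : starts (blocks s a) = (Finset.range s).image fun k => a k + 1 := by
    ext x
    simp only [starts, Finset.mem_filter, Finset.mem_image, Finset.mem_range]
    constructor
    · rintro ⟨h1, h2, h3⟩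
      rcases mem_blocks.mp h1 with h | ⟨k, hks, h4, h5⟩
      · exact absurd (mem_blocks.mpr (Or.inl (by omega))) h3
      · refine ⟨k, hks, ?_⟩
        by_contra hne
        exact h3 (mem_blocks.mpr (Or.inr ⟨k, hks, by omega, by omega⟩))
    · rintro ⟨k, hks, rfl⟩
      have := ha k hks
      exact ⟨mem_blocks.mpr (Or.inr ⟨k, hks, le_rfl, by omega⟩), by omega,
        by simpa using hnot k hks.le⟩
  rw [m_eq_sum_starts, h0, hst, Finset.sum_image]
  · congr 1
    · simp
    · refine Finset.sum_congr rfl fun k hks => ?_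
      rw [Finset.mem_range] at hks
      have := ha k hks
      rw [hk k hks, Nat.card_Ico]
      congr 1
      omega
  · intro j hj k hk h
    simp only [Finset.coe_range, Set.mem_Iio] at hj hk
    dsimp only at h
    rcases lt_trichotomy j k with h' | h' | h'
    · have := hle h'.le hk.le; omega
    · exact h'
    · have := hle h'.le hj.le; omega

/-- All differences are even, so halving loses nothing and the sum telescopes. Thus 2m - 1 = a_s, an
odd degree in which no position after the last interval is free. -/
theorem two_mul_m_blocks {s : ℕ} {a : ℕ → ℕ} (ha : ∀ k < s, a k + 2 ≤ a (k + 1))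
    (hpar : ∀ k < s, a (k + 1) % 2 = a k % 2) (hodd : Odd (a 0)) :
    2 * m (blocks s a) = a s + 1 := by
  rw [m_blocks ha]
  rw [Nat.odd_iff] at hodd
  have key : ∀ t ≤ s, 2 * ∑ k ∈ Finset.range t, (a (k + 1) - a k) / 2 + a 0 = a t := by
    intro t
    induction t with
    | zero => simp
    | succ t ih =>
      intro ht
      have h1 := ih (by omega)
      have h2 := ha t (by omega)
      have h3 := hpar t (by omega)
      rw [Finset.sum_range_succ]
      omega
  have := key s le_rfl
  omega

theorem F_blocks {s n : ℕ} {a : ℕ → ℕ} (ha : ∀ k < s, a k + 2 ≤ a (k + 1))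
    (hpar : ∀ k < s, a (k + 1) % 2 = a k % 2) (hodd : Odd (a 0)) (h2 : 2 ≤ a 0) (hn : a s ≤ n) :
    2 * m (blocks s a) - 1 ≤ n ∧ IsCompressed (2 * m (blocks s a) - 1) (blocks s a) ∧
    F n (blocks s a) = genFun (2 * m (blocks s a) - 1) (blocks s a) *
      ∏ j ∈ Finset.Icc (2 * m (blocks s a)) n,
        (1 + (-1 : ℤ[X]) ^ (j - 1) * Polynomial.X ^ (j / 2)) ^ 2 := by
  have hle := add_two_mul_le ha (Nat.zero_le s) le_rfl
  have hpar' : ∀ k ≤ s, a k % 2 = a 0 % 2 := by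
    intro k
    induction k with
    | zero => simp
    | succ k ih => exact fun hk => (hpar k (by omega)).trans (ih (by omega))
  rw [two_mul_m_blocks ha hpar hodd, Nat.add_sub_cancel]
  refine ⟨hn, ⟨s, a, fun k hk => by have := ha k hk; omega, le_rfl, fun k hk => hpar' k hk, rfl⟩,
    ?_⟩
  rw [genFun_eq_F (by omega) (blocks_subset_range ha)]
  have := hpar' s le_rfl
  rw [Nat.odd_iff] at hodd
  obtain ⟨M, hM⟩ : ∃ M, a s = 2 * M + 1 := ⟨a s / 2, by omega⟩
  have hsub := blocks_subset_range ha
  rw [hM] at hsub hn ⊢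
  exact F_eq_mul_prod (by omega) hsub (mem_blocks.mpr (Or.inl (by omega)))
    (mem_blocks.mpr (Or.inl (by omega))) n hn

/-! ### Compressing the components. -/

theorem F_shift {n h u p : ℕ} (hh : 1 ≤ h) (hu : 2 ≤ u) (hup : u ≤ p) (hn : p + 2 * h ≤ n)
    {I₀ : Finset ℕ} (h0 : ∀ i ∈ I₀, i < u ∨ p + 2 * h < i) :
    F n (I₀ ∪ Finset.Icc (p + 1) (p + 2 * h - 1)) =
      F n (I₀ ∪ Finset.Icc (u + 1) (u + 2 * h - 1)) := by
  induction p, hup using Nat.le_induction with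
  | base => rfl
  | succ p hp ih =>
    -- The block moves one place to the left: `F_prepend` joins the free position in front of it,
    -- and `F_append` read backwards releases its last position.
    rw [← ih (by omega) (fun i hi => by have := h0 i hi; omega),
      show p + 1 + 2 * h - 1 = p + 2 * h by omega, show p + 1 + 1 = p + 2 by omega,
      F_prepend (by omega) hh (by omega) (fun i hi => by have := h0 i hi; omega),
      F_append (by omega) hh (by omega) (fun i hi => by have := h0 i hi; omega)]

/-- A component of even size c loses its last ascent by `F_append` read backwards, and one of odd
size is kept. The resulting block has an even number 2⌊(c+1)/2⌋ of entries and can be shifted. -/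
theorem F_compress_component {n c u p : ℕ} (hc : 1 ≤ c) (hu : 2 ≤ u) (hup : u ≤ p)
    (hn : p + c + 1 ≤ n) {I₀ : Finset ℕ} (h0 : ∀ i ∈ I₀, i < u ∨ p + c + 1 < i) :
    F n (I₀ ∪ Finset.Icc (p + 1) (p + c)) =
      F n (I₀ ∪ Finset.Icc (u + 1) (u + 2 * ((c + 1) / 2) - 1)) := by
  obtain ⟨h, rfl | rfl⟩ := Nat.even_or_odd' c
  · rw [← F_append (by omega) (by omega) hn (fun i hi => by have := h0 i hi; omega),
      F_shift (by omega) hu hup (by omega) (fun i hi => by have := h0 i hi; omega),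
      show (2 * h + 1) / 2 = h by omega]
  · rw [show p + (2 * h + 1) = p + 2 * (h + 1) - 1 by omega,
      F_shift (by omega) hu hup (by omega) (fun i hi => by have := h0 i hi; omega),
      show (2 * h + 1 + 1) / 2 = h + 1 by omega]

theorem component_zero (I : Finset ℕ) : component I 0 = Finset.range (component I 0).card := by
  obtain ⟨c, h, -⟩ := exists_runFrom I 0
  have : component I 0 = Finset.range c := by
    rw [component, h, zero_add, Finset.range_eq_Ico]
  rw [this, Finset.card_range]

/-- The positions of the connected components other than `I_0`. -/
theorem exists_components (I : Finset ℕ) : ∃ p : ℕ → ℕ,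
    (∀ k < numComponents I, component I (k + 1) =
      Finset.Icc (p k + 1) (p k + (component I (k + 1)).card) ∧
      1 ≤ (component I (k + 1)).card ∧ (component I 0).card ≤ p k) ∧
    (∀ k, k + 1 < numComponents I → p k + (component I (k + 1)).card + 1 ≤ p (k + 1)) ∧
    I = Finset.range (component I 0).card ∪
      (Finset.Icc 1 (numComponents I)).biUnion (component I) := by
  have hf : {a | a ∈ starts I}.Finite := (starts I).finite_toSet
  have hc : hf.toFinset.card = numComponents I := by
    rw [numComponents]
    congr 1
    ext a
    simp
  have hmem : ∀ k < numComponents I, Nat.nth (fun a => a ∈ starts I) k ∈ starts I := fun k hk =>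
    Nat.nth_mem_of_lt_card hf (by rwa [hc])
  have hrun : ∀ k < numComponents I,
      1 ≤ (component I (k + 1)).card ∧ 1 ≤ Nat.nth (fun a => a ∈ starts I) k ∧
      component I (k + 1) = Finset.Ico (Nat.nth (fun a => a ∈ starts I) k)
        (Nat.nth (fun a => a ∈ starts I) k + (component I (k + 1)).card) ∧
      (∀ j, Nat.nth (fun a => a ∈ starts I) k ≤ j →
        j < Nat.nth (fun a => a ∈ starts I) k + (component I (k + 1)).card → j ∈ I) ∧
      Nat.nth (fun a => a ∈ starts I) k - 1 ∉ I := by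
    intro k hk
    obtain ⟨h1, h2, h3⟩ := Finset.mem_filter.mp (hmem k hk)
    obtain ⟨c, h4, h5, h6⟩ := exists_runFrom I (Nat.nth (fun a => a ∈ starts I) k)
    have h7 : (component I (k + 1)).card = c := by
      rw [component, h4, Nat.card_Ico, Nat.add_sub_cancel_left]
    rw [h7]
    refine ⟨?_, by omega, h4, h5, h3⟩
    rcases Nat.eq_zero_or_pos c with rfl | h
    · exact absurd h1 h6
    · exact h
  have hzero : ∀ j < (component I 0).card, j ∈ I := by
    intro j hj
    obtain ⟨c, h4, h5, h6⟩ := exists_runFrom I 0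
    have : (component I 0).card = c := by rw [component, h4, Nat.card_Ico]; omega
    exact h5 j (Nat.zero_le _) (by omega)
  -- The number p k is one less than the least element of a component. That element is nonzero, so
  -- the subtraction is exact.
  refine ⟨fun k => Nat.nth (fun a => a ∈ starts I) k - 1, fun k hk => ?_, fun k hk => ?_, ?_⟩
  · obtain ⟨h1, h2, h3, h4, h5⟩ := hrun k hk
    dsimp only
    refine ⟨?_, h1, ?_⟩
    · nth_rewrite 1 [h3]
      ext j
      rw [Finset.mem_Ico, Finset.mem_Icc]
      omega
    · by_contra h
      exact h5 (hzero _ (by omega))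
  · obtain ⟨h1, h2, h3, h4, h5⟩ := hrun k (by omega)
    obtain ⟨-, h2', -, -, h5'⟩ := hrun (k + 1) hk
    have hlt : Nat.nth (fun a => a ∈ starts I) k < Nat.nth (fun a => a ∈ starts I) (k + 1) :=
      Nat.nth_lt_nth_of_lt_card hf (by omega) (by rwa [hc])
    dsimp only
    by_contra h
    exact h5' (h4 _ (by omega) (by omega))
  · ext x
    rw [Finset.mem_union, Finset.mem_range, Finset.mem_biUnion]
    constructor
    · intro hx
      have hex : ∃ a, a ≤ x ∧ Finset.Icc a x ⊆ I := ⟨x, le_rfl, by simpa using hx⟩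
      obtain ⟨h1, h2⟩ := Nat.find_spec hex
      rcases Nat.eq_zero_or_pos (Nat.find hex) with h | h
      · left
        have : x ∈ component I 0 := by
          rw [component, runFrom, Finset.mem_filter]
          exact ⟨hx, Nat.zero_le _, h ▸ h2⟩
        rwa [component_zero, Finset.mem_range] at this
      · right
        have hs : Nat.find hex ∈ starts I := by
          rw [starts, Finset.mem_filter]
          refine ⟨h2 (Finset.mem_Icc.mpr ⟨le_rfl, h1⟩), by omega, fun hm => ?_⟩
          refine Nat.find_min hex (m := Nat.find hex - 1) (by omega) ⟨by omega, fun y hy => ?_⟩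
          rw [Finset.mem_Icc] at hy
          rcases eq_or_lt_of_le hy.1 with h' | h'
          · rwa [← h']
          · exact h2 (Finset.mem_Icc.mpr (by omega))
        obtain ⟨k, hk, hk'⟩ := Nat.exists_lt_card_finite_nth_eq hf hs
        rw [hc] at hk
        refine ⟨k + 1, Finset.mem_Icc.mpr (by omega), ?_⟩
        rw [component, runFrom, Finset.mem_filter, hk']
        exact ⟨hx, h1, h2⟩
    · rintro (h | ⟨k, hk, h⟩)
      · exact hzero x h
      · rw [Finset.mem_Icc] at hk
        obtain ⟨k, rfl⟩ : ∃ k', k = k' + 1 := ⟨k - 1, by omega⟩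
        rw [component, runFrom, Finset.mem_filter] at h
        exact h.1

theorem b_zero (I : Finset ℕ) : b I 0 = (component I 0).card := by
  simp [b]

theorem b_succ (I : Finset ℕ) (k : ℕ) :
    b I (k + 1) = b I k + 2 * (((component I (k + 1)).card + 1) / 2) := by
  rw [b, b, Finset.sum_Icc_succ_top (by omega), add_assoc]

theorem b_add_two_le {I : Finset ℕ} : ∀ k < numComponents I, b I k + 2 ≤ b I (k + 1) := by
  obtain ⟨p, hp, -⟩ := exists_components I
  intro k hk
  have := (hp k hk).2.1
  rw [b_succ]
  omega

/-- Compressing the components does not change the signed weight enumerator. -/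
theorem F_compress {n : ℕ} {I : Finset ℕ} (hI : I ⊆ Finset.range n)
    (h0 : 2 ≤ (component I 0).card) : F n I = F n (compress I) ∧ b I (numComponents I) ≤ n := by
  obtain ⟨p, hp, hgap, hdec⟩ := exists_components I
  have hb : ∀ k < numComponents I, b I k ≤ p k := by
    intro k
    induction k with
    | zero => exact fun hk => by rw [b_zero]; exact (hp 0 hk).2.2
    | succ k ih =>
      intro hk
      have h1 := ih (by omega)
      have h2 := hgap k hk
      rw [b_succ]
      omega
  have hpn : ∀ k < numComponents I, p k + (component I (k + 1)).card + 1 ≤ n := by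
    intro k hk
    obtain ⟨h1, h2, h3⟩ := hp k hk
    have : p k + (component I (k + 1)).card ∈ I := by
      refine Finset.filter_subset _ _ ((Finset.ext_iff.mp h1 _).mpr (Finset.mem_Icc.mpr ?_))
      omega
    have := Finset.mem_range.mp (hI this)
    omega
  have hmono : ∀ j k, j < k → k < numComponents I →
      p j + (component I (j + 1)).card + 1 ≤ p k := by
    intro j k hjk
    induction k, hjk using Nat.le_induction with
    | base => exact hgap j
    | succ k h ih =>
      intro hk
      have h1 := ih (by omega)
      have h2 := hgap k hk
      omega
  -- After k steps the first k components after I_0 are in their compressed places and the others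
  -- have not moved. The bound b_k ≤ p k ensures that each shift goes to the left.
  have hsteps : ∀ k ≤ numComponents I, F n I = F n (blocks k (b I) ∪
      (Finset.Icc (k + 1) (numComponents I)).biUnion (component I)) := by
    intro k
    induction k with
    | zero =>
      intro _
      nth_rewrite 1 [hdec]
      congr 2
      ext x
      rw [mem_blocks, b_zero, Finset.mem_range]
      simp
    | succ k ih =>
      intro hk
      rw [ih (by omega)]
      have e1 : (Finset.Icc (k + 1) (numComponents I)).biUnion (component I) =
          component I (k + 1) ∪ (Finset.Icc (k + 2) (numComponents I)).biUnion (component I) := by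
        rw [← Finset.biUnion_insert]
        congr 1
        ext x
        simp only [Finset.mem_Icc, Finset.mem_insert]
        omega
      have e2 : blocks (k + 1) (b I) = blocks k (b I) ∪
          Finset.Icc (b I k + 1) (b I k + 2 * (((component I (k + 1)).card + 1) / 2) - 1) := by
        rw [blocks_succ]
        congr 1
        have := b_add_two_le k hk
        rw [b_succ] at *
        ext x
        rw [Finset.mem_Ico, Finset.mem_Icc]
        omega
      obtain ⟨h1, h2, h3⟩ := hp k hk
      rw [e1, e2, Finset.union_right_comm, Finset.union_comm (component I (k + 1)),
        ← Finset.union_assoc]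
      nth_rewrite 1 [h1]
      refine F_compress_component h2 ?_ (hb k hk) (hpn k hk) fun i hi => ?_
      · have := add_two_mul_le (a := b I) b_add_two_le (Nat.zero_le k) (by omega)
        rw [b_zero] at this
        omega
      · rw [Finset.mem_union, Finset.mem_biUnion] at hi
        rcases hi with hi | ⟨l, hl, hi⟩
        · left
          have := blocks_subset_range (s := k) (a := b I)
            (fun j hj => b_add_two_le j (by omega)) hi
          rwa [Finset.mem_range] at this
        · right
          rw [Finset.mem_Icc] at hl
          obtain ⟨l, rfl⟩ : ∃ l', l = l' + 1 := ⟨l - 1, by omega⟩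
          have := hmono k l (by omega) (by omega)
          rw [(hp l (by omega)).1, Finset.mem_Icc] at hi
          omega
  constructor
  · rw [hsteps _ le_rfl, compress]
    simp
  · rcases Nat.eq_zero_or_pos (numComponents I) with h | h
    · have : (component I 0).card - 1 ∈ I := by
        refine Finset.filter_subset _ _
          ((Finset.ext_iff.mp (component_zero I) _).mpr (Finset.mem_range.mpr ?_))
        omega
      have := Finset.mem_range.mp (hI this)
      rw [h, b_zero]
      omega
    · obtain ⟨k, hk⟩ : ∃ k, numComponents I = k + 1 := ⟨numComponents I - 1, by omega⟩
      -- If c is the size of the last component, then b_s ≤ p_{s-1} + 2⌊(c+1)/2⌋ ≤ p_{s-1} + c + 1 ≤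
      -- n.
      have h1 := hpn k (by omega)
      have h2 := hb k (by omega)
      rw [hk, b_succ]
      omega

/-- A free position at the end may be moved to the front and joined to an even first block. -/
theorem F_blocks_even {s n : ℕ} {a : ℕ → ℕ} (ha : ∀ k < s, a k + 2 ≤ a (k + 1))
    (hpar : ∀ k < s, a (k + 1) % 2 = a k % 2) (heven : Even (a 0)) (h2 : 2 ≤ a 0)
    (hn : a s + 1 ≤ n) :
    F n (blocks s a) = (1 + Polynomial.X ^ a 0) * F n (blocks s fun k => a k + 1) := by
  have hle := fun {j k : ℕ} => add_two_mul_le ha (j := j) (k := k)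
  -- The last d intervals have moved one place to the right. Each absorbs the free position behind
  -- it by `F_append` and releases the one in front of it by `F_prepend`; the first of these free
  -- positions is a_s + 1 ≤ n.
  have hsteps : ∀ d ≤ s, F n (blocks s a) = F n (blocks (s - d) a ∪
      (Finset.Icc (s - d + 1) s).biUnion fun k => Finset.Ico (a (k - 1) + 2) (a k + 1)) := by
    intro d
    induction d with
    | zero => simp
    | succ d ih =>
      intro hd
      rw [ih (by omega)]
      obtain ⟨k, hk⟩ : ∃ k, s - d = k + 1 := ⟨s - d - 1, by omega⟩
      have hk' : s - (d + 1) = k := by omega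
      rw [hk, hk']
      have hks : k < s := by omega
      have e1 : ((Finset.Icc (k + 1) s).biUnion fun k => Finset.Ico (a (k - 1) + 2) (a k + 1)) =
          Finset.Ico (a k + 2) (a (k + 1) + 1) ∪
          (Finset.Icc (k + 2) s).biUnion fun k => Finset.Ico (a (k - 1) + 2) (a k + 1) := by
        have : Finset.Icc (k + 1) s = insert (k + 1) (Finset.Icc (k + 2) s) := by
          ext x
          simp only [Finset.mem_Icc, Finset.mem_insert]
          omega
        rw [this, Finset.biUnion_insert, Nat.add_sub_cancel]
      have hak := ha k hks
      have hpk := hpar k hks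
      obtain ⟨h, hh⟩ : ∃ h, a (k + 1) = a k + 2 * h := ⟨(a (k + 1) - a k) / 2, by omega⟩
      have e2 : Finset.Ico (a k + 1) (a (k + 1)) = Finset.Icc (a k + 1) (a k + 2 * h - 1) := by
        ext x
        rw [Finset.mem_Ico, Finset.mem_Icc]
        omega
      have e3 : Finset.Ico (a k + 2) (a (k + 1) + 1) = Finset.Icc (a k + 2) (a k + 2 * h) := by
        ext x
        rw [Finset.mem_Ico, Finset.mem_Icc]
        omega
      have hak0 := hle (Nat.zero_le k) hks.le
      have has := hle (show k + 1 ≤ s by omega) le_rfl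
      have hI₀ : ∀ i ∈ blocks k a ∪
          (Finset.Icc (k + 2) s).biUnion (fun k => Finset.Ico (a (k - 1) + 2) (a k + 1)),
          i < a k ∨ a k + 2 * h + 1 < i := by
        intro i hi
        rw [Finset.mem_union, Finset.mem_biUnion] at hi
        rcases hi with hi | ⟨l, hl, hi⟩
        · left
          have := blocks_subset_range (s := k) (fun j hj => ha j (by omega)) hi
          rwa [Finset.mem_range] at this
        · right
          rw [Finset.mem_Icc] at hl
          rw [Finset.mem_Ico] at hi
          have := hle (show k + 1 ≤ l - 1 by omega) (by omega)
          omega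
      rw [e1, blocks_succ, Finset.union_right_comm, e2,
        Finset.union_comm (Finset.Ico (a k + 2) (a (k + 1) + 1)), ← Finset.union_assoc, e3,
        F_append (by omega) (by omega) (by omega) hI₀,
        F_prepend (by omega) (by omega) (by omega) hI₀]
  have h := hsteps s le_rfl
  rw [Nat.sub_self, zero_add] at h
  obtain ⟨c, hc⟩ := heven
  have hc' : a 0 = 2 * c := by omega
  have e0 : blocks 0 a = Finset.range (2 * c) := by
    ext x
    rw [mem_blocks, Finset.mem_range, hc']
    simp
  have has := hle (Nat.zero_le s) le_rfl
  -- The free position now directly follows the first block, which has an even number 2c of entries.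
  rw [h, e0, F_join_first (by omega) (by omega), hc']
  · congr 2
    ext x
    rw [Finset.mem_union, Finset.mem_range, Finset.mem_biUnion, mem_blocks, hc']
    refine or_congr Iff.rfl ⟨?_, ?_⟩
    · rintro ⟨k, hk, hx⟩
      rw [Finset.mem_Icc] at hk
      rw [Finset.mem_Ico] at hx
      exact ⟨k - 1, by omega, by omega, by rw [Nat.sub_add_cancel hk.1]; omega⟩
    · rintro ⟨k, hk, hx⟩
      refine ⟨k + 1, Finset.mem_Icc.mpr (by omega), ?_⟩
      rw [Finset.mem_Ico, Nat.add_sub_cancel]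
      omega
  · intro i hi
    rw [Finset.mem_biUnion] at hi
    obtain ⟨k, hk, hx⟩ := hi
    rw [Finset.mem_Icc] at hk
    rw [Finset.mem_Ico] at hx
    have := hle (Nat.zero_le (k - 1)) (by omega)
    omega

/-- For even b_0 the endpoints b_k + 1 are all odd, so `F_blocks` applies to this set as it does to
`compress I` for odd b_0. -/
theorem shiftedCompress_eq (I : Finset ℕ) :
    shiftedCompress I = blocks (numComponents I) fun k => b I k + 1 := by
  ext x
  rw [shiftedCompress, Finset.mem_union, Finset.mem_Icc, Finset.mem_biUnion, mem_blocks]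
  refine or_congr (by omega) ⟨?_, ?_⟩
  · rintro ⟨k, hk, hx⟩
    rw [Finset.mem_Icc] at hk hx
    exact ⟨k - 1, by omega, by omega, by rw [Nat.sub_add_cancel hk.1]; omega⟩
  · rintro ⟨k, hk, hx⟩
    refine ⟨k + 1, Finset.mem_Icc.mpr (by omega), ?_⟩
    rw [Finset.mem_Icc, Nat.add_sub_cancel]
    omega

end TypeD

open TypeD in
theorem mainTheorem8 (n : ℕ) (I : Finset ℕ) (hI : I ⊆ Finset.range n)
    (h0 : 2 ≤ (component I 0).card) :
    (Odd (component I 0).card →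
      2 * m (compress I) - 1 ≤ n ∧
      IsCompressed (2 * m (compress I) - 1) (compress I) ∧
      genFun n I = genFun (2 * m (compress I) - 1) (compress I) *
        ∏ j ∈ Finset.Icc (2 * m (compress I)) n,
          (1 + (-1 : ℤ[X]) ^ (j - 1) * Polynomial.X ^ (j / 2)) ^ 2) ∧
    (Even (component I 0).card → b I (numComponents I) ≤ n - 1 →
      2 * m (shiftedCompress I) - 1 ≤ n ∧
      IsCompressed (2 * m (shiftedCompress I) - 1) (shiftedCompress I) ∧
      genFun n I = (1 + Polynomial.X ^ b I 0) *
        genFun (2 * m (shiftedCompress I) - 1) (shiftedCompress I) *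
        ∏ j ∈ Finset.Icc (2 * m (shiftedCompress I)) n,
          (1 + (-1 : ℤ[X]) ^ (j - 1) * Polynomial.X ^ (j / 2)) ^ 2) := by
  obtain ⟨hF, hb⟩ := F_compress hI h0
  have hn : 2 ≤ n := by
    have := add_two_mul_le (a := b I) b_add_two_le (Nat.zero_le _) le_rfl
    rw [b_zero] at this
    omega
  have hpar : ∀ k < numComponents I, b I (k + 1) % 2 = b I k % 2 := fun k _ => by
    rw [b_succ, Nat.add_mul_mod_self_left]
  rw [genFun_eq_F hn hI, hF]
  constructor
  · intro hodd
    exact F_blocks b_add_two_le hpar (by rwa [b_zero]) (by rwa [b_zero]) hb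
  · intro heven hbn
    have h := F_blocks (s := numComponents I) (n := n) (a := fun k => b I k + 1)
      (fun k hk => by have := b_add_two_le k hk; omega)
      (fun k hk => by have := hpar k hk; omega)
      (by rw [b_zero]; exact heven.add_one) (by rw [b_zero]; omega) (by omega)
    rw [shiftedCompress_eq]
    refine ⟨h.1, h.2.1, ?_⟩
    rw [compress, F_blocks_even b_add_two_le hpar (by rwa [b_zero]) (by rwa [b_zero]) (by omega),
      h.2.2, mul_assoc]
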